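/- Let $d\in\mathbf N$, $1/4<H\le 1/2$, $(1+\lfloor 1/H\rfloor)^{-1}<\alpha<H$, and let $m$ be a positive integer with $H-\alpha>2/m$. Let $\mathfrak H$ be the Cameron--Martin space of $d$-dimensional fractional Brownian motion on $[0,1]$ with Hurst parameter $H$: the Hilbert space of functions $[0,1]\to\mathbf R^d$ obtained by completing the linear span of $R(t,\cdot)v$ ($t\in[0,1]$, $v\in\mathbf R^d$) under $\langle R(s,\cdot)v,R(t,\cdot)w\rangle=R(s,t)\langle v,w\rangle$, where $R(s,t)=\frac12(s^{2H}+t^{2H}-|t-s|^{2H})$. Put $N=\lfloor 1/\alpha\rfloor\in\{2,3\}$. For continuous families $x=(x^1,\dots,x^N)$ and $y=(y^1,\dots,y^N)$, with $x^i,y^i$ defined on $\{0\le s\le t\le1\}$ and taking values in $(\mathbf R^d)^{\otimes i}$, set $$\rho(x,y)=\sum_{i=1}^{N}\Big(\iint_{0\le s<t\le1}\frac{|x^i_{s,t}-y^i_{s,t}|^{12m/i}}{|t-s|^{1+12m\alpha}}\,ds\,dt\Big)^{i/(12m)} .$$ The geometric rough path space $G=G^{B}_{\alpha,12m}(\mathbf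 R^d)$ is the set of all such $x$ that are limits, with respect to $\rho$, of natural lifts (iterated integrals up to level $N$) of smooth paths; it carries the metric $\rho$. For $x\in G$ write $x_t=x^1_{0,t}$. For $x\in G$ and $\gamma\in\mathfrak H$ set $\gamma^1_{s,t}=\gamma_t-\gamma_s$, $\gamma^{i}_{s,t}=\int_s^t\gamma^{i-1}_{s,u}\otimes d\gamma_u$ ($i=2,3$), and \begin{gather*} A^1_{s,t}=\int_s^t x^1_{s,u}\otimes d\gamma_u,\qquad A^2_{s,t}=\int_s^t\gamma^1_{s,u}\otimes dx_u,\\ B^1_{s,t}=\int_s^t x^2_{s,u}\otimes d\gamma_u,\qquad B^2_{s,t}=\int_s^t A^1_{s,v}\otimes dx_v,\qquad B^3_{s,t}=-\int_s^t\gamma^1_{s,u}\otimes dx^2_{u,t},\\ C^1_{s,t}=-\int_s^t x^1_{s,u}\otimes d\gamma^2_{u,t},\qquad C^2_{s,t}=\int_s^t A^2_{s,v}\otimes d\gamma_v,\qquad C^3_{s,t}=\int_s^t\gamma^2_{s,u}\otimes dx_u, \end{gather*} where all integrals are Young integrals (limits of Riemann--Stieltjes sums as the mesh tends to $0$) and,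 in $B^3$ and $C^1$, the integrators are the functions $u\mapsto x^2_{u,t}$ and $u\mapsto\gamma^2_{u,t}$. The Young translation $\tau_\gamma(x)$ has the levels \begin{align*} \tau_\gamma(x)^1&=x^1+\gamma^1,\qquad \tau_\gamma(x)^2=x^2+A^1+A^2+\gamma^2,\\ \tau_\gamma(x)^3&=x^3+B^1+B^2+B^3+C^1+C^2+C^3+\gamma^3\quad(\text{the last one only if }N=3). \end{align*} Then $\tau: G\times\mathfrak H\to G$, $(x,\gamma)\mapsto\tau_\gamma(x)$, is well-defined (for all $x\in G$, $\gamma\in\mathfrak H$ and $0\le s\le t\le 1$, all the Young integrals entering the levels $\le N$ exist, and $\tau_\gamma(x)\in G$) and continuous. Moreover, $\tau$ is Lipschitz continuous on every bounded subset of $G\times\mathfrak H$, with respect to $\rho$ and $\|\cdot\|_{\mathfrak H}$. -/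

import Mathlib

open Set Filter Topology MeasureTheory
open scoped ENNReal NNReal ContDiff

/-! ### The Cameron-Martin space of fractional Brownian motion -/

/-- The covariance `R(s,t) = (s^{2H} + t^{2H} - |t-s|^{2H}) / 2` of a one-dimensional
fractional Brownian motion with Hurst parameter `H`. -/
noncomputable def fbmCov (H s t : ℝ) : ℝ :=
  (s ^ (2 * H) + t ^ (2 * H) - |t - s| ^ (2 * H)) / 2

/-- The covariance of a `d`-dimensional fractional Brownian motion on `[0,1]` with independent
components, as an operator-valued kernel: `(s,t) ↦ R(s,t) Id`. -/
noncomputable def fbmKernel (d : ℕ) (H : Ioo (0 : ℝ) 1) :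
    Matrix unitInterval unitInterval
      (EuclideanSpace ℝ (Fin d) →L[ℝ] EuclideanSpace ℝ (Fin d)) :=
  Matrix.of fun s t => fbmCov H s t • ContinuousLinearMap.id ℝ (EuclideanSpace ℝ (Fin d))

lemma integrableOn_one_sub_cos_mul_rpow {H : ℝ} (h0 : 0 < H) (h1 : H < 1) (t : ℝ) :
    IntegrableOn (fun ξ : ℝ => (1 - Real.cos (t * ξ)) * ξ ^ (-(1 + 2 * H))) (Ioi 0) := by
  have hm : ∀ s : Set ℝ, MeasurableSet s → s ⊆ Ioi 0 → AEStronglyMeasurable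
      (fun ξ : ℝ => (1 - Real.cos (t * ξ)) * ξ ^ (-(1 + 2 * H))) (volume.restrict s) := by
    intro s hs hs'
    refine ContinuousOn.aestronglyMeasurable ?_ hs
    refine ContinuousOn.mul (by fun_prop) ?_
    exact continuousOn_id.rpow_const fun x hx => Or.inl (ne_of_gt (hs' hx))
  rw [← Ioc_union_Ioi_eq_Ioi (zero_le_one : (0 : ℝ) ≤ 1)]
  refine IntegrableOn.union ?_ ?_
  · have hi : IntegrableOn (fun ξ : ℝ => t ^ 2 / 2 * ξ ^ (1 - 2 * H)) (Ioc 0 1) := by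
      have := (intervalIntegral.intervalIntegrable_rpow' (a := 0) (b := 1)
        (r := 1 - 2 * H) (by linarith))
      rw [intervalIntegrable_iff_integrableOn_Ioc_of_le zero_le_one] at this
      exact this.const_mul _
    refine Integrable.mono' hi (hm _ measurableSet_Ioc Ioc_subset_Ioi_self) ?_
    refine (ae_restrict_mem measurableSet_Ioc).mono fun ξ hξ => ?_
    have hpos : (0 : ℝ) < ξ := hξ.1
    have e : ξ ^ (1 - 2 * H) = ξ ^ 2 * ξ ^ (-(1 + 2 * H)) := by
      rw [← Real.rpow_natCast, ← Real.rpow_add hpos]; congr 1; push_cast; ring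
    have hc := Real.one_sub_sq_div_two_le_cos (x := t * ξ)
    have hc1 := Real.cos_le_one (t * ξ)
    have hp : 0 ≤ ξ ^ (-(1 + 2 * H)) := Real.rpow_nonneg hpos.le _
    rw [Real.norm_of_nonneg (mul_nonneg (by linarith) hp), e]
    calc _ ≤ (t ^ 2 / 2 * ξ ^ 2) * ξ ^ (-(1 + 2 * H)) :=
          mul_le_mul_of_nonneg_right (by nlinarith) hp
      _ = _ := by ring
  · have hi : IntegrableOn (fun ξ : ℝ => 2 * ξ ^ (-(1 + 2 * H))) (Ioi 1) :=
      (integrableOn_Ioi_rpow_of_lt (by linarith) one_pos).const_mul _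
    refine Integrable.mono' hi (hm _ measurableSet_Ioi (Ioi_subset_Ioi zero_le_one)) ?_
    refine (ae_restrict_mem measurableSet_Ioi).mono fun ξ hξ => ?_
    have hpos : (0 : ℝ) < ξ := lt_trans one_pos hξ
    have hc1 := Real.cos_le_one (t * ξ)
    have hc2 := Real.neg_one_le_cos (t * ξ)
    have hp : 0 ≤ ξ ^ (-(1 + 2 * H)) := Real.rpow_nonneg hpos.le _
    rw [Real.norm_of_nonneg (mul_nonneg (by linarith) hp)]
    exact mul_le_mul_of_nonneg_right (by linarith) hp

lemma integral_one_sub_cos_mul_rpow {H : ℝ} (h0 : 0 < H) {t : ℝ} (ht : 0 ≤ t) :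
    ∫ ξ in Ioi (0 : ℝ), (1 - Real.cos (t * ξ)) * ξ ^ (-(1 + 2 * H)) =
      t ^ (2 * H) * ∫ ξ in Ioi (0 : ℝ), (1 - Real.cos ξ) * ξ ^ (-(1 + 2 * H)) := by
  rcases ht.eq_or_lt with rfl | ht
  · rw [Real.zero_rpow (by linarith)]; simp
  have h := integral_comp_mul_left_Ioi
    (fun ξ : ℝ => (1 - Real.cos ξ) * ξ ^ (-(1 + 2 * H))) 0 ht
  rw [mul_zero, smul_eq_mul] at h
  have h2 : ∫ ξ in Ioi (0 : ℝ), (1 - Real.cos (t * ξ)) * (t * ξ) ^ (-(1 + 2 * H)) =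
      t ^ (-(1 + 2 * H)) *
        ∫ ξ in Ioi (0 : ℝ), (1 - Real.cos (t * ξ)) * ξ ^ (-(1 + 2 * H)) := by
    rw [← integral_const_mul]
    refine setIntegral_congr_fun measurableSet_Ioi fun ξ hξ => ?_
    rw [Real.mul_rpow ht.le (le_of_lt hξ)]; ring
  rw [h2] at h
  have e : t ^ (2 * H) = t ^ (1 + 2 * H) * t⁻¹ := by
    rw [← Real.rpow_neg_one t, ← Real.rpow_add ht]; congr 1; ring
  rw [e, mul_assoc, ← h, ← mul_assoc, ← Real.rpow_add ht]
  simp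

lemma integral_one_sub_cos_pos {H : ℝ} (h0 : 0 < H) (h1 : H < 1) :
    0 < ∫ ξ in Ioi (0 : ℝ), (1 - Real.cos ξ) * ξ ^ (-(1 + 2 * H)) := by
  have hi := integrableOn_one_sub_cos_mul_rpow h0 h1 1
  simp only [one_mul] at hi
  rw [setIntegral_pos_iff_support_of_nonneg_ae _ hi]
  · refine lt_of_lt_of_le ?_ (measure_mono (s := Ioo (0 : ℝ) 1) fun ξ hξ => ⟨?_, hξ.1⟩)
    · simp
    · refine mul_ne_zero ?_ (Real.rpow_pos_of_pos hξ.1 _).ne'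
      have hlt : Real.cos ξ < 1 := by
        have := Real.cos_lt_cos_of_nonneg_of_le_pi_div_two (le_refl (0 : ℝ))
          (by linarith [Real.pi_gt_three, hξ.2]) hξ.1
        simpa using this
      linarith
  · refine (ae_restrict_mem measurableSet_Ioi).mono fun ξ hξ => ?_
    exact mul_nonneg (by linarith [Real.cos_le_one ξ]) (Real.rpow_nonneg (le_of_lt hξ) _)

/-- The spectral representation of the covariance of fractional Brownian motion. -/
lemma fbmCov_spectral {H : ℝ} (h0 : 0 < H) (h1 : H < 1) {s t : ℝ} (hs : 0 ≤ s) (ht : 0 ≤ t) :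
    IntegrableOn (fun ξ : ℝ => ((1 - Real.cos (s * ξ)) * (1 - Real.cos (t * ξ)) +
      Real.sin (s * ξ) * Real.sin (t * ξ)) * ξ ^ (-(1 + 2 * H))) (Ioi 0) ∧
    ∫ ξ in Ioi (0 : ℝ), ((1 - Real.cos (s * ξ)) * (1 - Real.cos (t * ξ)) +
      Real.sin (s * ξ) * Real.sin (t * ξ)) * ξ ^ (-(1 + 2 * H)) =
      2 * (∫ ξ in Ioi (0 : ℝ), (1 - Real.cos ξ) * ξ ^ (-(1 + 2 * H))) * fbmCov H s t := by
  have hfun : (fun ξ : ℝ => ((1 - Real.cos (s * ξ)) * (1 - Real.cos (t * ξ)) +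
      Real.sin (s * ξ) * Real.sin (t * ξ)) * ξ ^ (-(1 + 2 * H))) = fun ξ : ℝ =>
      (1 - Real.cos (s * ξ)) * ξ ^ (-(1 + 2 * H)) + (1 - Real.cos (t * ξ)) * ξ ^ (-(1 + 2 * H))
        - (1 - Real.cos (|t - s| * ξ)) * ξ ^ (-(1 + 2 * H)) := by
    funext ξ
    have : Real.cos (|t - s| * ξ) = Real.cos (t * ξ - s * ξ) := by
      rcases abs_cases (t - s) with ⟨h, _⟩ | ⟨h, _⟩
      · rw [h]; congr 1; ring
      · rw [h, ← Real.cos_neg]; congr 1; ring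
    rw [this, Real.cos_sub]; ring
  have is := integrableOn_one_sub_cos_mul_rpow h0 h1 s
  have it := integrableOn_one_sub_cos_mul_rpow h0 h1 t
  have ist := integrableOn_one_sub_cos_mul_rpow h0 h1 |t - s|
  rw [hfun]
  refine ⟨(is.add it).sub ist, ?_⟩
  rw [integral_sub (by exact is.add it) ist, integral_add is it, integral_one_sub_cos_mul_rpow h0 hs,
    integral_one_sub_cos_mul_rpow h0 ht, integral_one_sub_cos_mul_rpow h0 (abs_nonneg _), fbmCov]
  ring

lemma fbmCov_sum_nonneg {H : ℝ} (h0 : 0 < H) (h1 : H < 1) {ι E : Type*}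
    [NormedAddCommGroup E] [InnerProductSpace ℝ E] (F : Finset ι) (t : ι → ℝ)
    (ht : ∀ i, 0 ≤ t i) (v : ι → E) :
    0 ≤ ∑ i ∈ F, ∑ j ∈ F, fbmCov H (t j) (t i) * inner ℝ (v i) (v j) := by
  set c := ∫ ξ in Ioi (0 : ℝ), (1 - Real.cos ξ) * ξ ^ (-(1 + 2 * H)) with hc
  have hcpos : 0 < c := integral_one_sub_cos_pos h0 h1
  have key : 2 * c * ∑ i ∈ F, ∑ j ∈ F, fbmCov H (t j) (t i) * inner ℝ (v i) (v j) =
      ∫ ξ in Ioi (0 : ℝ), ∑ i ∈ F, ∑ j ∈ F,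
        ((1 - Real.cos (t j * ξ)) * (1 - Real.cos (t i * ξ)) +
        Real.sin (t j * ξ) * Real.sin (t i * ξ)) * ξ ^ (-(1 + 2 * H)) * inner ℝ (v i) (v j) := by
    have hint : ∀ i ∈ F, ∀ j ∈ F, IntegrableOn (fun ξ : ℝ =>
        ((1 - Real.cos (t j * ξ)) * (1 - Real.cos (t i * ξ)) +
        Real.sin (t j * ξ) * Real.sin (t i * ξ)) * ξ ^ (-(1 + 2 * H)) *
          inner ℝ (v i) (v j)) (Ioi 0) := fun i _ j _ =>
      (fbmCov_spectral h0 h1 (ht j) (ht i)).1.mul_const _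
    rw [integral_finsetSum _ fun i hi => integrable_finsetSum _ fun j hj => hint i hi j hj,
      Finset.mul_sum]
    refine Finset.sum_congr rfl fun i hi => ?_
    rw [integral_finsetSum _ fun j hj => hint i hi j hj, Finset.mul_sum]
    refine Finset.sum_congr rfl fun j hj => ?_
    rw [integral_mul_const, (fbmCov_spectral h0 h1 (ht j) (ht i)).2]
    ring
  have hnn : 0 ≤ 2 * c * ∑ i ∈ F, ∑ j ∈ F, fbmCov H (t j) (t i) * inner ℝ (v i) (v j) := by
    rw [key]
    refine setIntegral_nonneg measurableSet_Ioi fun ξ hξ => ?_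
    have e : ∑ i ∈ F, ∑ j ∈ F,
        ((1 - Real.cos (t j * ξ)) * (1 - Real.cos (t i * ξ)) +
        Real.sin (t j * ξ) * Real.sin (t i * ξ)) * ξ ^ (-(1 + 2 * H)) * inner ℝ (v i) (v j) =
        ξ ^ (-(1 + 2 * H)) *
        (inner ℝ (∑ i ∈ F, (1 - Real.cos (t i * ξ)) • v i)
            (∑ i ∈ F, (1 - Real.cos (t i * ξ)) • v i) +
          inner ℝ (∑ i ∈ F, Real.sin (t i * ξ) • v i) (∑ i ∈ F, Real.sin (t i * ξ) • v i)) := by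
      simp only [sum_inner, inner_sum, real_inner_smul_left, real_inner_smul_right]
      rw [← Finset.sum_add_distrib, Finset.mul_sum]
      refine Finset.sum_congr rfl fun i _ => ?_
      rw [← Finset.sum_add_distrib, Finset.mul_sum]
      refine Finset.sum_congr rfl fun j _ => ?_
      rw [real_inner_comm (v i) (v j)]
      ring
    rw [e]
    exact mul_nonneg (Real.rpow_nonneg (le_of_lt hξ) _)
      (add_nonneg real_inner_self_nonneg real_inner_self_nonneg)
  exact nonneg_of_mul_nonneg_right hnn (by positivity)

open scoped ComplexOrder in
instance fbmKernel_posSemidef (d : ℕ) (H : Ioo (0 : ℝ) 1) :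
    Fact (fbmKernel d H).PosSemidef := by
  constructor
  have h := ((RKHS.posSemidef_tfae (K := fbmKernel d H)).out 0 2).mpr
  refine h ⟨?_, fun v => ?_⟩
  · ext s t x i
    have e : star (ContinuousLinearMap.id ℝ (EuclideanSpace ℝ (Fin d))) =
      ContinuousLinearMap.id ℝ (EuclideanSpace ℝ (Fin d)) := star_one _
    simp [fbmKernel, fbmCov, abs_sub_comm, add_comm, Matrix.conjTranspose_apply, e]
  · have := fbmCov_sum_nonneg H.2.1 H.2.2 v.support (fun s : unitInterval => (s : ℝ))
      (fun s => s.2.1) v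
    simpa [Finsupp.sum, fbmKernel, real_inner_smul_left] using this

/-- The Cameron-Martin space of a `d`-dimensional fractional Brownian motion on `[0,1]`: the
completion of the linear span of the functions `R(t,·) v`, `t ∈ [0,1]`, `v ∈ ℝᵈ`, under
`⟨R(s,·) v, R(t,·) w⟩ = R(s,t) ⟨v,w⟩`, realized as a Hilbert space of functions
`[0,1] → ℝᵈ`. -/
noncomputable abbrev CameronMartin (d : ℕ) (H : Ioo (0 : ℝ) 1) : Type :=
  RKHS.OfKernel (fbmKernel d H)

/-! ### Tensors and Young integrals -/

/-- The tensor power `(ℝᵈ)^{⊗ i}` in coordinates, with its Euclidean norm. -/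
abbrev Tens (d i : ℕ) : Type := EuclideanSpace ℝ (Fin i → Fin d)

/-- The tensor product `(ℝᵈ)^{⊗ i} × (ℝᵈ)^{⊗ j} → (ℝᵈ)^{⊗ (i+j)}`. -/
def tmul {d i j : ℕ} (a : Tens d i) (b : Tens d j) : Tens d (i + j) :=
  WithLp.toLp 2 fun w => a (fun k => w (Fin.castAdd j k)) * b (fun k => w (Fin.natAdd i k))

/-- `I` is the Young (Riemann-Stieltjes) integral `∫_s^t f ⊗ dg`: the limit, as the mesh of the
partition `s = u 0 ≤ ⋯ ≤ u n = t` tends to `0`, of the sums `∑ f(ξ k) ⊗ (g(u (k+1)) - g(u k))`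
with arbitrary tags `ξ k ∈ [u k, u (k+1)]`. -/
def HasYoungIntegral {d i j : ℕ} (f : ℝ → Tens d i) (g : ℝ → Tens d j) (s t : ℝ)
    (I : Tens d (i + j)) : Prop :=
  ∀ ε > 0, ∃ δ > 0, ∀ (n : ℕ) (u ξ : ℕ → ℝ), u 0 = s → u n = t →
    (∀ k < n, u k ≤ ξ k ∧ ξ k ≤ u (k + 1) ∧ u (k + 1) - u k < δ) →
    ‖∑ k ∈ Finset.range n, tmul (f (ξ k)) (g (u (k + 1)) - g (u k)) - I‖ < ε

def YoungIntegrable {d i j : ℕ} (f : ℝ → Tens d i) (g : ℝ → Tens d j) (s t : ℝ) : Prop :=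
  ∃ I, HasYoungIntegral f g s t I

open Classical in
/-- The Young integral `∫_s^t f ⊗ dg` (with the value `0` if it does not exist). -/
noncomputable def youngIntegral {d i j : ℕ} (f : ℝ → Tens d i) (g : ℝ → Tens d j) (s t : ℝ) :
    Tens d (i + j) :=
  if h : YoungIntegrable f g s t then h.choose else 0

/-! ### Geometric rough paths with Besov topology -/

/-- Families `(x^i_{s,t})` with values in the tensor powers of `ℝᵈ`. Only the levels
`1 ≤ i ≤ ⌊1/α⌋` and the arguments `0 ≤ s ≤ t ≤ 1` are ever looked at. -/
abbrev RoughFunctional (d : ℕ) : Type := (i : ℕ) → ℝ → ℝ → Tens d i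

/-- The natural lift of a smooth path: `x^0 = 1` and
`x^{i+1}_{s,t} = ∫_s^t x^i_{s,u} ⊗ dx_u`, i.e. the iterated integrals of `x`. -/
noncomputable def smoothLift {d : ℕ} (x : ℝ → EuclideanSpace ℝ (Fin d)) : RoughFunctional d
  | 0 => fun _ _ => WithLp.toLp 2 fun _ => 1
  | i + 1 => fun s t => WithLp.toLp 2 fun w =>
      ∫ u in s..t, smoothLift x i s u (fun k => w k.castSucc) *
        deriv (fun v => x v (w (Fin.last i))) u

/-- The `(β, r)`-Besov norm
`(∬_{0 ≤ s < t ≤ 1} |z_{s,t}|^r / |t-s|^{1 + β r} ds dt)^{1/r}`. -/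
noncomputable def besovNorm {E : Type*} [NormedAddCommGroup E] (β r : ℝ) (z : ℝ → ℝ → E) :
    ℝ≥0∞ :=
  (∫⁻ p in {p : ℝ × ℝ | 0 ≤ p.1 ∧ p.1 < p.2 ∧ p.2 ≤ 1},
    ENNReal.ofReal (‖z p.1 p.2‖ ^ r / |p.2 - p.1| ^ (1 + β * r))) ^ (1 / r)

/-- The distance inducing the `(α, r)`-Besov topology on rough paths of roughness `1/α`:
the sum over the levels `1 ≤ i ≤ ⌊1/α⌋` of the `(iα, r/i)`-Besov norm of `x^i - y^i`. -/
noncomputable def besovDist {d : ℕ} (α r : ℝ) (X Y : RoughFunctional d) : ℝ≥0∞ :=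
  ∑ i ∈ Finset.Icc 1 ⌊1 / α⌋₊, besovNorm (i * α) (r / i) (fun s t => X i s t - Y i s t)

/-- Membership in the geometric rough path space with `(α, r)`-Besov topology: the levels are
continuous on the simplex and `X` is a limit of natural lifts of smooth paths in the
`(α, r)`-Besov distance. (Chen's identity passes to the limit.) -/
def IsBesovGeoRP {d : ℕ} (α r : ℝ) (X : RoughFunctional d) : Prop :=
  (∀ i ∈ Finset.Icc 1 ⌊1 / α⌋₊,
    ContinuousOn (fun p : ℝ × ℝ => X i p.1 p.2) {p | 0 ≤ p.1 ∧ p.1 ≤ p.2 ∧ p.2 ≤ 1}) ∧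
  ∃ x : ℕ → ℝ → EuclideanSpace ℝ (Fin d), (∀ n, ContDiff ℝ ∞ (x n)) ∧
    Tendsto (fun n => besovDist α r (smoothLift (x n)) X) atTop (𝓝 0)

/-! ### The Young translation -/

namespace YoungTranslation

variable {d : ℕ} {H : Ioo (0 : ℝ) 1}

/-- The path `t ↦ γ_t` of a Cameron-Martin element, as a path in `(ℝᵈ)^{⊗ 1}`, constant
outside `[0,1]`. -/
noncomputable def path (γ : CameronMartin d H) (t : ℝ) : Tens d 1 :=
  WithLp.toLp 2 fun w => γ (projIcc 0 1 zero_le_one t) (w 0)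

noncomputable def γ1 (γ : CameronMartin d H) (s t : ℝ) : Tens d 1 := path γ t - path γ s

noncomputable def γ2 (γ : CameronMartin d H) (s t : ℝ) : Tens d 2 :=
  youngIntegral (fun u => γ1 γ s u) (path γ) s t

noncomputable def γ3 (γ : CameronMartin d H) (s t : ℝ) : Tens d 3 :=
  youngIntegral (fun u => γ2 γ s u) (path γ) s t

/-- `A¹_{s,t} = ∫_s^t x¹_{s,u} ⊗ dγ_u`. -/
noncomputable def A1 (X : RoughFunctional d) (γ : CameronMartin d H) (s t : ℝ) : Tens d 2 :=
  youngIntegral (fun u => X 1 s u) (path γ) s t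

/-- `A²_{s,t} = ∫_s^t γ¹_{s,u} ⊗ dx_u`, where `x_u = x¹_{0,u}`. -/
noncomputable def A2 (X : RoughFunctional d) (γ : CameronMartin d H) (s t : ℝ) : Tens d 2 :=
  youngIntegral (fun u => γ1 γ s u) (fun u => X 1 0 u) s t

/-- `B¹_{s,t} = ∫_s^t x²_{s,u} ⊗ dγ_u`. -/
noncomputable def B1 (X : RoughFunctional d) (γ : CameronMartin d H) (s t : ℝ) : Tens d 3 :=
  youngIntegral (fun u => X 2 s u) (path γ) s t

/-- `B²_{s,t} = ∫_s^t ∫_s^v x¹_{s,u} ⊗ dγ_u ⊗ dx_v`. -/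
noncomputable def B2 (X : RoughFunctional d) (γ : CameronMartin d H) (s t : ℝ) : Tens d 3 :=
  youngIntegral (fun v => A1 X γ s v) (fun v => X 1 0 v) s t

/-- `B³_{s,t} = - ∫_s^t γ¹_{s,u} ⊗ dx²_{u,t}`, the integrator being `u ↦ x²_{u,t}`. -/
noncomputable def B3 (X : RoughFunctional d) (γ : CameronMartin d H) (s t : ℝ) : Tens d 3 :=
  -youngIntegral (i := 1) (j := 2) (fun u => γ1 γ s u) (fun u => X 2 u t) s t

/-- `C¹_{s,t} = - ∫_s^t x¹_{s,u} ⊗ dγ²_{u,t}`, the integrator being `u ↦ γ²_{u,t}`. -/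
noncomputable def C1 (X : RoughFunctional d) (γ : CameronMartin d H) (s t : ℝ) : Tens d 3 :=
  -youngIntegral (i := 1) (j := 2) (fun u => X 1 s u) (fun u => γ2 γ u t) s t

/-- `C²_{s,t} = ∫_s^t ∫_s^v γ¹_{s,u} ⊗ dx_u ⊗ dγ_v`. -/
noncomputable def C2 (X : RoughFunctional d) (γ : CameronMartin d H) (s t : ℝ) : Tens d 3 :=
  youngIntegral (fun v => A2 X γ s v) (path γ) s t

/-- `C³_{s,t} = ∫_s^t γ²_{s,u} ⊗ dx_u`. -/
noncomputable def C3 (X : RoughFunctional d) (γ : CameronMartin d H) (s t : ℝ) : Tens d 3 :=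
  youngIntegral (fun u => γ2 γ s u) (fun u => X 1 0 u) s t

/-- All Young integrals in the definition of the second level exist on `[s,t]`. -/
def Level2Exists (X : RoughFunctional d) (γ : CameronMartin d H) (s t : ℝ) : Prop :=
  YoungIntegrable (fun u => γ1 γ s u) (path γ) s t ∧
  YoungIntegrable (fun u => X 1 s u) (path γ) s t ∧
  YoungIntegrable (fun u => γ1 γ s u) (fun u => X 1 0 u) s t

/-- All Young integrals in the definition of the third level exist on `[s,t]` (the inner ones
being those of the second level). -/
def Level3Exists (X : RoughFunctional d) (γ : CameronMartin d H) (s t : ℝ) : Prop :=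
  YoungIntegrable (fun u => γ2 γ s u) (path γ) s t ∧
  YoungIntegrable (fun u => X 2 s u) (path γ) s t ∧
  YoungIntegrable (fun v => A1 X γ s v) (fun v => X 1 0 v) s t ∧
  YoungIntegrable (fun u => γ1 γ s u) (fun u => X 2 u t) s t ∧
  YoungIntegrable (fun u => X 1 s u) (fun u => γ2 γ u t) s t ∧
  YoungIntegrable (fun v => A2 X γ s v) (path γ) s t ∧
  YoungIntegrable (fun u => γ2 γ s u) (fun u => X 1 0 u) s t

end YoungTranslation

open YoungTranslation in
/-- The Young translation `τ_γ(x)`. Only the levels `1 ≤ i ≤ ⌊1/α⌋` are used, where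
`⌊1/α⌋ ≤ 3`. -/
noncomputable def youngTranslation {d : ℕ} {H : Ioo (0 : ℝ) 1} (X : RoughFunctional d)
    (γ : CameronMartin d H) : RoughFunctional d
  | 1 => fun s t => X 1 s t + γ1 γ s t
  | 2 => fun s t => X 2 s t + A1 X γ s t + A2 X γ s t + γ2 γ s t
  | 3 => fun s t => X 3 s t + B1 X γ s t + B2 X γ s t + B3 X γ s t
      + C1 X γ s t + C2 X γ s t + C3 X γ s t + γ3 γ s t
  | _ => fun _ _ => 0

/-! ### The tensor product as a continuous bilinear map -/

/-! Put r = 12m, a = α - 1/r and h = α + 12/r = α + 1/m. Then h < H, and a + h > 1/2 because α >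
1/4. The two facts behind everything are these. A rough path in the Besov space is a-Hölder at level
one and 2a-Hölder at level two. A Cameron-Martin path satisfies |γ_t - γ_s| ≤ M (t - s)^h √(F t - F
s) with F increasing and values in [0,1]: besides the Hölder order h it has a variation gain of
order 1/2. Pairing x with γ thus gives total order a + h + 1/2 > 1, which is Young's condition,
although the Hölder exponents alone add up to less than one. The gauge `mixGauge` records this mixed
regularity, and the sewing lemma (`exists_additive_of_germ`) is proved for it.

The bound on γ comes from H ≤ 1/2. Increments of fractional Brownian motion over non-overlapping
intervals are then negatively correlated, so each row of the covariance matrix of the increments is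
absolutely summable with sum at most twice its diagonal entry (`sum_abs_fbmIncrCov_le`). Schur's
test and the reproducing property bound the sums of |γ_{u_k,u_{k+1}}|² / (u_{k+1} - u_k)^{2H} by
2‖γ‖² (`CameronMartin.sum_sq_div_le`), and the supremum of such sums over partitions of [0,t] serves
as F (`EnergyOn.exists_control`).

The Hölder bounds on X follow from a Garsia-Rodemich-Rumsey inequality
(`exists_holder_of_besovNorm_le`), whose defect hypothesis is supplied by Chen's identity. It is
applied to lifts of smooth paths and to differences of two of them, and then carried to the limit
(`IsBesovGeoRP.exists_close`). Level three of X needs no such bound: it enters the translation only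
additively.

Young integration being bilinear, the cross terms at level i are Hölder of order (i - 1)a + h and
locally Lipschitz in (X, γ) (`RoughClose.estimates`). This order exceeds iα by (13 - i)/r, enough to
bound the (iα, r/i)-Besov norm (`BesovParams.besovDist_translation_le`). Hence the Lipschitz
estimate, and from it continuity.

That the translation stays in the geometric space is seen by approximation. For smooth x and g it is
the lift of x + g (`translation_smoothLift`); mollification approximates γ in the energy of every
order h < H (`EnergyOn.exists_contDiff`), and the Lipschitz estimate passes this on to the
translations. -/

lemma norm_tmul {d i j : ℕ} (a : Tens d i) (b : Tens d j) : ‖tmul a b‖ = ‖a‖ * ‖b‖ := by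
  rw [← sq_eq_sq₀ (norm_nonneg _) (by positivity), mul_pow, EuclideanSpace.norm_sq_eq,
    EuclideanSpace.norm_sq_eq, EuclideanSpace.norm_sq_eq, Finset.sum_mul_sum,
    ← Finset.sum_product', Finset.univ_product_univ]
  refine (Fintype.sum_equiv (Fin.appendEquiv i j) _ _ fun w => ?_).symm
  simp [tmul, Fin.appendEquiv, mul_pow]

/-- The tensor product as a continuous bilinear map. -/
noncomputable def tmulL (d i j : ℕ) : Tens d i →L[ℝ] Tens d j →L[ℝ] Tens d (i + j) :=
  LinearMap.mkContinuous₂ (LinearMap.mk₂ ℝ tmul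
    (fun a a' b => by ext w; simp [tmul, add_mul])
    (fun c a b => by ext w; simp [tmul, mul_assoc])
    (fun a b b' => by ext w; simp [tmul, mul_add])
    (fun c a b => by ext w; simp [tmul, mul_left_comm])) 1 fun a b => by
      simp [norm_tmul]

@[simp] lemma tmulL_apply {d i j : ℕ} (a : Tens d i) (b : Tens d j) :
    tmulL d i j a b = tmul a b := rfl

section tmul
variable {d i j : ℕ}

lemma tmul_add (a : Tens d i) (b b' : Tens d j) : tmul a (b + b') = tmul a b + tmul a b' :=
  (tmulL d i j a).map_add b b'
lemma add_tmul (a a' : Tens d i) (b : Tens d j) : tmul (a + a') b = tmul a b + tmul a' b :=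
  (tmulL d i j).map_add₂ a a' b
lemma tmul_sub (a : Tens d i) (b b' : Tens d j) : tmul a (b - b') = tmul a b - tmul a b' :=
  (tmulL d i j a).map_sub b b'
lemma sub_tmul (a a' : Tens d i) (b : Tens d j) : tmul (a - a') b = tmul a b - tmul a' b :=
  (tmulL d i j).map_sub₂ a a' b
lemma tmul_neg (a : Tens d i) (b : Tens d j) : tmul a (-b) = -tmul a b :=
  (tmulL d i j a).map_neg b
@[simp] lemma tmul_zero (a : Tens d i) : tmul a (0 : Tens d j) = 0 := (tmulL d i j a).map_zero
@[simp] lemma zero_tmul (b : Tens d j) : tmul (0 : Tens d i) b = 0 := (tmulL d i j).map_zero₂ b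
end tmul

/-! ### The gauge `(v - u)^p √(F v - F u)` -/

/-- The gauge `(v - u)^p √(F v - F u)` attached to an increasing function `F`. -/
noncomputable def mixGauge (F : ℝ → ℝ) (p u v : ℝ) : ℝ := (v - u) ^ p * √(F v - F u)

lemma mixGauge_nonneg {F : ℝ → ℝ} {p u v : ℝ} (huv : u ≤ v) : 0 ≤ mixGauge F p u v :=
  mul_nonneg (Real.rpow_nonneg (sub_nonneg.2 huv) _) (Real.sqrt_nonneg _)

lemma mixGauge_mono {F : ℝ → ℝ} (hF : Monotone F) {p u v u' v' : ℝ} (hp : 0 ≤ p) (h1 : u' ≤ u)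
    (h2 : u ≤ v) (h3 : v ≤ v') : mixGauge F p u v ≤ mixGauge F p u' v' := by
  unfold mixGauge
  have := hF h1
  have := hF h3
  gcongr
  exact Real.rpow_nonneg (by linarith) _

/-- A pigeonhole argument. The n overlapping double intervals cover everything at most twice, so the
sum of relative length and relative F-increment averages at most 4/n, and some k attains this.
Raising length to the power p and F-increment to the power 1/2 gives the exponent p + 1/2, summable
over n exactly when p > 1/2. -/
lemma exists_mixGauge_le {F : ℝ → ℝ} (hF : Monotone F) {p : ℝ} (hp : 0 < p) {u : ℕ → ℝ}
    (hu : Monotone u) {n : ℕ} (hn : 0 < n) :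
    ∃ k < n, mixGauge F p (u k) (u (k + 2)) ≤
      (4 / (n : ℝ)) ^ (p + 1 / 2) * mixGauge F p (u 0) (u (n + 1)) := by
  have hn' : (0 : ℝ) < n := by exact_mod_cast hn
  have htele : ∀ G : ℝ → ℝ, Monotone G →
      ∑ k ∈ Finset.range n, (G (u (k + 2)) - G (u k)) ≤ 2 * (G (u (n + 1)) - G (u 0)) := by
    intro G hG
    have e : ∀ k, G (u (k + 2)) - G (u k) =
      (G (u (k + 1 + 1)) - G (u (k + 1))) + (G (u (k + 1)) - G (u k)) := fun k => by ring
    simp only [e, Finset.sum_add_distrib]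
    rw [Finset.sum_range_sub (fun k => G (u (k + 1))), Finset.sum_range_sub (fun k => G (u k))]
    have h1 := hG (hu (Nat.zero_le 1))
    have h2 := hG (hu (Nat.le_succ n))
    simp only [zero_add, Nat.succ_eq_add_one] at *
    linarith
  have hT0 : u 0 ≤ u (n + 1) := hu (Nat.zero_le _)
  have hW0 := hF hT0
  by_cases hdeg : u (n + 1) - u 0 = 0 ∨ F (u (n + 1)) - F (u 0) = 0
  · refine ⟨0, hn, ?_⟩
    have hz : mixGauge F p (u 0) (u (n + 1)) = 0 := by
      rcases hdeg with h | h <;> simp [mixGauge, h, hp.ne']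
    rw [hz, mul_zero, ← hz]
    exact mixGauge_mono hF hp.le le_rfl (hu (Nat.zero_le _)) (hu (by omega))
  · push Not at hdeg
    set T := u (n + 1) - u 0 with hT
    set W := F (u (n + 1)) - F (u 0) with hW
    have hTp : 0 < T := lt_of_le_of_ne (by simpa [hT] using hT0) (Ne.symm hdeg.1)
    have hWp : 0 < W := lt_of_le_of_ne (by simpa [hW] using hW0) (Ne.symm hdeg.2)
    obtain ⟨k, hk, hle⟩ : ∃ k ∈ Finset.range n,
        (u (k + 2) - u k) / T + (F (u (k + 2)) - F (u k)) / W ≤ 4 / n := by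
      refine Finset.exists_le_of_sum_le (by simpa using hn.ne') ?_
      rw [Finset.sum_add_distrib, ← Finset.sum_div, ← Finset.sum_div, Finset.sum_const,
        Finset.card_range, nsmul_eq_mul, mul_div_cancel₀ _ hn'.ne']
      have h1 := htele id monotone_id
      have h2 := htele F hF
      simp only [id] at h1
      have h3 := div_le_div_of_nonneg_right h1 hTp.le
      have h4 := div_le_div_of_nonneg_right h2 hWp.le
      rw [mul_div_assoc, div_self hTp.ne'] at h3
      rw [mul_div_assoc, div_self hWp.ne'] at h4
      linarith
    refine ⟨k, Finset.mem_range.1 hk, ?_⟩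
    have hu2 : u k ≤ u (k + 2) := hu (by omega)
    have hd1 : 0 ≤ u (k + 2) - u k := by linarith
    have hd2 : 0 ≤ F (u (k + 2)) - F (u k) := by linarith [hF hu2]
    have h1 : u (k + 2) - u k ≤ 4 / n * T := by
      rw [← div_le_iff₀ hTp]; linarith [div_nonneg hd2 hWp.le]
    have h2 : F (u (k + 2)) - F (u k) ≤ 4 / n * W := by
      rw [← div_le_iff₀ hWp]; linarith [div_nonneg hd1 hTp.le]
    have h4n : (0 : ℝ) < 4 / n := by positivity
    calc mixGauge F p (u k) (u (k + 2)) ≤ (4 / n * T) ^ p * √(4 / n * W) := by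
          unfold mixGauge; gcongr
      _ = _ := by
          rw [mixGauge, Real.mul_rpow h4n.le hTp.le, Real.sqrt_mul h4n.le, Real.rpow_add h4n,
            ← Real.sqrt_eq_rpow]
          ring

/-- The constant of the sewing lemma. -/
noncomputable def sewConst (p : ℝ) : ℝ := ∑' j : ℕ, (4 / ((j : ℝ) + 1)) ^ (p + 1 / 2)

lemma summable_sewConst {p : ℝ} (hp : 1 / 2 < p) :
    Summable fun j : ℕ => (4 / ((j : ℝ) + 1)) ^ (p + 1 / 2) := by
  have h := (summable_nat_add_iff (f := fun j : ℕ => ((j : ℝ) ^ (p + 1 / 2))⁻¹) 1).2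
    (Real.summable_nat_rpow_inv.2 (by linarith))
  refine (h.mul_left (4 ^ (p + 1 / 2))).congr fun j => ?_
  rw [Real.div_rpow (by norm_num) (by positivity)]
  push_cast
  rfl

lemma sewConst_nonneg (p : ℝ) : 0 ≤ sewConst p :=
  tsum_nonneg fun _ => Real.rpow_nonneg (by positivity) _

/-! ### Sewing for germs whose defect is bounded by the mixed gauge -/

section Sewing

variable {E : Type*} [NormedAddCommGroup E]

/-- Young's maximal inequality. -/
lemma norm_sum_germ_sub_le_aux {F : ℝ → ℝ} (hF : Monotone F) {p : ℝ} (hp : 0 < p) {s t K : ℝ}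
    (hK : 0 ≤ K) {Ξ : ℝ → ℝ → E}
    (hΞ : ∀ x y z, s ≤ x → x ≤ y → y ≤ z → z ≤ t →
      ‖Ξ x z - Ξ x y - Ξ y z‖ ≤ K * mixGauge F p x z) (n : ℕ) :
    ∀ u : ℕ → ℝ, Monotone u → s ≤ u 0 → u (n + 1) ≤ t →
    ‖∑ k ∈ Finset.range (n + 1), Ξ (u k) (u (k + 1)) - Ξ (u 0) (u (n + 1))‖ ≤
      K * (∑ j ∈ Finset.range n, (4 / ((j : ℝ) + 1)) ^ (p + 1 / 2)) *
        mixGauge F p (u 0) (u (n + 1)) := by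
  induction n with
  | zero => intro u hu _ _; simp
  | succ n ih =>
    intro u hu h0 h1
    obtain ⟨k, hk, hle⟩ := exists_mixGauge_le hF hp hu (Nat.succ_pos n)
    obtain ⟨l, rfl⟩ : ∃ l, n = k + l := ⟨n - k, by omega⟩
    -- `v` is the partition with the node k + 1 deleted. Deleting it costs the defect of the germ on
    -- [u k, u (k + 2)], which is small by the choice of k.
    set v : ℕ → ℝ := fun j => if j ≤ k then u j else u (j + 1) with hv
    have hvm : Monotone v := by
      intro i j hij
      simp only [hv]
      split_ifs with h h'
      · exact hu hij
      · exact hu (by omega)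
      · omega
      · exact hu (by omega)
    have hv0 : v 0 = u 0 := by simp [hv]
    have hv1 : v (k + l + 1) = u (k + l + 1 + 1) := by simp [hv]
    have IH := ih v hvm (by rw [hv0]; exact h0) (by rw [hv1]; exact h1)
    rw [hv0, hv1] at IH
    have key : ∑ j ∈ Finset.range (k + l + 1 + 1), Ξ (u j) (u (j + 1)) =
        ∑ j ∈ Finset.range (k + l + 1), Ξ (v j) (v (j + 1)) -
        (Ξ (u k) (u (k + 2)) - Ξ (u k) (u (k + 1)) - Ξ (u (k + 1)) (u (k + 2))) := by
      set a : ℕ → E := fun j => Ξ (u j) (u (j + 1)) with ha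
      set b : ℕ → E := fun j => Ξ (v j) (v (j + 1)) with hb
      have h1 : ∑ x ∈ Finset.range k, b x = ∑ x ∈ Finset.range k, a x := by
        refine Finset.sum_congr rfl fun x hx => ?_
        have := Finset.mem_range.1 hx
        simp only [ha, hb, hv]
        rw [if_pos (by omega), if_pos (by omega)]
      have h2 : ∑ x ∈ Finset.range l, b (k + (1 + x)) =
          ∑ x ∈ Finset.range l, a (k + (2 + x)) := by
        refine Finset.sum_congr rfl fun x hx => ?_
        simp only [ha, hb, hv]
        rw [if_neg (by omega), if_neg (by omega)]
        have : k + (1 + x) + 1 = k + (2 + x) := by omega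
        rw [this]
      have h3 : b k = Ξ (u k) (u (k + 2)) := by simp [hb, hv]
      have e1 : k + l + 1 + 1 = k + (2 + l) := by omega
      have e2 : k + l + 1 = k + (1 + l) := by omega
      rw [e1, e2, Finset.sum_range_add, Finset.sum_range_add, Finset.sum_range_add,
        Finset.sum_range_add, h1, h2, ← h3]
      simp only [Finset.sum_range_succ, Finset.sum_range_zero, zero_add, add_zero]
      change _ = _ - (b k - a k - a (k + 1))
      abel
    rw [key]
    have hδ := hΞ (u k) (u (k + 1)) (u (k + 2)) (h0.trans (hu (Nat.zero_le _))) (hu (by omega))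
      (hu (by omega)) ((hu (by omega)).trans h1)
    calc _ ≤ ‖∑ j ∈ Finset.range (k + l + 1), Ξ (v j) (v (j + 1)) -
              Ξ (u 0) (u (k + l + 1 + 1))‖ +
            ‖Ξ (u k) (u (k + 2)) - Ξ (u k) (u (k + 1)) - Ξ (u (k + 1)) (u (k + 2))‖ := by
          rw [sub_right_comm]; exact norm_sub_le _ _
      _ ≤ _ := add_le_add IH (hδ.trans (mul_le_mul_of_nonneg_left hle hK))
      _ = _ := by
          rw [Finset.sum_range_succ _ (k + l)]; push_cast; ring

/-- The constant no longer depends on the partition: the finite sums are replaced by the convergent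
series `sewConst p`. -/
lemma norm_sum_germ_sub_le {F : ℝ → ℝ} (hF : Monotone F) {p : ℝ} (hp : 1 / 2 < p) {s t K : ℝ}
    (hK : 0 ≤ K) {Ξ : ℝ → ℝ → E}
    (hΞ : ∀ x y z, s ≤ x → x ≤ y → y ≤ z → z ≤ t →
      ‖Ξ x z - Ξ x y - Ξ y z‖ ≤ K * mixGauge F p x z) (n : ℕ)
    {u : ℕ → ℝ} (hu : Monotone u) (h0 : s ≤ u 0) (h1 : u (n + 1) ≤ t) :
    ‖∑ k ∈ Finset.range (n + 1), Ξ (u k) (u (k + 1)) - Ξ (u 0) (u (n + 1))‖ ≤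
      K * sewConst p * mixGauge F p (u 0) (u (n + 1)) := by
  refine (norm_sum_germ_sub_le_aux hF (by linarith) hK hΞ n u hu h0 h1).trans ?_
  gcongr
  · exact mixGauge_nonneg (hu (Nat.zero_le _))
  · exact (summable_sewConst hp).sum_le_tsum _ fun _ _ => Real.rpow_nonneg (by positivity) _

/-- Split D^p √G as D^(p - 1/2) · √D √G. The first factor is controlled by the mesh, and √D √G ≤ D +
G telescopes. Since p > 1/2, errors of the size of the gauge therefore vanish as the mesh shrinks.
-/
lemma sum_mixGauge_le {F : ℝ → ℝ} (hF : Monotone F) {p δ : ℝ} (hp : 1 / 2 < p) {u : ℕ → ℝ}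
    (hu : Monotone u) (n : ℕ) (hδ : ∀ k < n, u (k + 1) - u k ≤ δ) :
    ∑ k ∈ Finset.range n, mixGauge F p (u k) (u (k + 1)) ≤
      δ ^ (p - 1 / 2) * ((u n - u 0) + (F (u n) - F (u 0))) := by
  rw [← Finset.sum_range_sub u, ← Finset.sum_range_sub (fun k => F (u k)),
    ← Finset.sum_add_distrib, Finset.mul_sum]
  refine Finset.sum_le_sum fun k hk => ?_
  have hd : 0 ≤ u (k + 1) - u k := sub_nonneg.2 (hu (Nat.le_succ k))
  have hdF : 0 ≤ F (u (k + 1)) - F (u k) := sub_nonneg.2 (hF (hu (Nat.le_succ k)))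
  set D := u (k + 1) - u k
  set G := F (u (k + 1)) - F (u k)
  have e : D ^ p = D ^ (p - 1 / 2) * √D := by
    rw [Real.sqrt_eq_rpow, ← Real.rpow_add_of_nonneg hd (by linarith) (by norm_num)]
    congr 1; ring
  have hsq : √D * √G ≤ D + G := by
    nlinarith [Real.sq_sqrt hd, Real.sq_sqrt hdF, sq_nonneg (√D - √G), Real.sqrt_nonneg D,
      Real.sqrt_nonneg G]
  change D ^ p * √G ≤ _
  rw [e, mul_assoc]
  have h1 : D ^ (p - 1 / 2) ≤ δ ^ (p - 1 / 2) :=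
    Real.rpow_le_rpow hd (hδ k (Finset.mem_range.1 hk)) (by linarith)
  exact mul_le_mul h1 hsq (by positivity) ((Real.rpow_nonneg hd _).trans h1)

/-- Clamping to the interval `[u, v]`. -/
def clamp (u v x : ℝ) : ℝ := max u (min v x)

lemma clamp_mono {u v : ℝ} : Monotone (clamp u v) := fun _ _ h =>
  max_le_max le_rfl (min_le_min le_rfl h)

lemma le_clamp {u v x : ℝ} : u ≤ clamp u v x := le_max_left _ _

lemma clamp_le {u v x : ℝ} (h : u ≤ v) : clamp u v x ≤ v := max_le h (min_le_left _ _)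

lemma clamp_sub_le {u v x y : ℝ} (h : x ≤ y) : clamp u v y - clamp u v x ≤ y - x := by
  unfold clamp
  rcases max_cases u (min v y) with h1 | h1 <;> rcases max_cases u (min v x) with h2 | h2 <;>
    rcases min_cases v y with h3 | h3 <;> rcases min_cases v x with h4 | h4 <;> linarith

/-- The sewing lemma: a germ with small defect is close to an additive function. -/
lemma exists_additive_of_germ [ProperSpace E] {F : ℝ → ℝ} (hF : Monotone F) {p : ℝ}
    (hp : 1 / 2 < p) {s t K : ℝ} (hst : s ≤ t) (hK : 0 ≤ K) {Ξ : ℝ → ℝ → E}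
    (hΞ0 : ∀ x, Ξ x x = 0)
    (hΞ : ∀ x y z, s ≤ x → x ≤ y → y ≤ z → z ≤ t →
      ‖Ξ x z - Ξ x y - Ξ y z‖ ≤ K * mixGauge F p x z) :
    ∃ I : ℝ → ℝ → E,
      (∀ u v w, s ≤ u → u ≤ v → v ≤ w → w ≤ t → I u w = I u v + I v w) ∧
      ∀ u v, s ≤ u → u ≤ v → v ≤ t →
        ‖I u v - Ξ u v‖ ≤ K * sewConst p * mixGauge F p u v := by
  -- A single uniform grid of [s,t] is used for all subintervals, clamped to [u,v]. Sums over
  -- adjacent subintervals then come from the same grid and differ only in the cell containing the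
  -- common endpoint.
  set G : ℕ → ℕ → ℝ := fun n k => s + (t - s) * (k / (n + 1)) with hG
  have hGm : ∀ n, Monotone (G n) := fun n i j hij => by
    have : (i : ℝ) ≤ j := by exact_mod_cast hij
    have := sub_nonneg.2 hst
    simp only [hG]; gcongr
  have hG0 : ∀ n, G n 0 = s := fun n => by simp [hG]
  have hG1 : ∀ n, G n (n + 1) = t := fun n => by
    have : ((n : ℝ) + 1) ≠ 0 := by positivity
    simp [hG, this]
  have hGd : ∀ n k, G n (k + 1) - G n k = (t - s) / (n + 1) := fun n k => by
    simp only [hG]; push_cast; field_simp; ring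
  set S : ℕ → ℝ → ℝ → E := fun n u v =>
    ∑ k ∈ Finset.range (n + 1), Ξ (clamp u v (G n k)) (clamp u v (G n (k + 1))) with hS
  have hc0 : ∀ n u v, s ≤ u → u ≤ v → clamp u v (G n 0) = u := fun n u v h1 h2 => by
    rw [hG0, clamp, min_eq_right (h1.trans h2), max_eq_left h1]
  have hc1 : ∀ n u v, v ≤ t → u ≤ v → clamp u v (G n (n + 1)) = v := fun n u v h1 h2 => by
    rw [hG1, clamp, min_eq_left h1, max_eq_right h2]
  have hbound : ∀ n u v, s ≤ u → u ≤ v → v ≤ t →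
      ‖S n u v - Ξ u v‖ ≤ K * sewConst p * mixGauge F p u v := by
    intro n u v h1 h2 h3
    have := norm_sum_germ_sub_le hF hp hK hΞ n (u := fun k => clamp u v (G n k))
      (clamp_mono.comp (hGm n)) (by rw [hc0 n u v h1 h2]; exact h1)
      (by rw [hc1 n u v h3 h2]; exact h3)
    simpa only [hc0 n u v h1 h2, hc1 n u v h3 h2] using this
  -- Cells on one side of v cancel because `Ξ x x = 0`; the cell around v leaves one defect.
  -- Bounding every cell by its gauge is enough, as the sum of the gauges tends to 0.
  have hadd : ∀ u v w, s ≤ u → u ≤ v → v ≤ w → w ≤ t →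
      Tendsto (fun n => S n u w - (S n u v + S n v w)) atTop (𝓝 0) := by
    intro u v w h1 h2 h3 h4
    have hb : ∀ n, ‖S n u w - (S n u v + S n v w)‖ ≤
        K * (((t - s) / (n + 1)) ^ (p - 1 / 2) * ((w - u) + (F w - F u))) := by
      intro n
      have hm : Monotone fun k => clamp u w (G n k) := clamp_mono.comp (hGm n)
      have := sum_mixGauge_le hF hp hm (n + 1) (δ := (t - s) / (n + 1)) fun k _ => by
        rw [← hGd n k]; exact clamp_sub_le (hGm n (Nat.le_succ k))
      simp only [hc0 n u w h1 (h2.trans h3), hc1 n u w h4 (h2.trans h3)] at this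
      refine le_trans ?_ (mul_le_mul_of_nonneg_left this hK)
      rw [← Finset.sum_add_distrib, ← Finset.sum_sub_distrib, Finset.mul_sum]
      refine norm_sum_le_of_le _ fun k _ => ?_
      have e1 : ∀ x, clamp u v x = min v (clamp u w x) := fun x => by
        unfold clamp
        rw [min_max_distrib_left, min_eq_right h2, ← min_assoc, min_eq_left h3]
      have e2 : ∀ x, clamp v w x = max v (clamp u w x) := fun x => by
        unfold clamp
        rw [← max_assoc, max_eq_left h2]
      rw [e1, e1, e2, e2]
      have hXY := hm (Nat.le_succ k)
      have hX : s ≤ clamp u w (G n k) := h1.trans le_clamp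
      have hY : clamp u w (G n (k + 1)) ≤ t := (clamp_le (h2.trans h3)).trans h4
      simp only [Nat.succ_eq_add_one] at hXY
      set X := clamp u w (G n k)
      set Y := clamp u w (G n (k + 1))
      rcases le_total v X with hv | hv
      · rw [min_eq_left hv, min_eq_left (hv.trans hXY), max_eq_right hv,
          max_eq_right (hv.trans hXY), hΞ0, zero_add, sub_self, norm_zero]
        exact mul_nonneg hK (mixGauge_nonneg hXY)
      rcases le_total Y v with hv' | hv'
      · rw [min_eq_right hv', min_eq_right hv, max_eq_left hv,
          max_eq_left hv', hΞ0, add_zero, sub_self, norm_zero]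
        exact mul_nonneg hK (mixGauge_nonneg hXY)
      · rw [min_eq_right hv, min_eq_left hv', max_eq_left hv, max_eq_right hv', ← sub_sub]
        exact hΞ X v Y hX hv hv' hY
    refine squeeze_zero_norm hb ?_
    have h0 : Tendsto (fun n : ℕ => (t - s) / ((n : ℝ) + 1)) atTop (𝓝 0) :=
      tendsto_const_nhds.div_atTop (tendsto_atTop_add_const_right _ _ tendsto_natCast_atTop_atTop)
    have h5 := (h0.rpow_const (p := p - 1 / 2) (Or.inr (by linarith)))
    rw [Real.zero_rpow (by linarith)] at h5
    simpa using (h5.mul_const ((w - u) + (F w - F u))).const_mul K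
  -- Limits are taken along an ultrafilter on ℕ. They exist since the sums stay in a compact ball,
  -- and being additive in the sums they inherit `hadd`. True convergence of Riemann sums follows
  -- afterwards from additivity of the limit.
  have hlim : ∀ u v, ∃ L, s ≤ u → u ≤ v → v ≤ t →
      Tendsto (fun n => S n u v) (hyperfilter ℕ) (𝓝 L) := by
    intro u v
    by_cases h : s ≤ u ∧ u ≤ v ∧ v ≤ t
    · obtain ⟨L, -, hL⟩ := (isCompact_closedBall (Ξ u v) (K * sewConst p *
        mixGauge F p u v)).ultrafilter_le_nhds ((hyperfilter ℕ).map fun n => S n u v) (by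
          rw [le_principal_iff]
          exact Filter.mem_map.2 (Filter.univ_mem' fun n => by
            simpa [dist_eq_norm] using hbound n u v h.1 h.2.1 h.2.2))
      exact ⟨L, fun _ _ _ => hL⟩
    · exact ⟨0, fun h1 h2 h3 => absurd ⟨h1, h2, h3⟩ h⟩
  choose I hI using hlim
  have hle : (hyperfilter ℕ : Filter ℕ) ≤ atTop := by
    rw [← Nat.cofinite_eq_atTop]; exact hyperfilter_le_cofinite
  refine ⟨I, fun u v w h1 h2 h3 h4 => ?_, fun u v h1 h2 h3 => ?_⟩
  · have ha := (hadd u v w h1 h2 h3 h4).mono_left hle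
    have hb := (hI u w h1 (h2.trans h3) h4).sub
      ((hI u v h1 h2 (h3.trans h4)).add (hI v w (h1.trans h2) h3 h4))
    exact sub_eq_zero.1 (tendsto_nhds_unique hb ha)
  · exact le_of_tendsto ((hI u v h1 h2 h3).sub_const (Ξ u v)).norm
      (Filter.Eventually.of_forall fun n => hbound n u v h1 h2 h3)

end Sewing

/-! ### Young integrals -/

lemma exists_rpow_mul_lt {q : ℝ} (hq : 0 < q) {B : ℝ} (hB : 0 ≤ B) {ε : ℝ} (hε : 0 < ε) :
    ∃ δ > 0, δ ^ q * B < ε := by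
  refine ⟨(ε / (B + 1)) ^ (1 / q), Real.rpow_pos_of_pos (by positivity) _, ?_⟩
  rw [← Real.rpow_mul (by positivity), one_div, inv_mul_cancel₀ hq.ne', Real.rpow_one,
    div_mul_eq_mul_div, div_lt_iff₀ (by positivity)]
  nlinarith

section Young

variable {d i j : ℕ}

lemma monotone_partition {u ξ : ℕ → ℝ} {n : ℕ}
    (h : ∀ k < n, u k ≤ ξ k ∧ ξ k ≤ u (k + 1)) : Monotone fun k => u (min k n) := by
  refine monotone_nat_of_le_succ fun k => ?_
  rcases lt_or_ge k n with hk | hk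
  · have := h k hk
    rw [min_eq_left hk.le, min_eq_left (by omega)]
    linarith
  · rw [min_eq_right hk, min_eq_right (by omega)]

lemma partition_mem {u ξ : ℕ → ℝ} {n : ℕ} (h : ∀ k < n, u k ≤ ξ k ∧ ξ k ≤ u (k + 1)) {k : ℕ}
    (hk : k ≤ n) : u k ∈ Icc (u 0) (u n) := by
  have hm := monotone_partition h
  have h1 := hm (Nat.zero_le k)
  have h2 := hm hk
  simp only [Nat.zero_min, min_self, min_eq_left hk] at h1 h2
  exact ⟨h1, h2⟩

lemma additive_sum {E : Type*} [AddCommGroup E] {I : ℝ → ℝ → E} {s t : ℝ}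
    (hI : ∀ u v w, s ≤ u → u ≤ v → v ≤ w → w ≤ t → I u w = I u v + I v w) {u : ℕ → ℝ}
    (hu : Monotone u) (h0 : s ≤ u 0) {n : ℕ} (hn : u n ≤ t) :
    ∑ k ∈ Finset.range n, I (u k) (u (k + 1)) = I (u 0) (u n) := by
  induction n with
  | zero =>
    have := hI (u 0) (u 0) (u 0) h0 le_rfl le_rfl hn
    rw [left_eq_add] at this
    rw [Finset.sum_range_zero, this]
  | succ n ih =>
    rw [Finset.sum_range_succ, ih ((hu (Nat.le_succ n)).trans hn),
      ← hI _ _ _ h0 (hu (Nat.zero_le _)) (hu (Nat.le_succ n)) hn]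

/-- By additivity I(s,t) is the sum of the increments of I over any partition, so the error of a
tagged Riemann sum is at most a sum of gauges over its cells, which vanishes with the mesh. -/
lemma hasYoungIntegral_of_additive {F : ℝ → ℝ} (hF : Monotone F) {p : ℝ} (hp : 1 / 2 < p)
    {s t K : ℝ} (hst : s ≤ t) (hK : 0 ≤ K) {f : ℝ → Tens d i} {g : ℝ → Tens d j}
    {I : ℝ → ℝ → Tens d (i + j)}
    (hadd : ∀ u v w, s ≤ u → u ≤ v → v ≤ w → w ≤ t → I u w = I u v + I v w)
    (hI : ∀ u ξ v, s ≤ u → u ≤ ξ → ξ ≤ v → v ≤ t →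
      ‖tmul (f ξ) (g v - g u) - I u v‖ ≤ K * mixGauge F p u v) :
    HasYoungIntegral f g s t (I s t) := by
  intro ε hε
  have hB : 0 ≤ K * ((t - s) + (F t - F s)) :=
    mul_nonneg hK (add_nonneg (sub_nonneg.2 hst) (sub_nonneg.2 (hF hst)))
  obtain ⟨δ, hδ, hlt⟩ := exists_rpow_mul_lt (q := p - 1 / 2) (by linarith) hB hε
  refine ⟨δ, hδ, fun n u ξ h0 hn h => lt_of_le_of_lt ?_ hlt⟩
  have hm := monotone_partition (u := u) (ξ := ξ) (n := n) fun k hk => ⟨(h k hk).1, (h k hk).2.1⟩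
  -- A partition is constrained only up to index n; freezing it afterwards makes it monotone on all
  -- of ℕ.
  set v : ℕ → ℝ := fun k => u (min k n) with hv
  have hv0 : v 0 = s := by simp [hv, h0]
  have hvn : v n = t := by simp [hv, hn]
  have hvk : ∀ k < n, v k = u k ∧ v (k + 1) = u (k + 1) := fun k hk => by
    simp only [hv]
    rw [min_eq_left hk.le, min_eq_left (by omega)]
    exact ⟨rfl, rfl⟩
  have hsum := additive_sum hadd hm hv0.ge hvn.le
  rw [hv0, hvn] at hsum
  have hmesh := sum_mixGauge_le hF hp hm n (δ := δ) fun k hk => by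
    rw [(hvk k hk).1, (hvk k hk).2]; exact (h k hk).2.2.le
  rw [hv0, hvn] at hmesh
  rw [← hsum, ← Finset.sum_sub_distrib]
  calc _ ≤ ∑ k ∈ Finset.range n, K * mixGauge F p (v k) (v (k + 1)) := by
        refine norm_sum_le_of_le _ fun k hk => ?_
        have hk' := Finset.mem_range.1 hk
        have h1 := h k hk'
        rw [← (hvk k hk').1, ← (hvk k hk').2] at h1 ⊢
        exact hI _ _ _ (hv0 ▸ hm (Nat.zero_le k)) h1.1 h1.2.1 (hvn ▸ hm hk')
    _ ≤ _ := by
        rw [← Finset.mul_sum]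
        calc _ ≤ _ := mul_le_mul_of_nonneg_left hmesh hK
          _ = _ := by ring

/-- Without arbitrarily fine tagged partitions the definition of the integral would be vacuous, and
the value not unique. -/
lemma exists_fine_partition {s t δ : ℝ} (hst : s ≤ t) (hδ : 0 < δ) :
    ∃ (n : ℕ) (u : ℕ → ℝ), u 0 = s ∧ u n = t ∧
      ∀ k < n, u k ≤ u k ∧ u k ≤ u (k + 1) ∧ u (k + 1) - u k < δ := by
  obtain ⟨n, hn⟩ := exists_nat_gt ((t - s) / δ)
  have hn0 : (0 : ℝ) < n := lt_of_le_of_lt (div_nonneg (sub_nonneg.2 hst) hδ.le) hn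
  refine ⟨n, fun k => s + (t - s) / n * k, by simp, by field_simp; ring, fun k _ => ?_⟩
  have e : s + (t - s) / n * ((k + 1 : ℕ) : ℝ) = s + (t - s) / n * k + (t - s) / n := by
    push_cast; ring
  have h0 : 0 ≤ (t - s) / n := div_nonneg (sub_nonneg.2 hst) hn0.le
  refine ⟨le_rfl, ?_, ?_⟩
  · beta_reduce; rw [e]; linarith
  · beta_reduce; rw [e, add_sub_cancel_left, div_lt_iff₀ hn0, mul_comm]
    exact (div_lt_iff₀ hδ).1 hn

lemma HasYoungIntegral.unique {f : ℝ → Tens d i} {g : ℝ → Tens d j} {s t : ℝ} (hst : s ≤ t)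
    {I J : Tens d (i + j)} (hI : HasYoungIntegral f g s t I) (hJ : HasYoungIntegral f g s t J) :
    I = J := by
  rw [← sub_eq_zero, ← norm_le_zero_iff]
  refine le_of_forall_pos_lt_add fun ε hε => ?_
  obtain ⟨δ₁, h1, H1⟩ := hI (ε / 2) (by positivity)
  obtain ⟨δ₂, h2, H2⟩ := hJ (ε / 2) (by positivity)
  obtain ⟨n, u, h0, hn, h⟩ := exists_fine_partition hst (lt_min h1 h2)
  have a1 := H1 n u u h0 hn fun k hk =>
    ⟨(h k hk).1, (h k hk).2.1, (h k hk).2.2.trans_le (min_le_left _ _)⟩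
  have a2 := H2 n u u h0 hn fun k hk =>
    ⟨(h k hk).1, (h k hk).2.1, (h k hk).2.2.trans_le (min_le_right _ _)⟩
  have := norm_sub_le_norm_sub_add_norm_sub I
    (∑ k ∈ Finset.range n, tmul (f (u k)) (g (u (k + 1)) - g (u k))) J
  rw [norm_sub_rev] at a1
  linarith

lemma HasYoungIntegral.eq {f : ℝ → Tens d i} {g : ℝ → Tens d j} {s t : ℝ} (hst : s ≤ t)
    {I : Tens d (i + j)} (hI : HasYoungIntegral f g s t I) : youngIntegral f g s t = I := by
  have h : YoungIntegrable f g s t := ⟨I, hI⟩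
  rw [youngIntegral, dif_pos h]
  exact h.choose_spec.unique hst hI

lemma HasYoungIntegral.congr {f f' : ℝ → Tens d i} {g g' : ℝ → Tens d j} {s t : ℝ}
    {I : Tens d (i + j)} (hI : HasYoungIntegral f g s t I) (hf : ∀ x ∈ Icc s t, f x = f' x)
    (hg : ∀ x ∈ Icc s t, g x = g' x) : HasYoungIntegral f' g' s t I := by
  intro ε hε
  obtain ⟨δ, hδ, H⟩ := hI ε hε
  refine ⟨δ, hδ, fun n u ξ h0 hn h => ?_⟩
  have hlt := H n u ξ h0 hn h
  have hmem : ∀ k ≤ n, u k ∈ Icc s t := fun k hk => by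
    rw [← h0, ← hn]; exact partition_mem (fun k hk => ⟨(h k hk).1, (h k hk).2.1⟩) hk
  convert hlt using 4 with k hk
  have hk' := Finset.mem_range.1 hk
  have h1 := hmem k hk'.le
  have h2 := hmem (k + 1) hk'
  rw [hf (ξ k) ⟨h1.1.trans (h k hk').1, (h k hk').2.1.trans h2.2⟩, hg _ h1, hg _ h2]

lemma youngIntegral_congr {f f' : ℝ → Tens d i} {g g' : ℝ → Tens d j} {s t : ℝ} (hst : s ≤ t)
    (hf : ∀ x ∈ Icc s t, f x = f' x) (hg : ∀ x ∈ Icc s t, g x = g' x) :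
    youngIntegral f g s t = youngIntegral f' g' s t := by
  by_cases h : YoungIntegrable f g s t
  · obtain ⟨I, hI⟩ := h
    rw [hI.eq hst, (hI.congr hf hg).eq hst]
  · have h' : ¬YoungIntegrable f' g' s t := fun ⟨I, hI⟩ =>
      h ⟨I, hI.congr (fun x hx => (hf x hx).symm) fun x hx => (hg x hx).symm⟩
    rw [youngIntegral, youngIntegral, dif_neg h, dif_neg h']

/-- The hypothesis is an identity between summands, so that the same lemma covers linearity in the
integrand and in the integrator. -/
lemma HasYoungIntegral.sub {f f' : ℝ → Tens d i} {g g' : ℝ → Tens d j} {s t : ℝ}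
    {I I' : Tens d (i + j)} {f'' : ℝ → Tens d i} {g'' : ℝ → Tens d j}
    (hI : HasYoungIntegral f g s t I) (hI' : HasYoungIntegral f' g' s t I')
    (h : ∀ x y z, tmul (f x) (g y - g z) - tmul (f' x) (g' y - g' z) =
      tmul (f'' x) (g'' y - g'' z)) : HasYoungIntegral f'' g'' s t (I - I') := by
  intro ε hε
  obtain ⟨δ₁, h1, H1⟩ := hI (ε / 2) (by positivity)
  obtain ⟨δ₂, h2, H2⟩ := hI' (ε / 2) (by positivity)
  refine ⟨min δ₁ δ₂, lt_min h1 h2, fun n u ξ h0 hn hk => ?_⟩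
  have a1 := H1 n u ξ h0 hn fun k hk' =>
    ⟨(hk k hk').1, (hk k hk').2.1, (hk k hk').2.2.trans_le (min_le_left _ _)⟩
  have a2 := H2 n u ξ h0 hn fun k hk' =>
    ⟨(hk k hk').1, (hk k hk').2.1, (hk k hk').2.2.trans_le (min_le_right _ _)⟩
  simp only [← h, Finset.sum_sub_distrib]
  rw [sub_sub_sub_comm]
  exact (norm_sub_le _ _).trans_lt (by linarith)

lemma hasYoungIntegral_const (c : Tens d i) (g : ℝ → Tens d j) (s t : ℝ) :
    HasYoungIntegral (fun _ => c) g s t (tmul c (g t - g s)) := by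
  intro ε hε
  refine ⟨1, one_pos, fun n u ξ h0 hn _ => ?_⟩
  have : ∑ k ∈ Finset.range n, tmul c (g (u (k + 1)) - g (u k)) = tmul c (g t - g s) := by
    simp only [← tmulL_apply]
    rw [← map_sum, Finset.sum_range_sub (fun k => g (u k)), hn, h0]
  rw [this, sub_self, norm_zero]
  exact hε

/-- The products of the increments of `f` and `g` over subintervals are controlled by the gauge
`mixGauge F p`. -/
def YoungPair (F : ℝ → ℝ) (p K : ℝ) (f : ℝ → Tens d i) (g : ℝ → Tens d j) (s t : ℝ) : Prop :=
  ∀ lo x y z w hi, s ≤ lo → lo ≤ x → x ≤ y → y ≤ hi → lo ≤ z → z ≤ w → w ≤ hi → hi ≤ t →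
    ‖f y - f x‖ * ‖g w - g z‖ ≤ K * mixGauge F p lo hi

/-- The germ f(u) ⊗ (g v - g u) has defect -(f y - f x) ⊗ (g z - g y), exactly what a Young pair
controls, so it can be sewn. Moving the tag from u to ξ costs another product of increments of the
same size. -/
lemma YoungPair.exists_integral {F : ℝ → ℝ} (hF : Monotone F) {p : ℝ} (hp : 1 / 2 < p)
    {s t K : ℝ} (hst : s ≤ t) (hK : 0 ≤ K) {f : ℝ → Tens d i} {g : ℝ → Tens d j}
    (h : YoungPair F p K f g s t) :
    ∃ I : ℝ → ℝ → Tens d (i + j),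
      (∀ u v w, s ≤ u → u ≤ v → v ≤ w → w ≤ t → I u w = I u v + I v w) ∧
      (∀ u v, s ≤ u → u ≤ v → v ≤ t → HasYoungIntegral f g u v (I u v)) ∧
      ∀ u v, s ≤ u → u ≤ v → v ≤ t →
        ‖I u v - tmul (f u) (g v - g u)‖ ≤ K * sewConst p * mixGauge F p u v := by
  obtain ⟨I, hadd, hI⟩ := exists_additive_of_germ hF hp hst hK
    (Ξ := fun u v => tmul (f u) (g v - g u)) (fun x => by simp) fun x y z h1 h2 h3 h4 => by
      have : tmul (f x) (g z - g x) - tmul (f x) (g y - g x) - tmul (f y) (g z - g y) =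
          -tmul (f y - f x) (g z - g y) := by
        rw [sub_tmul, ← tmul_sub, sub_sub_sub_cancel_right]; abel
      rw [this, norm_neg, norm_tmul]
      exact h x x y y z z h1 le_rfl h2 h3 h2 h3 le_rfl h4
  refine ⟨I, hadd, fun u v h1 h2 h3 => ?_, hI⟩
  refine hasYoungIntegral_of_additive hF hp h2 (K := K + K * sewConst p)
    (add_nonneg hK (mul_nonneg hK (sewConst_nonneg p)))
    (fun x y z a b c e => hadd x y z (h1.trans a) b c (e.trans h3)) fun x ξ y a b c e => ?_
  have e1 : tmul (f ξ) (g y - g x) - I x y =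
      tmul (f ξ - f x) (g y - g x) - (I x y - tmul (f x) (g y - g x)) := by
    rw [sub_tmul]; abel
  rw [e1, add_mul]
  refine (norm_sub_le _ _).trans (add_le_add ?_ (hI x y (h1.trans a) (b.trans c) (e.trans h3)))
  rw [norm_tmul]
  exact h x x ξ x y y (h1.trans a) le_rfl b c le_rfl (b.trans c) le_rfl (e.trans h3)

end Young

/-! ### Pairs of two-parameter functions which are close to each other -/

/-- The gauge `(v - u)^p`. -/
noncomputable def powGauge (p u v : ℝ) : ℝ := (v - u) ^ p

/-- On `[s,t]`, both `L` and `L'` are bounded by `K` times the gauge `G`, and their difference is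
bounded by `K ε` times `G`. -/
structure CloseOn {E : Type*} [NormedAddCommGroup E] (G : ℝ → ℝ → ℝ) (K ε : ℝ) (L L' : ℝ → ℝ → E)
    (s t : ℝ) : Prop where
  left : ∀ u v, s ≤ u → u ≤ v → v ≤ t → ‖L u v‖ ≤ K * G u v
  right : ∀ u v, s ≤ u → u ≤ v → v ≤ t → ‖L' u v‖ ≤ K * G u v
  diff : ∀ u v, s ≤ u → u ≤ v → v ≤ t → ‖L u v - L' u v‖ ≤ K * ε * G u v

/-- The increments of a path. -/
def incr {E : Type*} [Sub E] (p : ℝ → E) (u v : ℝ) : E := p v - p u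

section CloseOn

variable {E : Type*} [NormedAddCommGroup E] {G G' : ℝ → ℝ → ℝ} {K K' ε s t : ℝ}
  {L L' M M' : ℝ → ℝ → E}

lemma CloseOn.mono {s' t' : ℝ} (h : CloseOn G K ε L L' s t) (hs : s ≤ s') (ht : t' ≤ t) :
    CloseOn G K ε L L' s' t' :=
  ⟨fun u v a b c => h.left u v (hs.trans a) b (c.trans ht),
    fun u v a b c => h.right u v (hs.trans a) b (c.trans ht),
    fun u v a b c => h.diff u v (hs.trans a) b (c.trans ht)⟩

lemma CloseOn.mono_gauge (h : CloseOn G K ε L L' s t) (hK : 0 ≤ K) (hε : 0 ≤ ε) {c : ℝ}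
    (hG : ∀ u v, s ≤ u → u ≤ v → v ≤ t → G u v ≤ c * G' u v) :
    CloseOn G' (K * c) ε L L' s t :=
  ⟨fun u v a b c' => (h.left u v a b c').trans
      ((mul_le_mul_of_nonneg_left (hG u v a b c') hK).trans_eq (by ring)),
    fun u v a b c' => (h.right u v a b c').trans
      ((mul_le_mul_of_nonneg_left (hG u v a b c') hK).trans_eq (by ring)),
    fun u v a b c' => (h.diff u v a b c').trans
      ((mul_le_mul_of_nonneg_left (hG u v a b c') (mul_nonneg hK hε)).trans_eq (by ring))⟩

lemma CloseOn.add (h : CloseOn G K ε L L' s t) (h' : CloseOn G K' ε M M' s t) :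
    CloseOn G (K + K') ε (fun u v => L u v + M u v) (fun u v => L' u v + M' u v) s t :=
  ⟨fun u v a b c => (norm_add_le _ _).trans
      ((add_le_add (h.left u v a b c) (h'.left u v a b c)).trans_eq (by ring)),
    fun u v a b c => (norm_add_le _ _).trans
      ((add_le_add (h.right u v a b c) (h'.right u v a b c)).trans_eq (by ring)),
    fun u v a b c => by
      rw [add_sub_add_comm]
      exact (norm_add_le _ _).trans
        ((add_le_add (h.diff u v a b c) (h'.diff u v a b c)).trans_eq (by ring))⟩

lemma CloseOn.neg (h : CloseOn G K ε L L' s t) :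
    CloseOn G K ε (fun u v => -L u v) (fun u v => -L' u v) s t :=
  ⟨fun u v a b c => by rw [norm_neg]; exact h.left u v a b c,
    fun u v a b c => by rw [norm_neg]; exact h.right u v a b c,
    fun u v a b c => by rw [neg_sub_neg, norm_sub_rev]; exact h.diff u v a b c⟩

lemma CloseOn.congr (h : CloseOn G K ε L L' s t)
    (hL : ∀ u v, s ≤ u → u ≤ v → v ≤ t → L u v = M u v)
    (hL' : ∀ u v, s ≤ u → u ≤ v → v ≤ t → L' u v = M' u v) : CloseOn G K ε M M' s t :=
  ⟨fun u v a b c => hL u v a b c ▸ h.left u v a b c,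
    fun u v a b c => hL' u v a b c ▸ h.right u v a b c,
    fun u v a b c => hL u v a b c ▸ hL' u v a b c ▸ h.diff u v a b c⟩

end CloseOn

section CloseTmul

variable {d i j : ℕ} {G : ℝ → ℝ → ℝ} {K K' ε s t a : ℝ}

lemma norm_tmul_sub_tmul_le {x x' : Tens d i} {y y' : Tens d j} {A B : ℝ}
    (hx : ‖x - x'‖ ≤ A * ε) (hx' : ‖x'‖ ≤ A) (hy : ‖y‖ ≤ B) (hy' : ‖y - y'‖ ≤ B * ε) :
    ‖tmul x y - tmul x' y'‖ ≤ 2 * (A * B) * ε := by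
  have e : tmul x y - tmul x' y' = tmul (x - x') y + tmul x' (y - y') := by
    rw [sub_tmul, tmul_sub]; abel
  rw [e]
  refine (norm_add_le _ _).trans ?_
  rw [norm_tmul, norm_tmul]
  have h1 : ‖x - x'‖ * ‖y‖ ≤ A * ε * B :=
    mul_le_mul hx hy (norm_nonneg _) ((norm_nonneg _).trans hx)
  have h2 : ‖x'‖ * ‖y - y'‖ ≤ A * (B * ε) :=
    mul_le_mul hx' hy' (norm_nonneg _) ((norm_nonneg _).trans hx')
  linarith

lemma CloseOn.tmul_of_le {E₁ E₂ : ℝ → ℝ → Tens d i} {M M' : ℝ → ℝ → Tens d j} {A : ℝ}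
    (hA : 0 ≤ A)
    (h1 : ∀ u v, s ≤ u → u ≤ v → v ≤ t → ‖E₁ u v‖ ≤ A)
    (h2 : ∀ u v, s ≤ u → u ≤ v → v ≤ t → ‖E₂ u v‖ ≤ A)
    (h3 : ∀ u v, s ≤ u → u ≤ v → v ≤ t → ‖E₁ u v - E₂ u v‖ ≤ A * ε)
    (hM : CloseOn G K ε M M' s t) :
    CloseOn G (2 * A * K) ε (fun u v => tmul (E₁ u v) (M u v)) (fun u v => tmul (E₂ u v) (M' u v))
      s t := by
  refine ⟨fun u v a b c => ?_, fun u v a b c => ?_, fun u v a b c => ?_⟩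
  · rw [norm_tmul]
    have := mul_le_mul (h1 u v a b c) (hM.left u v a b c) (norm_nonneg _) hA
    have h0 := mul_nonneg hA ((norm_nonneg _).trans (hM.left u v a b c))
    linarith
  · rw [norm_tmul]
    have := mul_le_mul (h2 u v a b c) (hM.right u v a b c) (norm_nonneg _) hA
    have h0 := mul_nonneg hA ((norm_nonneg _).trans (hM.left u v a b c))
    linarith
  · refine (norm_tmul_sub_tmul_le (A := A) (B := K * G u v) (h3 u v a b c) (h2 u v a b c)
      (hM.left u v a b c) ((hM.diff u v a b c).trans_eq (by ring))).trans_eq (by ring)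

lemma CloseOn.of_le_tmul {E₁ E₂ : ℝ → ℝ → Tens d j} {M M' : ℝ → ℝ → Tens d i} {A : ℝ}
    (hA : 0 ≤ A)
    (h1 : ∀ u v, s ≤ u → u ≤ v → v ≤ t → ‖E₁ u v‖ ≤ A)
    (h2 : ∀ u v, s ≤ u → u ≤ v → v ≤ t → ‖E₂ u v‖ ≤ A)
    (h3 : ∀ u v, s ≤ u → u ≤ v → v ≤ t → ‖E₁ u v - E₂ u v‖ ≤ A * ε)
    (hM : CloseOn G K ε M M' s t) :
    CloseOn G (2 * A * K) ε (fun u v => tmul (M u v) (E₁ u v)) (fun u v => tmul (M' u v) (E₂ u v))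
      s t := by
  refine ⟨fun u v a b c => ?_, fun u v a b c => ?_, fun u v a b c => ?_⟩
  · rw [norm_tmul]
    have := mul_le_mul (h1 u v a b c) (hM.left u v a b c) (norm_nonneg _) hA
    have h0 := mul_nonneg hA ((norm_nonneg _).trans (hM.left u v a b c))
    linarith
  · rw [norm_tmul]
    have := mul_le_mul (h2 u v a b c) (hM.right u v a b c) (norm_nonneg _) hA
    have h0 := mul_nonneg hA ((norm_nonneg _).trans (hM.left u v a b c))
    linarith
  · refine (norm_tmul_sub_tmul_le (A := K * G u v) (B := A) ((hM.diff u v a b c).trans_eq (by ring))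
      (hM.right u v a b c) (h1 u v a b c) (h3 u v a b c)).trans_eq (by ring)

end CloseTmul

/-! ### Lipschitz dependence of Young integrals on integrand and integrator -/

/-- Two increasing gauges whose product is dominated by `mixGauge F p`. -/
structure GaugePair (F : ℝ → ℝ) (p : ℝ) (G G' : ℝ → ℝ → ℝ) : Prop where
  nonneg : ∀ u v, u ≤ v → 0 ≤ G u v
  nonneg' : ∀ u v, u ≤ v → 0 ≤ G' u v
  mono : ∀ lo x y hi, lo ≤ x → x ≤ y → y ≤ hi → G x y ≤ G lo hi
  mono' : ∀ lo x y hi, lo ≤ x → x ≤ y → y ≤ hi → G' x y ≤ G' lo hi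
  mul_le : ∀ u v, u ≤ v → G u v * G' u v ≤ mixGauge F p u v

lemma GaugePair.symm {F : ℝ → ℝ} {p : ℝ} {G G' : ℝ → ℝ → ℝ} (h : GaugePair F p G G') :
    GaugePair F p G' G :=
  ⟨h.nonneg', h.nonneg, h.mono', h.mono, fun u v huv => by rw [mul_comm]; exact h.mul_le u v huv⟩

lemma powGauge_nonneg {p u v : ℝ} (h : u ≤ v) : 0 ≤ powGauge p u v :=
  Real.rpow_nonneg (sub_nonneg.2 h) _

lemma powGauge_mul_mixGauge {F : ℝ → ℝ} {a h u v : ℝ} (ha : 0 ≤ a) (hh : 0 ≤ h) (huv : u ≤ v) :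
    powGauge a u v * mixGauge F h u v = mixGauge F (a + h) u v := by
  rw [mixGauge, mixGauge, powGauge, Real.rpow_add_of_nonneg (sub_nonneg.2 huv) ha hh, mul_assoc]

/-- The pairing used throughout: an a-Hölder path against a path of finite energy of order h. The
Hölder exponents add up and the factor √(F v - F u) survives. -/
lemma gaugePair_pow_mix {F : ℝ → ℝ} (hF : Monotone F) {a h : ℝ} (ha : 0 ≤ a) (hh : 0 ≤ h) :
    GaugePair F (a + h) (powGauge a) (mixGauge F h) where
  nonneg _ _ := powGauge_nonneg
  nonneg' _ _ := mixGauge_nonneg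
  mono lo x y hi h1 h2 h3 := Real.rpow_le_rpow (by linarith) (by linarith) ha
  mono' _ _ _ _ h1 h2 h3 := mixGauge_mono hF hh h1 h2 h3
  mul_le u v huv := (powGauge_mul_mixGauge ha hh huv).le

section

variable {d i j k : ℕ} {F : ℝ → ℝ} {p : ℝ} {G G' : ℝ → ℝ → ℝ}

lemma GaugePair.youngPair (hG : GaugePair F p G G') {A B s t : ℝ} (hA : 0 ≤ A) (hB : 0 ≤ B)
    {f : ℝ → Tens d i} {g : ℝ → Tens d j}
    (hf : ∀ u v, s ≤ u → u ≤ v → v ≤ t → ‖incr f u v‖ ≤ A * G u v)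
    (hg : ∀ u v, s ≤ u → u ≤ v → v ≤ t → ‖incr g u v‖ ≤ B * G' u v) :
    YoungPair F p (A * B) f g s t := by
  intro lo x y z w hi h1 h2 h3 h4 h5 h6 h7 h8
  have a1 := (hf x y (h1.trans h2) h3 (h4.trans h8)).trans
    (mul_le_mul_of_nonneg_left (hG.mono lo x y hi h2 h3 h4) hA)
  have a2 := (hg z w (h1.trans h5) h6 (h7.trans h8)).trans
    (mul_le_mul_of_nonneg_left (hG.mono' lo z w hi h5 h6 h7) hB)
  have hlh : lo ≤ hi := h2.trans (h3.trans h4)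
  calc _ ≤ (A * G lo hi) * (B * G' lo hi) :=
        mul_le_mul a1 a2 (norm_nonneg _) (mul_nonneg hA (hG.nonneg _ _ hlh))
    _ = A * B * (G lo hi * G' lo hi) := by ring
    _ ≤ _ := mul_le_mul_of_nonneg_left (hG.mul_le lo hi hlh) (mul_nonneg hA hB)

lemma GaugePair.young (hG : GaugePair F p G G') (hF : Monotone F) (hp : 1 / 2 < p) {A B s t : ℝ}
    (hst : s ≤ t) (hA : 0 ≤ A) (hB : 0 ≤ B) {f : ℝ → Tens d i} {g : ℝ → Tens d j}
    (hf : ∀ u v, s ≤ u → u ≤ v → v ≤ t → ‖incr f u v‖ ≤ A * G u v)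
    (hg : ∀ u v, s ≤ u → u ≤ v → v ≤ t → ‖incr g u v‖ ≤ B * G' u v) :
    HasYoungIntegral f g s t (youngIntegral f g s t) ∧
    (f s = 0 → ‖youngIntegral f g s t‖ ≤ A * B * sewConst p * mixGauge F p s t) ∧
    ∀ u, s ≤ u → u ≤ t →
      youngIntegral f g s t = youngIntegral f g s u + youngIntegral f g u t := by
  obtain ⟨I, hadd, hI, hb⟩ := (hG.youngPair hA hB hf hg).exists_integral hF hp hst
    (mul_nonneg hA hB)
  have e := (hI s t le_rfl hst le_rfl).eq hst
  refine ⟨e ▸ hI s t le_rfl hst le_rfl, fun h0 => ?_, fun u h1 h2 => ?_⟩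
  · have := hb s t le_rfl hst le_rfl
    rwa [h0, zero_tmul, sub_zero, ← e] at this
  · rw [e, (hI s u le_rfl h1 h2).eq h1, (hI u t h1 h2 le_rfl).eq h2]
    exact hadd s u t le_rfl h1 h2 le_rfl

/-- Young integrals depend on the integrand and the integrator in a Lipschitz way. -/
lemma CloseOn.young (hG : GaugePair F p G G') (hF : Monotone F) (hp : 1 / 2 < p) {A B ε s t : ℝ}
    (hst : s ≤ t) (hA : 0 ≤ A) (hB : 0 ≤ B) (hε : 0 ≤ ε) {f f' : ℝ → Tens d i}
    {g g' : ℝ → Tens d j} (hf : CloseOn G A ε (incr f) (incr f') s t)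
    (hg : CloseOn G' B ε (incr g) (incr g') s t) (h0 : f s = 0) (h0' : f' s = 0) :
    ‖youngIntegral f g s t‖ ≤ 2 * A * B * sewConst p * mixGauge F p s t ∧
    ‖youngIntegral f' g' s t‖ ≤ 2 * A * B * sewConst p * mixGauge F p s t ∧
    ‖youngIntegral f g s t - youngIntegral f' g' s t‖ ≤
      2 * A * B * sewConst p * ε * mixGauge F p s t := by
  have hpos : 0 ≤ A * B * sewConst p * mixGauge F p s t :=
    mul_nonneg (mul_nonneg (mul_nonneg hA hB) (sewConst_nonneg p)) (mixGauge_nonneg hst)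
  have y1 := hG.young hF hp hst hA hB hf.left hg.left
  have y2 := hG.young hF hp hst hA hB hf.right hg.right
  -- The intermediate integral ∫ f' dg splits the difference into ∫ (f - f') dg and ∫ f' d(g - g'),
  -- each with one small factor.
  have y3 := hG.young hF hp hst hA hB hf.right hg.left
  have d1 := hG.young hF hp hst (mul_nonneg hA hε) hB (f := fun x => f x - f' x) (g := g)
    (fun u v a b c => by
      have := hf.diff u v a b c
      simp only [incr] at this ⊢
      rwa [sub_sub_sub_comm]) hg.left
  have d2 := hG.young hF hp hst hA (mul_nonneg hB hε) (f := f') (g := fun x => g x - g' x)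
    hf.right (fun u v a b c => by
      have := hg.diff u v a b c
      simp only [incr] at this ⊢
      rwa [sub_sub_sub_comm])
  have e1 := d1.1.unique hst (y1.1.sub y3.1 (f'' := fun x => f x - f' x) (g'' := g)
    fun x y z => by rw [sub_tmul])
  have e2 := d2.1.unique hst (y3.1.sub y2.1 (f'' := f') (g'' := fun x => g x - g' x)
    fun x y z => by rw [← tmul_sub, sub_sub_sub_comm])
  refine ⟨(y1.2.1 h0).trans (by linarith), (y2.2.1 h0').trans (by linarith), ?_⟩
  have b1 := d1.2.1 (by simp [h0, h0'])
  have b2 := d2.2.1 h0'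
  rw [e1] at b1
  rw [e2] at b2
  calc _ ≤ _ := norm_sub_le_norm_sub_add_norm_sub _ (youngIntegral f' g s t) _
    _ ≤ _ := add_le_add b1 b2
    _ = _ := by ring

/-! ### Second level -/

/-- The iterated integral `∫_s^t (p_u - p_s) ⊗ dq_u`. -/
noncomputable def lev2 (p : ℝ → Tens d i) (q : ℝ → Tens d j) (s t : ℝ) : Tens d (i + j) :=
  youngIntegral (fun u => p u - p s) q s t

/-- Chen's identity for a two-parameter function on `[0,1]` that behaves like `∫ p ⊗ dq`. -/
def IsChen (L : ℝ → ℝ → Tens d (i + j)) (p : ℝ → Tens d i) (q : ℝ → Tens d j) : Prop :=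
  ∀ s u t, 0 ≤ s → s ≤ u → u ≤ t → t ≤ 1 →
    L s t = L s u + L u t + tmul (p u - p s) (q t - q u)

lemma IsChen.self {L : ℝ → ℝ → Tens d (i + j)} {p : ℝ → Tens d i} {q : ℝ → Tens d j}
    (h : IsChen L p q) {s : ℝ} (h0 : 0 ≤ s) (h1 : s ≤ 1) : L s s = 0 := by
  simpa using h s s s h0 le_rfl le_rfl h1

lemma incr_sub_const {E : Type*} [AddCommGroup E] (f : ℝ → E) (c : E) :
    incr (fun u => f u - c) = incr f := by
  ext u v; simp [incr]

lemma lev2_hasYoungIntegral (hG : GaugePair F p G G') (hF : Monotone F) (hp : 1 / 2 < p)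
    {A B : ℝ} (hA : 0 ≤ A) (hB : 0 ≤ B) {x : ℝ → Tens d i} {y : ℝ → Tens d j}
    (hx : ∀ u v, 0 ≤ u → u ≤ v → v ≤ 1 → ‖incr x u v‖ ≤ A * G u v)
    (hy : ∀ u v, 0 ≤ u → u ≤ v → v ≤ 1 → ‖incr y u v‖ ≤ B * G' u v) {s t : ℝ} (hs : 0 ≤ s)
    (hst : s ≤ t) (ht : t ≤ 1) :
    HasYoungIntegral (fun u => x u - x s) y s t (lev2 x y s t) :=
  (hG.young hF hp hst hA hB (by
    rw [incr_sub_const]; exact fun u v a b c => hx u v (hs.trans a) b (c.trans ht))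
    fun u v a b c => hy u v (hs.trans a) b (c.trans ht)).1

/-- Additivity of the integral over [s,u] and [u,t]; rebasing the integrand on [u,t] from s to u
produces the constant integrand x u - x s and hence the tensor term. -/
lemma lev2_isChen (hG : GaugePair F p G G') (hF : Monotone F) (hp : 1 / 2 < p)
    {A B : ℝ} (hA : 0 ≤ A) (hB : 0 ≤ B) {x : ℝ → Tens d i} {y : ℝ → Tens d j}
    (hx : ∀ u v, 0 ≤ u → u ≤ v → v ≤ 1 → ‖incr x u v‖ ≤ A * G u v)
    (hy : ∀ u v, 0 ≤ u → u ≤ v → v ≤ 1 → ‖incr y u v‖ ≤ B * G' u v) :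
    IsChen (lev2 x y) x y := by
  intro s u t hs hsu hut ht
  have h1 := (hG.young hF hp (hsu.trans hut) hA hB (f := fun u => x u - x s) (g := y) (by
    rw [incr_sub_const]; exact fun u v a b c => hx u v (hs.trans a) b (c.trans ht))
    fun u v a b c => hy u v (hs.trans a) b (c.trans ht)).2.2 u hsu hut
  have h2 := lev2_hasYoungIntegral hG hF hp hA hB hx hy (hs.trans hsu) hut ht
  have h3 := (hG.young hF hp hut hA hB (f := fun u => x u - x s) (g := y) (by
    rw [incr_sub_const]; exact fun u' v a b c => hx u' v (hs.trans (hsu.trans a)) b (c.trans ht))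
    fun u' v a b c => hy u' v (hs.trans (hsu.trans a)) b (c.trans ht)).1
  have h4 := (h3.sub (hasYoungIntegral_const (x u - x s) y u t) (f'' := fun v => x v - x u)
    (g'' := y) fun a b c => by rw [← sub_tmul, sub_sub_sub_cancel_right]).unique hut h2
  rw [lev2, h1, ← h4, lev2]
  abel

lemma CloseOn.lev2 (hG : GaugePair F p G G') (hF : Monotone F) (hp : 1 / 2 < p)
    {A B ε : ℝ} (hA : 0 ≤ A) (hB : 0 ≤ B) (hε : 0 ≤ ε) {x x' : ℝ → Tens d i} {y y' : ℝ → Tens d j}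
    (hx : CloseOn G A ε (incr x) (incr x') 0 1) (hy : CloseOn G' B ε (incr y) (incr y') 0 1) :
    CloseOn (mixGauge F p) (2 * A * B * sewConst p) ε (lev2 x y) (lev2 x' y') 0 1 := by
  have key := fun (s t : ℝ) (h1 : 0 ≤ s) (h2 : s ≤ t) (h3 : t ≤ 1) =>
    CloseOn.young hG hF hp h2 hA hB hε (f := fun u => x u - x s) (f' := fun u => x' u - x' s)
      (by rw [incr_sub_const, incr_sub_const]; exact hx.mono h1 h3) (hy.mono h1 h3)
      (sub_self _) (sub_self _)
  exact ⟨fun s t h1 h2 h3 => (key s t h1 h2 h3).1, fun s t h1 h2 h3 => (key s t h1 h2 h3).2.1,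
    fun s t h1 h2 h3 => (key s t h1 h2 h3).2.2⟩

/-! ### Third level -/

/-- By Chen's identity L_{s,v} - L_{s,u} = L_{u,v} + x_{s,u} ⊗ y_{u,v}. On [s,t] both terms are
G(u,v) times a factor of order (t - s)^a, so u ↦ L_{s,u} is as regular as G, with a constant that
shrinks with the interval. That constant supplies the extra power in the third-level bounds. -/
lemma CloseOn.incr_left {a K K₁ K₂ ε s t : ℝ} (hG : ∀ u v, u ≤ v → 0 ≤ G u v) (ha : 0 ≤ a)
    (hK : 0 ≤ K) (hK₁ : 0 ≤ K₁) (hε : 0 ≤ ε) {L L' : ℝ → ℝ → Tens d (i + j)} {x x' : ℝ → Tens d i}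
    {y y' : ℝ → Tens d j} (hL : CloseOn (fun u v => powGauge a u v * G u v) K ε L L' 0 1)
    (hc : IsChen L x y) (hc' : IsChen L' x' y')
    (hx : CloseOn (powGauge a) K₁ ε (incr x) (incr x') 0 1)
    (hy : CloseOn G K₂ ε (incr y) (incr y') 0 1) (hs : 0 ≤ s) (hst : s ≤ t) (ht : t ≤ 1) :
    CloseOn G ((K + 2 * K₁ * K₂) * powGauge a s t) ε (incr (L s)) (incr (L' s)) s t := by
  have hst' : 0 ≤ t - s := sub_nonneg.2 hst
  have h1 : CloseOn G (K * powGauge a s t) ε L L' s t :=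
    (hL.mono hs ht).mono_gauge hK hε fun u v a1 b c =>
      mul_le_mul_of_nonneg_right (Real.rpow_le_rpow (by linarith) (by linarith) ha) (hG u v b)
  have hb : ∀ u, s ≤ u → u ≤ t → powGauge a s u ≤ powGauge a s t := fun u a1 b =>
    Real.rpow_le_rpow (by linarith) (by linarith) ha
  have h2 := CloseOn.tmul_of_le (A := K₁ * powGauge a s t) (E₁ := fun u _ => incr x s u)
    (E₂ := fun u _ => incr x' s u) (s := s) (t := t) (ε := ε) (mul_nonneg hK₁ (powGauge_nonneg hst))
    (fun u v a1 b c => (hx.left s u hs a1 (b.trans (c.trans ht))).trans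
      (mul_le_mul_of_nonneg_left (hb u a1 (b.trans c)) hK₁))
    (fun u v a1 b c => (hx.right s u hs a1 (b.trans (c.trans ht))).trans
      (mul_le_mul_of_nonneg_left (hb u a1 (b.trans c)) hK₁))
    (fun u v a1 b c => (hx.diff s u hs a1 (b.trans (c.trans ht))).trans
      ((mul_le_mul_of_nonneg_left (hb u a1 (b.trans c)) (mul_nonneg hK₁ hε)).trans_eq (by ring)))
    (hy.mono hs ht)
  have h3 := h1.add h2
  rw [show K * powGauge a s t + 2 * (K₁ * powGauge a s t) * K₂ =
    (K + 2 * K₁ * K₂) * powGauge a s t by ring] at h3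
  refine h3.congr (fun u v a1 b c => ?_) fun u v a1 b c => ?_
  · simp only [incr]; rw [hc s u v hs a1 b (c.trans ht)]; abel
  · simp only [incr]; rw [hc' s u v hs a1 b (c.trans ht)]; abel

/-- The mirror image: L_{v,t} - L_{u,t} = -(L_{u,v} + x_{u,v} ⊗ y_{v,t}), where now y contributes
the factor (t - s)^a and x the gauge. -/
lemma CloseOn.incr_right {a K K₁ K₂ ε s t : ℝ} (hG : ∀ u v, u ≤ v → 0 ≤ G u v) (ha : 0 ≤ a)
    (hK : 0 ≤ K) (hK₂ : 0 ≤ K₂) (hε : 0 ≤ ε) {L L' : ℝ → ℝ → Tens d (i + j)} {x x' : ℝ → Tens d i}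
    {y y' : ℝ → Tens d j} (hL : CloseOn (fun u v => powGauge a u v * G u v) K ε L L' 0 1)
    (hc : IsChen L x y) (hc' : IsChen L' x' y')
    (hx : CloseOn G K₁ ε (incr x) (incr x') 0 1)
    (hy : CloseOn (powGauge a) K₂ ε (incr y) (incr y') 0 1) (hs : 0 ≤ s) (hst : s ≤ t)
    (ht : t ≤ 1) :
    CloseOn G ((K + 2 * K₁ * K₂) * powGauge a s t) ε (incr fun u => L u t) (incr fun u => L' u t)
      s t := by
  have hst' : 0 ≤ t - s := sub_nonneg.2 hst
  have h1 : CloseOn G (K * powGauge a s t) ε L L' s t :=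
    (hL.mono hs ht).mono_gauge hK hε fun u v a1 b c =>
      mul_le_mul_of_nonneg_right (Real.rpow_le_rpow (by linarith) (by linarith) ha) (hG u v b)
  have hb : ∀ u, s ≤ u → u ≤ t → powGauge a u t ≤ powGauge a s t := fun u a1 b =>
    Real.rpow_le_rpow (by linarith) (by linarith) ha
  have h2 := CloseOn.of_le_tmul (A := K₂ * powGauge a s t) (E₁ := fun _ v => incr y v t)
    (E₂ := fun _ v => incr y' v t) (s := s) (t := t) (ε := ε) (mul_nonneg hK₂ (powGauge_nonneg hst))
    (fun u v a1 b c => (hy.left v t (hs.trans (a1.trans b)) c ht).trans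
      (mul_le_mul_of_nonneg_left (hb v (a1.trans b) c) hK₂))
    (fun u v a1 b c => (hy.right v t (hs.trans (a1.trans b)) c ht).trans
      (mul_le_mul_of_nonneg_left (hb v (a1.trans b) c) hK₂))
    (fun u v a1 b c => (hy.diff v t (hs.trans (a1.trans b)) c ht).trans
      ((mul_le_mul_of_nonneg_left (hb v (a1.trans b) c) (mul_nonneg hK₂ hε)).trans_eq (by ring)))
    (hx.mono hs ht)
  have h3 := (h1.add h2).neg
  rw [show K * powGauge a s t + 2 * (K₂ * powGauge a s t) * K₁ =
    (K + 2 * K₁ * K₂) * powGauge a s t by ring] at h3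
  refine h3.congr (fun u v a1 b c => ?_) fun u v a1 b c => ?_
  · simp only [incr]; rw [hc u v t (hs.trans a1) b c ht]; abel
  · simp only [incr]; rw [hc' u v t (hs.trans a1) b c ht]; abel

/-- The integrals `∫_s^t L_{s,u} ⊗ dz_u`. -/
lemma CloseOn.intLeft {a K K₁ K₂ K₃ ε : ℝ} (hG : GaugePair F p G G') (hF : Monotone F)
    (hp : 1 / 2 < p) (ha : 0 ≤ a) (hK : 0 ≤ K) (hK₁ : 0 ≤ K₁) (hK₂ : 0 ≤ K₂) (hK₃ : 0 ≤ K₃)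
    (hε : 0 ≤ ε) {L L' : ℝ → ℝ → Tens d (i + j)} {x x' : ℝ → Tens d i}
    {y y' : ℝ → Tens d j} {z z' : ℝ → Tens d k}
    (hL : CloseOn (fun u v => powGauge a u v * G u v) K ε L L' 0 1)
    (hc : IsChen L x y) (hc' : IsChen L' x' y')
    (hx : CloseOn (powGauge a) K₁ ε (incr x) (incr x') 0 1)
    (hy : CloseOn G K₂ ε (incr y) (incr y') 0 1)
    (hz : CloseOn G' K₃ ε (incr z) (incr z') 0 1) :
    (∀ s t, 0 ≤ s → s ≤ t → t ≤ 1 → YoungIntegrable (fun u => L s u) z s t) ∧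
    CloseOn (fun u v => powGauge a u v * mixGauge F p u v)
      (2 * (K + 2 * K₁ * K₂) * K₃ * sewConst p) ε
      (fun s t => youngIntegral (fun u => L s u) z s t)
      (fun s t => youngIntegral (fun u => L' s u) z' s t) 0 1 := by
  have hinc := fun (s t : ℝ) (h1 : 0 ≤ s) (h2 : s ≤ t) (h3 : t ≤ 1) =>
    CloseOn.incr_left hG.nonneg ha hK hK₁ hε hL hc hc' hx hy h1 h2 h3
  have hpos : ∀ s t, s ≤ t → 0 ≤ (K + 2 * K₁ * K₂) * powGauge a s t := fun s t h2 =>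
    mul_nonneg (by positivity) (powGauge_nonneg h2)
  have key := fun (s t : ℝ) (h1 : 0 ≤ s) (h2 : s ≤ t) (h3 : t ≤ 1) =>
    CloseOn.young hG hF hp h2 (hpos s t h2) hK₃ hε
      (hinc s t h1 h2 h3) (hz.mono h1 h3) (hc.self h1 (h2.trans h3)) (hc'.self h1 (h2.trans h3))
  refine ⟨fun s t h1 h2 h3 => ⟨_, (hG.young hF hp h2 (hpos s t h2) hK₃
    (hinc s t h1 h2 h3).left (hz.mono h1 h3).left).1⟩, fun s t h1 h2 h3 => ?_,
    fun s t h1 h2 h3 => ?_, fun s t h1 h2 h3 => ?_⟩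
  · exact (key s t h1 h2 h3).1.trans_eq (by ring)
  · exact (key s t h1 h2 h3).2.1.trans_eq (by ring)
  · exact (key s t h1 h2 h3).2.2.trans_eq (by ring)

/-- The integrals `∫_s^t (z_u - z_s) ⊗ d_u L_{u,t}`. -/
lemma CloseOn.intRight {a K K₁ K₂ K₃ ε : ℝ} (hG : GaugePair F p G G') (hF : Monotone F)
    (hp : 1 / 2 < p) (ha : 0 ≤ a) (hK : 0 ≤ K) (hK₁ : 0 ≤ K₁) (hK₂ : 0 ≤ K₂) (hK₃ : 0 ≤ K₃)
    (hε : 0 ≤ ε) {L L' : ℝ → ℝ → Tens d (i + j)} {x x' : ℝ → Tens d i}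
    {y y' : ℝ → Tens d j} {z z' : ℝ → Tens d k}
    (hL : CloseOn (fun u v => powGauge a u v * G u v) K ε L L' 0 1)
    (hc : IsChen L x y) (hc' : IsChen L' x' y')
    (hx : CloseOn G K₁ ε (incr x) (incr x') 0 1)
    (hy : CloseOn (powGauge a) K₂ ε (incr y) (incr y') 0 1)
    (hz : CloseOn G' K₃ ε (incr z) (incr z') 0 1) :
    (∀ s t, 0 ≤ s → s ≤ t → t ≤ 1 → YoungIntegrable (fun u => z u - z s) (fun u => L u t) s t) ∧
    CloseOn (fun u v => powGauge a u v * mixGauge F p u v)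
      (2 * (K + 2 * K₁ * K₂) * K₃ * sewConst p) ε
      (fun s t => youngIntegral (fun u => z u - z s) (fun u => L u t) s t)
      (fun s t => youngIntegral (fun u => z' u - z' s) (fun u => L' u t) s t) 0 1 := by
  have hinc := fun (s t : ℝ) (h1 : 0 ≤ s) (h2 : s ≤ t) (h3 : t ≤ 1) =>
    CloseOn.incr_right hG.nonneg ha hK hK₂ hε hL hc hc' hx hy h1 h2 h3
  have hpos : ∀ s t, s ≤ t → 0 ≤ (K + 2 * K₁ * K₂) * powGauge a s t := fun s t h2 =>
    mul_nonneg (by positivity) (powGauge_nonneg h2)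
  have hz' : ∀ s t, 0 ≤ s → t ≤ 1 → CloseOn G' K₃ ε (incr fun u => z u - z s)
      (incr fun u => z' u - z' s) s t := fun s t h1 h3 => by
    rw [incr_sub_const, incr_sub_const]; exact hz.mono h1 h3
  have key := fun (s t : ℝ) (h1 : 0 ≤ s) (h2 : s ≤ t) (h3 : t ≤ 1) =>
    CloseOn.young hG.symm hF hp h2 hK₃ (hpos s t h2) hε (hz' s t h1 h3)
      (hinc s t h1 h2 h3) (sub_self _) (sub_self _)
  refine ⟨fun s t h1 h2 h3 => ⟨_, (hG.symm.young hF hp h2 hK₃ (hpos s t h2)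
    (hz' s t h1 h3).left (hinc s t h1 h2 h3).left).1⟩, fun s t h1 h2 h3 => ?_,
    fun s t h1 h2 h3 => ?_, fun s t h1 h2 h3 => ?_⟩
  · exact (key s t h1 h2 h3).1.trans_eq (by ring)
  · exact (key s t h1 h2 h3).2.1.trans_eq (by ring)
  · exact (key s t h1 h2 h3).2.2.trans_eq (by ring)

end

/-! ### Young translation by a general path -/

namespace PathTranslation

variable {d : ℕ}

/-- `∫_s^t x¹_{s,u} ⊗ dg_u` -/
noncomputable def A1 (X : RoughFunctional d) (g : ℝ → Tens d 1) (s t : ℝ) : Tens d 2 :=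
  youngIntegral (fun u => X 1 s u) g s t

/-- `∫_s^t x²_{s,u} ⊗ dg_u` -/
noncomputable def B1 (X : RoughFunctional d) (g : ℝ → Tens d 1) (s t : ℝ) : Tens d 3 :=
  youngIntegral (fun u => X 2 s u) g s t

/-- `∫_s^t ∫_s^v x¹_{s,u} ⊗ dg_u ⊗ dx_v` -/
noncomputable def B2 (X : RoughFunctional d) (g : ℝ → Tens d 1) (s t : ℝ) : Tens d 3 :=
  youngIntegral (fun v => A1 X g s v) (fun v => X 1 0 v) s t

/-- `-∫_s^t (g_u - g_s) ⊗ dx²_{u,t}` -/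
noncomputable def B3 (X : RoughFunctional d) (g : ℝ → Tens d 1) (s t : ℝ) : Tens d 3 :=
  -youngIntegral (i := 1) (j := 2) (fun u => g u - g s) (fun u => X 2 u t) s t

/-- `-∫_s^t x¹_{s,u} ⊗ dg²_{u,t}` -/
noncomputable def C1 (X : RoughFunctional d) (g : ℝ → Tens d 1) (s t : ℝ) : Tens d 3 :=
  -youngIntegral (i := 1) (j := 2) (fun u => X 1 s u) (fun u => lev2 g g u t) s t

/-- `∫_s^t ∫_s^v (g_u - g_s) ⊗ dx_u ⊗ dg_v` -/
noncomputable def C2 (X : RoughFunctional d) (g : ℝ → Tens d 1) (s t : ℝ) : Tens d 3 :=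
  youngIntegral (fun v => lev2 g (X 1 0) s v) g s t

/-- `∫_s^t g²_{s,u} ⊗ dx_u` -/
noncomputable def C3 (X : RoughFunctional d) (g : ℝ → Tens d 1) (s t : ℝ) : Tens d 3 :=
  youngIntegral (fun u => lev2 g g s u) (fun u => X 1 0 u) s t

/-- The third iterated integral of `g`. -/
noncomputable def g3 (g : ℝ → Tens d 1) (s t : ℝ) : Tens d 3 :=
  youngIntegral (fun u => lev2 g g s u) g s t

/-- The cross terms of the second level. -/
noncomputable def cross2 (X : RoughFunctional d) (g : ℝ → Tens d 1) (s t : ℝ) : Tens d 2 :=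
  A1 X g s t + lev2 g (X 1 0) s t + lev2 g g s t

/-- The cross terms of the third level. -/
noncomputable def cross3 (X : RoughFunctional d) (g : ℝ → Tens d 1) (s t : ℝ) : Tens d 3 :=
  B1 X g s t + B2 X g s t + B3 X g s t + C1 X g s t + C2 X g s t + C3 X g s t + g3 g s t

end PathTranslation

open PathTranslation

/-- The translation of `X` by the path `g`. -/
noncomputable def translation {d : ℕ} (X : RoughFunctional d) (g : ℝ → Tens d 1) :
    RoughFunctional d
  | 1 => fun s t => X 1 s t + incr g s t
  | 2 => fun s t => X 2 s t + cross2 X g s t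
  | 3 => fun s t => X 3 s t + cross3 X g s t
  | _ => fun _ _ => 0

/-- From here on only the path of γ matters. This allows translation by mollified paths, which need
not come from Cameron-Martin elements. -/
lemma youngTranslation_eq {d : ℕ} {H : Ioo (0 : ℝ) 1} (X : RoughFunctional d)
    (γ : CameronMartin d H) :
    youngTranslation X γ = translation X (YoungTranslation.path γ) := by
  funext i s t
  match i with
  | 0 => rfl
  | 1 => rfl
  | 2 =>
    change X 2 s t + _ + _ + _ = X 2 s t + (_ + _ + _)
    simp only [add_assoc]
    rfl
  | 3 =>
    change X 3 s t + _ + _ + _ + _ + _ + _ + _ = X 3 s t + (_ + _ + _ + _ + _ + _ + _)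
    simp only [add_assoc]
    rfl
  | (n + 4) => rfl

/-- `X`, `Y` satisfy Chen's identity at the first two levels, `g`, `k` have mixed
Hölder-variation regularity, and `(X, g)`, `(Y, k)` are `ε`-close. -/
structure RoughClose {d : ℕ} (F : ℝ → ℝ) (a h K ε : ℝ) (X Y : RoughFunctional d)
    (g k : ℝ → Tens d 1) : Prop where
  chen1 : ∀ s t, 0 ≤ s → s ≤ t → t ≤ 1 → X 1 s t = X 1 0 t - X 1 0 s
  chen1' : ∀ s t, 0 ≤ s → s ≤ t → t ≤ 1 → Y 1 s t = Y 1 0 t - Y 1 0 s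
  chen2 : IsChen (i := 1) (j := 1) (X 2) (X 1 0) (X 1 0)
  chen2' : IsChen (i := 1) (j := 1) (Y 2) (Y 1 0) (Y 1 0)
  close1 : CloseOn (powGauge a) K ε (X 1) (Y 1) 0 1
  close2 : CloseOn (powGauge (2 * a)) K ε (X 2) (Y 2) 0 1
  closeg : CloseOn (mixGauge F h) K ε (incr g) (incr k) 0 1

lemma CloseOn.mono_gauge_one {E : Type*} [NormedAddCommGroup E] {G G' : ℝ → ℝ → ℝ}
    {K ε s t : ℝ} {L L' : ℝ → ℝ → E} (h : CloseOn G K ε L L' s t) (hK : 0 ≤ K) (hε : 0 ≤ ε)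
    (hG : ∀ u v, s ≤ u → u ≤ v → v ≤ t → G u v ≤ G' u v) : CloseOn G' K ε L L' s t := by
  simpa using h.mono_gauge (c := 1) hK hε (fun u v a b c => by simpa using hG u v a b c)

lemma powGauge_le_of_le {p q u v : ℝ} (hq : 0 < q) (hqp : q ≤ p) (huv : u ≤ v)
    (h1 : v - u ≤ 1) : powGauge p u v ≤ powGauge q u v := by
  unfold powGauge
  rcases (sub_nonneg.2 huv).eq_or_lt with h | h
  · rw [← h, Real.zero_rpow (by linarith), Real.zero_rpow hq.ne']
  · exact Real.rpow_le_rpow_of_exponent_ge h h1 hqp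

lemma mixGauge_le_powGauge {F : ℝ → ℝ} (hF1 : ∀ t, F t ∈ Icc (0 : ℝ) 1) {p u v : ℝ}
    (huv : u ≤ v) : mixGauge F p u v ≤ powGauge p u v := by
  refine mul_le_of_le_one_right (powGauge_nonneg huv) ?_
  rw [Real.sqrt_le_iff]
  exact ⟨zero_le_one, by linarith [(hF1 u).1, (hF1 v).2]⟩

lemma powGauge_mul {a b u v : ℝ} (ha : 0 ≤ a) (hb : 0 ≤ b) (huv : u ≤ v) :
    powGauge a u v * powGauge b u v = powGauge (a + b) u v :=
  (Real.rpow_add_of_nonneg (sub_nonneg.2 huv) ha hb).symm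

/-! ### Existence of the Young integrals and Lipschitz bounds for the cross terms -/

section

variable {d : ℕ} {F : ℝ → ℝ} {a h K ε : ℝ} {X Y : RoughFunctional d} {g k : ℝ → Tens d 1}

lemma RoughClose.incr_x (H : RoughClose F a h K ε X Y g k) :
    CloseOn (powGauge a) K ε (incr (X 1 0)) (incr (Y 1 0)) 0 1 :=
  H.close1.congr H.chen1 H.chen1'

lemma A1_eq (hX : ∀ s t, 0 ≤ s → s ≤ t → t ≤ 1 → X 1 s t = X 1 0 t - X 1 0 s) {s t : ℝ}
    (hs : 0 ≤ s) (hst : s ≤ t) (ht : t ≤ 1) : A1 X g s t = lev2 (X 1 0) g s t :=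
  youngIntegral_congr hst (fun x hx => hX s x hs hx.1 (hx.2.trans ht)) fun _ _ => rfl

lemma C1_eq (hX : ∀ s t, 0 ≤ s → s ≤ t → t ≤ 1 → X 1 s t = X 1 0 t - X 1 0 s) {s t : ℝ}
    (hs : 0 ≤ s) (hst : s ≤ t) (ht : t ≤ 1) : C1 X g s t =
      -youngIntegral (fun u => X 1 0 u - X 1 0 s) (fun u => lev2 g g u t) s t :=
  congrArg Neg.neg (youngIntegral_congr (i := 1) (j := 2) hst
    (fun x hx => hX s x hs hx.1 (hx.2.trans ht)) fun _ _ => rfl)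

lemma YoungIntegrable.congr {i j : ℕ} {f f' : ℝ → Tens d i} {g g' : ℝ → Tens d j} {s t : ℝ}
    (hI : YoungIntegrable f g s t) (hf : ∀ x ∈ Icc s t, f x = f' x)
    (hg : ∀ x ∈ Icc s t, g x = g' x) : YoungIntegrable f' g' s t :=
  ⟨_, hI.choose_spec.congr hf hg⟩

/-- All Young integrals in the translation exist, and the cross terms depend on `(X, g)` in a
Lipschitz way. -/
theorem RoughClose.estimates (hF : Monotone F) (hF1 : ∀ t, F t ∈ Icc (0 : ℝ) 1) (ha : 0 < a)
    (hah : a ≤ h) (hp : 1 / 2 < a + h) (hK : 0 ≤ K) (hε : 0 ≤ ε)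
    (H : RoughClose F a h K ε X Y g k) {S c D₁ D₂ : ℝ} (hS : S = sewConst (a + h))
    (hc : c = 2 * K * K * S) (hD₁ : D₁ = 2 * (K + 2 * K * K) * K * S)
    (hD₂ : D₂ = 2 * (c + 2 * K * K) * K * S) :
    (∀ s t, 0 ≤ s → s ≤ t → t ≤ 1 →
      (YoungIntegrable (fun u => g u - g s) g s t ∧
        YoungIntegrable (fun u => X 1 s u) g s t ∧
        YoungIntegrable (fun u => g u - g s) (X 1 0) s t) ∧
      YoungIntegrable (fun u => lev2 g g s u) g s t ∧
      YoungIntegrable (fun u => X 2 s u) g s t ∧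
      YoungIntegrable (fun v => A1 X g s v) (X 1 0) s t ∧
      YoungIntegrable (fun u => g u - g s) (fun u => X 2 u t) s t ∧
      YoungIntegrable (fun u => X 1 s u) (fun u => lev2 g g u t) s t ∧
      YoungIntegrable (fun v => lev2 g (X 1 0) s v) g s t ∧
      YoungIntegrable (fun u => lev2 g g s u) (X 1 0) s t) ∧
    CloseOn (powGauge h) K ε (incr g) (incr k) 0 1 ∧
    CloseOn (powGauge (a + h)) (c + c + c) ε (cross2 X g) (cross2 Y k) 0 1 ∧
    CloseOn (powGauge (a + (a + h))) (D₁ + D₂ + D₁ + D₂ + D₂ + D₂ + D₂) ε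
      (cross3 X g) (cross3 Y k) 0 1 := by
  have hh : 0 ≤ h := ha.le.trans hah
  have hS0 : 0 ≤ S := hS ▸ sewConst_nonneg _
  have hc0 : 0 ≤ c := by rw [hc]; positivity
  have hD₁0 : 0 ≤ D₁ := by rw [hD₁]; positivity
  have hD₂0 : 0 ≤ D₂ := by rw [hD₂]; positivity
  have gp := gaugePair_pow_mix hF ha.le hh
  have hx := H.incr_x
  have hg := H.closeg
  -- Since a ≤ h, the path g is also a-Hölder and can play either role in a gauge pair. This is what
  -- makes the iterated integrals of g against itself fit the same scheme.
  have hgP : CloseOn (powGauge a) K ε (incr g) (incr k) 0 1 :=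
    hg.mono_gauge_one hK hε fun u v h1 h2 h3 =>
      (mixGauge_le_powGauge hF1 h2).trans (powGauge_le_of_le ha hah h2 (by linarith))
  have hX2 : CloseOn (fun u v => powGauge a u v * powGauge a u v) K ε (X 2) (Y 2) 0 1 :=
    H.close2.mono_gauge_one hK hε fun u v h1 h2 h3 => by
      rw [powGauge_mul ha.le ha.le h2, two_mul]
  -- second level
  have l1 := CloseOn.lev2 gp hF hp hK hK hε hx hg
  have l2 := CloseOn.lev2 gp.symm hF hp hK hK hε hg hx
  have l3 := CloseOn.lev2 gp hF hp hK hK hε hgP hg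
  rw [← hS, ← hc] at l1 l2 l3
  have ch1 := lev2_isChen gp hF hp hK hK hx.left hg.left
  have ch1' := lev2_isChen gp hF hp hK hK hx.right hg.right
  have ch2 := lev2_isChen gp.symm hF hp hK hK hg.left hx.left
  have ch2' := lev2_isChen gp.symm hF hp hK hK hg.right hx.right
  have ch3 := lev2_isChen gp hF hp hK hK hgP.left hg.left
  have ch3' := lev2_isChen gp hF hp hK hK hgP.right hg.right
  -- In each third-level integral one side must carry the gauge of order h. If the remaining factor
  -- is x, the second level in γ keeps it (`toQ`); if the remaining factor is γ, the second level
  -- need only be Hölder (`toP`).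
  have toQ : ∀ {L L' : ℝ → ℝ → Tens d (1 + 1)},
      CloseOn (mixGauge F (a + h)) c ε L L' 0 1 →
      CloseOn (fun u v => powGauge a u v * mixGauge F h u v) c ε L L' 0 1 := fun hL =>
    hL.mono_gauge_one hc0 hε fun u v h1 h2 h3 => (powGauge_mul_mixGauge ha.le hh h2).ge
  have toP : ∀ {L L' : ℝ → ℝ → Tens d (1 + 1)},
      CloseOn (mixGauge F (a + h)) c ε L L' 0 1 →
      CloseOn (fun u v => powGauge a u v * powGauge a u v) c ε L L' 0 1 := fun hL =>
    hL.mono_gauge_one hc0 hε fun u v h1 h2 h3 => by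
      rw [powGauge_mul ha.le ha.le h2]
      exact (mixGauge_le_powGauge hF1 h2).trans
        (powGauge_le_of_le (by linarith) (by linarith) h2 (by linarith))
  -- Once the integrals are formed the factor √(F v - F u) ≤ 1 can be dropped: Besov norms only see
  -- the power of v - u.
  have fin3 : ∀ {D : ℝ} {L L' : ℝ → ℝ → Tens d 3}, 0 ≤ D →
      CloseOn (fun u v => powGauge a u v * mixGauge F (a + h) u v) D ε L L' 0 1 →
      CloseOn (powGauge (a + (a + h))) D ε L L' 0 1 := fun hD hL =>
    hL.mono_gauge_one hD hε fun u v h1 h2 h3 => by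
      rw [← powGauge_mul ha.le (by linarith) h2]
      exact mul_le_mul_of_nonneg_left (mixGauge_le_powGauge hF1 h2) (powGauge_nonneg h2)
  -- third level
  have b1 := CloseOn.intLeft (i := 1) (j := 1) gp hF hp ha.le hK hK hK hK hε hX2 H.chen2 H.chen2'
    hx hx hg
  have b2 := CloseOn.intLeft gp.symm hF hp ha.le hc0 hK hK hK hε (toQ l1) ch1 ch1' hx hg hx
  have b3 := CloseOn.intRight (i := 1) (j := 1) gp hF hp ha.le hK hK hK hK hε hX2 H.chen2 H.chen2'
    hx hx hg
  have c1 := CloseOn.intRight gp.symm hF hp ha.le hc0 hK hK hK hε (toQ l3) ch3 ch3' hg hgP hx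
  have c2 := CloseOn.intLeft gp hF hp ha.le hc0 hK hK hK hε (toP l2) ch2 ch2' hgP hx hg
  have c3 := CloseOn.intLeft gp.symm hF hp ha.le hc0 hK hK hK hε (toQ l3) ch3 ch3' hgP hg hx
  have e3 := CloseOn.intLeft gp hF hp ha.le hc0 hK hK hK hε (toP l3) ch3 ch3' hgP hgP hg
  rw [← hS, ← hD₁] at b1 b3
  rw [← hS, ← hD₂] at b2 c1 c2 c3 e3
  refine ⟨fun s t h1 h2 h3 => ⟨⟨?_, ?_, ?_⟩, e3.1 s t h1 h2 h3, b1.1 s t h1 h2 h3, ?_,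
    b3.1 s t h1 h2 h3, ?_, c2.1 s t h1 h2 h3, c3.1 s t h1 h2 h3⟩, ?_, ?_, ?_⟩
  · exact ⟨_, lev2_hasYoungIntegral gp hF hp hK hK hgP.left hg.left h1 h2 h3⟩
  · exact ⟨_, (lev2_hasYoungIntegral gp hF hp hK hK hx.left hg.left h1 h2 h3).congr
      (fun x hx => (H.chen1 s x h1 hx.1 (hx.2.trans h3)).symm) fun _ _ => rfl⟩
  · exact ⟨_, lev2_hasYoungIntegral gp.symm hF hp hK hK hg.left hx.left h1 h2 h3⟩
  · exact (b2.1 s t h1 h2 h3).congr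
      (fun x hx => (A1_eq H.chen1 h1 hx.1 (hx.2.trans h3)).symm) fun _ _ => rfl
  · exact (c1.1 s t h1 h2 h3).congr
      (fun x hx => (H.chen1 s x h1 hx.1 (hx.2.trans h3)).symm) fun _ _ => rfl
  · exact hg.mono_gauge_one hK hε fun u v h1 h2 h3 => mixGauge_le_powGauge hF1 h2
  · have l1' : CloseOn (mixGauge F (a + h)) c ε (A1 X g) (A1 Y k) 0 1 :=
      l1.congr (fun s t h1 h2 h3 => (A1_eq H.chen1 h1 h2 h3).symm)
        fun s t h1 h2 h3 => (A1_eq H.chen1' h1 h2 h3).symm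
    exact ((l1'.add l2).add l3).mono_gauge_one (by positivity) hε
      fun u v h1 h2 h3 => mixGauge_le_powGauge hF1 h2
  · have b2' : CloseOn (powGauge (a + (a + h))) D₂ ε (B2 X g) (B2 Y k) 0 1 :=
      fin3 hD₂0 (b2.2.congr
        (fun s t h1 h2 h3 => youngIntegral_congr h2
          (fun x hx => (A1_eq H.chen1 h1 hx.1 (hx.2.trans h3)).symm) fun _ _ => rfl)
        (fun s t h1 h2 h3 => youngIntegral_congr h2
          (fun x hx => (A1_eq H.chen1' h1 hx.1 (hx.2.trans h3)).symm) fun _ _ => rfl))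
    have c1' : CloseOn (powGauge (a + (a + h))) D₂ ε (C1 X g) (C1 Y k) 0 1 :=
      fin3 hD₂0 (c1.2.neg.congr (fun s t h1 h2 h3 => (C1_eq H.chen1 h1 h2 h3).symm)
        (fun s t h1 h2 h3 => (C1_eq H.chen1' h1 h2 h3).symm))
    have b3' : CloseOn (powGauge (a + (a + h))) D₁ ε (B3 X g) (B3 Y k) 0 1 := fin3 hD₁0 b3.2.neg
    have b1' : CloseOn (powGauge (a + (a + h))) D₁ ε (B1 X g) (B1 Y k) 0 1 := fin3 hD₁0 b1.2
    have c2' : CloseOn (powGauge (a + (a + h))) D₂ ε (C2 X g) (C2 Y k) 0 1 := fin3 hD₂0 c2.2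
    have c3' : CloseOn (powGauge (a + (a + h))) D₂ ε (C3 X g) (C3 Y k) 0 1 := fin3 hD₂0 c3.2
    have e3' : CloseOn (powGauge (a + (a + h))) D₂ ε (g3 g) (g3 k) 0 1 := fin3 hD₂0 e3.2
    exact (((((b1'.add b2').add b3').add c1').add c2').add c3').add e3'

end

/-! ### Smooth paths -/

/-- `p` is continuously differentiable with derivative `p'`. -/
structure IsC1 {E : Type*} [NormedAddCommGroup E] [NormedSpace ℝ E] (p p' : ℝ → E) : Prop where
  hasDerivAt : ∀ t, HasDerivAt p (p' t) t
  cont : Continuous p'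

section

variable {E : Type*} [NormedAddCommGroup E] [NormedSpace ℝ E] {p p' q q' : ℝ → E}

lemma IsC1.continuous (h : IsC1 p p') : Continuous p :=
  continuous_iff_continuousAt.2 fun t => (h.hasDerivAt t).continuousAt

lemma IsC1.sub_const (h : IsC1 p p') (c : E) : IsC1 (fun u => p u - c) p' :=
  ⟨fun t => (h.hasDerivAt t).sub_const c, h.cont⟩

lemma IsC1.exists_bound (h : IsC1 p p') (s t : ℝ) : ∃ A, 0 ≤ A ∧ (∀ r ∈ Icc s t, ‖p' r‖ ≤ A) ∧
    ∀ u ∈ Icc s t, ∀ v ∈ Icc s t, ‖p v - p u‖ ≤ A * |v - u| := by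
  obtain ⟨A, hA⟩ := isCompact_Icc.exists_bound_of_continuousOn (s := Icc s t) h.cont.continuousOn
  have hA' : ∀ r ∈ Icc s t, ‖p' r‖ ≤ max A 0 := fun r hr => (hA r hr).trans (le_max_left _ _)
  exact ⟨max A 0, le_max_right _ _, hA', fun u hu v hv =>
    (convex_Icc s t).norm_image_sub_le_of_norm_hasDerivWithin_le
      (fun x _ => (h.hasDerivAt x).hasDerivWithinAt) hA' hu hv⟩

end

section

variable {d i j k : ℕ}

@[fun_prop]
lemma Continuous.tmul' {α : Type*} [TopologicalSpace α] {f : α → Tens d i} {g : α → Tens d j}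
    (hf : Continuous f) (hg : Continuous g) : Continuous fun x => tmul (f x) (g x) :=
  (tmulL d i j).continuous₂.comp (hf.prodMk hg)

lemma HasDerivAt.tmul' {f : ℝ → Tens d i} {g : ℝ → Tens d j} {f' : Tens d i} {g' : Tens d j}
    {t : ℝ} (hf : HasDerivAt f f' t) (hg : HasDerivAt g g' t) :
    HasDerivAt (fun x => tmul (f x) (g x)) (tmul f' (g t) + tmul (f t) g') t := by
  have := (tmulL d i j).hasDerivAt_of_bilinear (fun _ => hf) fun _ => hg
  exact this.congr_deriv (add_comm _ _)

/-- For continuously differentiable paths, Young integrals are given by primitives. -/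
lemma hasYoungIntegral_of_primitive {f f' : ℝ → Tens d i} {g g' : ℝ → Tens d j}
    {J : ℝ → Tens d (i + j)} (hf : IsC1 f f') (hg : IsC1 g g')
    (hJ : ∀ r, HasDerivAt J (tmul (f r) (g' r)) r) {s t : ℝ} (hst : s ≤ t) :
    HasYoungIntegral f g s t (J t - J s) := by
  obtain ⟨A, hA0, -, hA⟩ := hf.exists_bound s t
  obtain ⟨B, hB0, hB, -⟩ := hg.exists_bound s t
  -- With F the identity and p = 3/2 the mixed gauge is (v - u)², the size of the local Riemann-sum
  -- error for C¹ data.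
  refine hasYoungIntegral_of_additive (F := id) monotone_id (p := 3 / 2) (by norm_num) hst
    (mul_nonneg hA0 hB0) (I := fun u v => J v - J u) (fun u v w _ _ _ _ => by abel)
    fun u ξ v h1 h2 h3 h4 => ?_
  have hΘ : mixGauge id (3 / 2) u v = (v - u) ^ 2 := by
    have h0 : 0 ≤ v - u := by linarith
    rw [mixGauge, Real.sqrt_eq_rpow, id, id, ← Real.rpow_add_of_nonneg h0 (by norm_num)
      (by norm_num), ← Real.rpow_natCast]
    norm_num
  have hd : ∀ r ∈ Icc u v, HasDerivWithinAt (fun r => tmul (f ξ) (g r) - J r)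
      (tmul (f ξ - f r) (g' r)) (Icc u v) r := fun r _ => by
    rw [sub_tmul]
    exact (((tmulL d i j (f ξ)).hasFDerivAt.comp_hasDerivAt r (hg.hasDerivAt r)).sub
      (hJ r)).hasDerivWithinAt
  have := (convex_Icc u v).norm_image_sub_le_of_norm_hasDerivWithin_le hd
    (C := A * (v - u) * B) (fun r hr => by
      rw [norm_tmul]
      refine mul_le_mul ?_ (hB r ⟨h1.trans hr.1, hr.2.trans h4⟩) (norm_nonneg _)
        (mul_nonneg hA0 (by linarith))
      refine (hA r ⟨h1.trans hr.1, hr.2.trans h4⟩ ξ ⟨h1.trans h2, h3.trans h4⟩).trans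
        (mul_le_mul_of_nonneg_left ?_ hA0)
      rw [abs_le]
      constructor <;> linarith [hr.1, hr.2])
    (left_mem_Icc.2 (h2.trans h3)) (right_mem_Icc.2 (h2.trans h3))
  rw [Real.norm_of_nonneg (by linarith : 0 ≤ v - u)] at this
  rw [hΘ, tmul_sub]
  calc _ = ‖(tmul (f ξ) (g v) - J v) - (tmul (f ξ) (g u) - J u)‖ := by congr 1; abel
    _ ≤ _ := this
    _ = _ := by ring

lemma hasDerivAt_integral {E : Type*} [NormedAddCommGroup E] [NormedSpace ℝ E] [CompleteSpace E]
    {f : ℝ → E} (hf : Continuous f) (s t : ℝ) : HasDerivAt (fun t => ∫ u in s..t, f u) (f t) t :=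
  (hf.integral_hasStrictDerivAt s t).hasDerivAt

lemma youngIntegral_eq_integral {f f' : ℝ → Tens d i} {g g' : ℝ → Tens d j} (hf : IsC1 f f')
    (hg : IsC1 g g') {s t : ℝ} (hst : s ≤ t) :
    youngIntegral f g s t = ∫ u in s..t, tmul (f u) (g' u) := by
  have hc : Continuous fun u => tmul (f u) (g' u) := hf.continuous.tmul' hg.cont
  have := (hasYoungIntegral_of_primitive hf hg (hasDerivAt_integral hc s) hst).eq hst
  rwa [intervalIntegral.integral_same, sub_zero] at this

/-- The second iterated integral `∫_s^t (p_u - p_s) ⊗ q'_u du`. -/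
noncomputable def smooth2 (p : ℝ → Tens d i) (q' : ℝ → Tens d j) (s t : ℝ) : Tens d (i + j) :=
  ∫ u in s..t, tmul (p u - p s) (q' u)

variable {p p' : ℝ → Tens d i} {q q' : ℝ → Tens d j} {r r' : ℝ → Tens d k}

lemma lev2_eq_smooth2 (hp : IsC1 p p') (hq : IsC1 q q') {s t : ℝ} (hst : s ≤ t) :
    lev2 p q s t = smooth2 p q' s t :=
  youngIntegral_eq_integral (hp.sub_const _) hq hst

lemma IsC1.smooth2 (hp : IsC1 p p') (hq : IsC1 q q') (s : ℝ) :
    IsC1 (smooth2 p q' s) fun t => tmul (p t - p s) (q' t) := by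
  have hc : Continuous fun u => tmul (p u - p s) (q' u) :=
    (hp.continuous.sub continuous_const).tmul' hq.cont
  exact ⟨hasDerivAt_integral hc s, hc⟩

/-- Pulling p s out of the integral separates the dependence on s from that on t. Chen's identity
becomes algebra, and differentiation in the lower endpoint becomes possible. -/
lemma smooth2_eq (hp : IsC1 p p') (hq : IsC1 q q') (s t : ℝ) :
    smooth2 p q' s t = (∫ u in (0 : ℝ)..t, tmul (p u) (q' u)) -
      (∫ u in (0 : ℝ)..s, tmul (p u) (q' u)) - tmul (p s) (q t - q s) := by
  have hc : Continuous fun u => tmul (p u) (q' u) := hp.continuous.tmul' hq.cont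
  have h1 : ∀ u ∈ uIcc s t, HasDerivAt (fun v => (∫ u in (0 : ℝ)..v, tmul (p u) (q' u)) -
      tmul (p s) (q v)) (tmul (p u - p s) (q' u)) u := fun u _ => by
    rw [sub_tmul]
    exact (hasDerivAt_integral hc 0 u).sub
      ((tmulL d i j (p s)).hasFDerivAt.comp_hasDerivAt u (hq.hasDerivAt u))
  have hc' : Continuous fun u => tmul (p u - p s) (q' u) :=
    (hp.continuous.sub continuous_const).tmul' hq.cont
  rw [smooth2, intervalIntegral.integral_eq_sub_of_hasDerivAt h1 (hc'.intervalIntegrable s t),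
    tmul_sub]
  abel

lemma IsC1.smooth2_left (hp : IsC1 p p') (hq : IsC1 q q') (t : ℝ) :
    IsC1 (fun s => _root_.smooth2 p q' s t) fun s => -tmul (p' s) (q t - q s) := by
  have hc : Continuous fun u => tmul (p u) (q' u) := hp.continuous.tmul' hq.cont
  refine ⟨fun s => ?_, (hp.cont.tmul' (continuous_const.sub hq.continuous)).neg⟩
  have h := ((hasDerivAt_integral hc 0 s).const_sub (∫ u in (0 : ℝ)..t, tmul (p u) (q' u))).sub
    ((hp.hasDerivAt s).tmul' ((hq.hasDerivAt s).const_sub (q t)))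
  refine (h.congr_deriv ?_).congr_of_eventuallyEq
    (Filter.Eventually.of_forall fun s => smooth2_eq hp hq s t)
  rw [tmul_neg]
  abel

lemma smooth2_isChen (hp : IsC1 p p') (hq : IsC1 q q') : IsChen (smooth2 p q') p q := by
  intro s u t _ _ _ _
  rw [smooth2_eq hp hq, smooth2_eq hp hq, smooth2_eq hp hq, sub_tmul, tmul_sub, tmul_sub, tmul_sub,
    tmul_sub]
  abel

/-- The index types 1 + 2 and 2 + 1 both reduce to 3, so associativity can be stated without a cast.
-/
lemma tmul_tmul (a b c : Tens d 1) :
    tmul (i := 1) (j := 2) a (tmul (i := 1) (j := 1) b c) =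
      tmul (i := 2) (j := 1) (tmul (i := 1) (j := 1) a b) c := by
  ext w
  have h : ∀ v v' : Fin 1 → Fin d, v 0 = v' 0 → v = v' := fun v v' h => by
    funext l; rwa [Subsingleton.elim l 0]
  simp only [tmul]
  rw [← mul_assoc, h (fun k => w (Fin.natAdd 1 (Fin.natAdd 1 k))) (fun k => w (Fin.natAdd 2 k)) rfl]
  rfl

/-- Integration by parts: `-∫_s^t (p_u - p_s) ⊗ d_u(∫_u^t (q_v - q_u) ⊗ dr_v)` is the third
iterated integral. -/
lemma youngIntegral_right_eq {p p' q q' r r' : ℝ → Tens d 1} (hp : IsC1 p p') (hq : IsC1 q q')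
    (hr : IsC1 r r') {s t : ℝ} (hst : s ≤ t) :
    -youngIntegral (i := 1) (j := 2) (fun u => p u - p s)
      (fun u => smooth2 (i := 1) (j := 1) q r' u t) s t =
      ∫ u in s..t, tmul (i := 2) (j := 1) (smooth2 (i := 1) (j := 1) p q' s u) (r' u) := by
  have h2 := hp.smooth2 hq s
  have hc : Continuous fun u => tmul (i := 2) (j := 1) (smooth2 (i := 1) (j := 1) p q' s u) (r' u) :=
    h2.continuous.tmul' hr.cont
  -- The primitive comes from integration by parts. Its boundary term vanishes at u = t because of r
  -- t - r u, and at u = s because the inner integral is empty.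
  have hJ : ∀ u, HasDerivAt (fun u => -(tmul (i := 2) (j := 1) (smooth2 (i := 1) (j := 1) p q' s u)
      (r t - r u) + ∫ v in s..u, tmul (i := 2) (j := 1) (smooth2 (i := 1) (j := 1) p q' s v) (r' v)))
      (tmul (i := 1) (j := 2) (p u - p s) (-tmul (i := 1) (j := 1) (q' u) (r t - r u))) u := by
    intro u
    have := (((h2.hasDerivAt u).tmul' ((hr.hasDerivAt u).const_sub (r t))).add
      (hasDerivAt_integral hc s u)).neg
    refine this.congr_deriv ?_
    rw [tmul_neg, tmul_neg, tmul_tmul]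
    abel
  have := (hasYoungIntegral_of_primitive (i := 1) (j := 2) (hp.sub_const _)
    (hq.smooth2_left hr t) hJ hst).eq hst
  rw [this]
  simp [smooth2]

end

/-! ### Lifts of smooth paths and their translations -/

section SmoothLift

variable {d : ℕ}

/-- The identification of `ℝᵈ` with `(ℝᵈ)^{⊗ 1}`. -/
noncomputable def toTens : EuclideanSpace ℝ (Fin d) ≃ₗᵢ[ℝ] Tens d 1 :=
  LinearIsometryEquiv.piLpCongrLeft 2 ℝ ℝ (Equiv.funUnique (Fin 1) (Fin d)).symm

lemma toTens_isC1 {x : ℝ → EuclideanSpace ℝ (Fin d)} (hx : ContDiff ℝ ∞ x) :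
    IsC1 (fun t => toTens (x t)) fun t => toTens (deriv x t) :=
  ⟨fun t => (toTens (d := d)).toContinuousLinearEquiv.hasFDerivAt.comp_hasDerivAt t
    ((hx.differentiable (by simp)) t).hasDerivAt,
    (toTens (d := d)).continuous.comp (hx.continuous_deriv (by simp))⟩

variable {x g : ℝ → EuclideanSpace ℝ (Fin d)}

/-- Joint continuity is needed since s occurs both as endpoint and in the integrand; the integral is
written as a difference of two integrals starting at the fixed point 0. -/
lemma continuous_smoothLift (hx : ContDiff ℝ ∞ x) (i : ℕ) :
    Continuous fun p : ℝ × ℝ => smoothLift x i p.1 p.2 := by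
  induction i with
  | zero => exact continuous_const
  | succ i ih =>
    refine (PiLp.continuous_toLp 2 _).comp (continuous_pi fun w => ?_)
    have hd : Continuous (deriv fun v => x v (w (Fin.last i))) := by
      have : ContDiff ℝ ∞ fun v => x v (w (Fin.last i)) :=
        (contDiff_euclidean.1 hx) _
      exact this.continuous_deriv (by simp)
    have hF : Continuous fun q : (ℝ × ℝ) × ℝ => smoothLift x i q.1.1 q.2 (fun k => w k.castSucc) *
        deriv (fun v => x v (w (Fin.last i))) q.2 :=
      ((EuclideanSpace.proj (𝕜 := ℝ) fun k : Fin i => w k.castSucc).continuous.comp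
        (ih.comp ((continuous_fst.comp continuous_fst).prodMk continuous_snd))).mul
        (hd.comp continuous_snd)
    have h1 := intervalIntegral.continuous_parametric_intervalIntegral_of_continuous (μ := volume)
      (a₀ := 0) (f := fun (p : ℝ × ℝ) u => smoothLift x i p.1 u (fun k => w k.castSucc) *
        deriv (fun v => x v (w (Fin.last i))) u) hF continuous_snd
    have h2 := intervalIntegral.continuous_parametric_intervalIntegral_of_continuous (μ := volume)
      (a₀ := 0) (f := fun (p : ℝ × ℝ) u => smoothLift x i p.1 u (fun k => w k.castSucc) *
        deriv (fun v => x v (w (Fin.last i))) u) hF continuous_fst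
    refine (h1.sub h2).congr fun p => ?_
    have hint : ∀ a b, IntervalIntegrable (fun u => smoothLift x i p.1 u (fun k => w k.castSucc) *
        deriv (fun v => x v (w (Fin.last i))) u) volume a b := fun a b =>
      (hF.comp (continuous_const.prodMk continuous_id : Continuous fun u => (p, u))).intervalIntegrable a b
    exact intervalIntegral.integral_interval_sub_left (hint _ _) (hint _ _)

lemma smoothLift_succ (hx : ContDiff ℝ ∞ x) (i : ℕ) (s t : ℝ) :
    smoothLift x (i + 1) s t =
      ∫ u in s..t, tmul (smoothLift x i s u) (toTens (deriv x u)) := by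
  have hc : Continuous fun u => tmul (smoothLift x i s u) (toTens (deriv x u)) :=
    ((continuous_smoothLift hx i).comp (continuous_const.prodMk continuous_id)).tmul'
      (toTens_isC1 hx).cont
  ext w
  have := (EuclideanSpace.proj (𝕜 := ℝ) w).intervalIntegral_comp_comm
    (hc.intervalIntegrable (μ := volume) s t)
  refine Eq.trans ?_ this
  change (∫ u in s..t, _) = _
  refine intervalIntegral.integral_congr fun u _ => ?_
  have hd : deriv (fun v => x v (w (Fin.last i))) u = deriv x u (w (Fin.last i)) :=
    ((EuclideanSpace.proj (𝕜 := ℝ) (w (Fin.last i))).hasFDerivAt.comp_hasDerivAt u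
      ((hx.differentiable (by simp)) u).hasDerivAt).deriv
  beta_reduce
  rw [hd]
  rfl

lemma smoothLift_one (hx : ContDiff ℝ ∞ x) (s t : ℝ) :
    smoothLift x 1 s t = toTens (x t) - toTens (x s) := by
  ext w
  have hd : ∀ u, HasDerivAt (fun v => x v (w 0)) (deriv (fun v => x v (w 0)) u) u := fun u =>
    (((contDiff_euclidean.1 hx (w 0)).differentiable (by simp)) u).hasDerivAt
  have hc : Continuous (deriv fun v => x v (w 0)) :=
    (contDiff_euclidean.1 hx (w 0)).continuous_deriv (by simp)
  change (∫ u in s..t, (1 : ℝ) * deriv (fun v => x v (w 0)) u) = x t (w 0) - x s (w 0)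
  simp only [one_mul]
  exact intervalIntegral.integral_eq_sub_of_hasDerivAt (fun u _ => hd u)
    (hc.intervalIntegrable s t)

lemma smoothLift_two (hx : ContDiff ℝ ∞ x) (s t : ℝ) :
    smoothLift x 2 s t =
      smooth2 (i := 1) (j := 1) (fun u => toTens (x u)) (fun u => toTens (deriv x u)) s t := by
  rw [smoothLift_succ hx 1]
  simp only [smoothLift_one hx]
  rfl

/-- The constant depends on the path and never enters a final estimate. It gives finiteness of Besov
norms and the a priori Hölder bound that `exists_holder_of_besovNorm_le` asks for. -/
lemma exists_norm_smoothLift_le (hx : ContDiff ℝ ∞ x) (i : ℕ) :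
    ∃ C, 0 ≤ C ∧ ∀ s t, 0 ≤ s → s ≤ t → t ≤ 1 → ‖smoothLift x i s t‖ ≤ C * (t - s) ^ i := by
  induction i with
  | zero =>
    exact ⟨‖smoothLift x 0 0 0‖, norm_nonneg _, fun s t _ _ _ => by simp [smoothLift]⟩
  | succ i ih =>
    obtain ⟨C, hC, h⟩ := ih
    obtain ⟨B, hB, hB', -⟩ := (toTens_isC1 hx).exists_bound 0 1
    refine ⟨C * B, mul_nonneg hC hB, fun s t hs hst ht => ?_⟩
    rw [smoothLift_succ hx]
    have := intervalIntegral.norm_integral_le_of_norm_le_const (a := s) (b := t)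
      (f := fun u => tmul (smoothLift x i s u) (toTens (deriv x u))) (C := C * (t - s) ^ i * B)
      fun u hu => by
        rw [uIoc_of_le hst] at hu
        rw [norm_tmul]
        have h0 : 0 ≤ u - s := by linarith [hu.1]
        refine mul_le_mul ((h s u hs hu.1.le (hu.2.trans ht)).trans ?_)
          (hB' u ⟨hs.trans hu.1.le, hu.2.trans ht⟩) (norm_nonneg _)
          (mul_nonneg hC (pow_nonneg (by linarith) _))
        gcongr
        exact hu.2
    rw [abs_of_nonneg (sub_nonneg.2 hst)] at this
    exact this.trans_eq (by ring)

open PathTranslation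

/-- The translation of the lift of `x` by `g` is the lift of `x + g`. -/
theorem translation_smoothLift (hx : ContDiff ℝ ∞ x) (hg : ContDiff ℝ ∞ g) {i : ℕ}
    (hi : i ∈ Finset.Icc 1 3) {s t : ℝ} (hst : s ≤ t) :
    translation (smoothLift x) (fun u => toTens (g u)) i s t =
      smoothLift (fun u => x u + g u) i s t := by
  have hy : ContDiff ℝ ∞ fun u => x u + g u := hx.add hg
  have dx := toTens_isC1 hx
  have dg := toTens_isC1 hg
  have hX1 : smoothLift x 1 0 = fun u => toTens (x u) - toTens (x 0) :=
    funext fun u => smoothLift_one hx 0 u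
  have dX1 : IsC1 (smoothLift x 1 0) fun u => toTens (deriv x u) := by
    rw [hX1]; exact dx.sub_const _
  have dy : ∀ u, toTens (deriv (fun u => x u + g u) u) = toTens (deriv x u) + toTens (deriv g u) :=
    fun u => by
      rw [← map_add]
      congr 1
      exact deriv_add ((hx.differentiable (by simp)) u) ((hg.differentiable (by simp)) u)
  set X := fun u => toTens (x u) with hX
  set X' := fun u => toTens (deriv x u) with hX'
  set γ := fun u => toTens (g u) with hγ
  set γ' := fun u => toTens (deriv g u) with hγ'
  have c2 : ∀ {p p' q q' : ℝ → Tens d 1}, IsC1 p p' → IsC1 q q' → ∀ s : ℝ,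
      Continuous fun u => tmul (i := 1) (j := 1) (p u - p s) (q' u) := fun hp hq s =>
    (hp.continuous.sub continuous_const).tmul' hq.cont
  have A2 : ∀ s t, s ≤ t → lev2 γ (smoothLift x 1 0) s t = smooth2 γ X' s t := fun s t hst =>
    lev2_eq_smooth2 dg dX1 hst
  have G2 : ∀ s t, s ≤ t → lev2 γ γ s t = smooth2 γ γ' s t := fun s t hst =>
    lev2_eq_smooth2 dg dg hst
  have hA1 : ∀ s t, s ≤ t → A1 (smoothLift x) γ s t = smooth2 (i := 1) (j := 1) X γ' s t :=
    fun s t hst => by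
      rw [← lev2_eq_smooth2 dx dg hst]
      exact youngIntegral_congr hst (fun u _ => smoothLift_one hx s u) fun _ _ => rfl
  have two : ∀ s t, smoothLift (fun u => x u + g u) 2 s t = smooth2 (i := 1) (j := 1) X X' s t +
      smooth2 (i := 1) (j := 1) X γ' s t + smooth2 (i := 1) (j := 1) γ X' s t +
      smooth2 (i := 1) (j := 1) γ γ' s t := by
    intro s t
    rw [smoothLift_two hy]
    have I1 := (c2 dx dx s).intervalIntegrable (μ := volume) s t
    have I2 := (c2 dx dg s).intervalIntegrable (μ := volume) s t
    have I3 := (c2 dg dx s).intervalIntegrable (μ := volume) s t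
    have I4 := (c2 dg dg s).intervalIntegrable (μ := volume) s t
    simp only [smooth2]
    rw [← intervalIntegral.integral_add I1 I2, ← intervalIntegral.integral_add (I1.add I2) I3,
      ← intervalIntegral.integral_add ((I1.add I2).add I3) I4]
    refine intervalIntegral.integral_congr fun u _ => ?_
    beta_reduce
    rw [dy, map_add, map_add, add_sub_add_comm, tmul_add, add_tmul, add_tmul]
    abel
  rw [Finset.mem_Icc] at hi
  obtain ⟨h1, h3⟩ := hi
  interval_cases i
  · change smoothLift x 1 s t + incr γ s t = _
    rw [smoothLift_one hx, smoothLift_one hy, map_add, map_add, incr]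
    abel
  · change smoothLift x 2 s t + (A1 (smoothLift x) γ s t + lev2 γ (smoothLift x 1 0) s t +
      lev2 γ γ s t) = _
    rw [two, smoothLift_two hx, hA1 s t hst, A2 s t hst, G2 s t hst]
    abel
  · change smoothLift x 3 s t + cross3 (smoothLift x) γ s t = _
    have c3 : ∀ {p p' q q' r r' : ℝ → Tens d 1}, IsC1 p p' → IsC1 q q' → IsC1 r r' →
        IntervalIntegrable (fun u => tmul (i := 2) (j := 1) (smooth2 (i := 1) (j := 1) p q' s u)
          (r' u)) volume s t := fun hp hq hr =>
      Continuous.intervalIntegrable ((hp.smooth2 hq s).continuous.tmul' hr.cont) s t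
    have left : ∀ {p p' q q' r r' : ℝ → Tens d 1} {L : ℝ → ℝ → Tens d 2}, IsC1 p p' → IsC1 q q' →
        IsC1 r r' → (∀ u, s ≤ u → L s u = smooth2 (i := 1) (j := 1) p q' s u) →
        youngIntegral (L s) r s t = ∫ u in s..t, tmul (i := 2) (j := 1)
          (smooth2 (i := 1) (j := 1) p q' s u) (r' u) := fun {p p' q q' r r' L} hp hq hr hL => by
      rw [← youngIntegral_eq_integral (i := 2) (j := 1) (hp.smooth2 hq s) hr hst]
      exact youngIntegral_congr hst (fun u hu => hL u hu.1) fun _ _ => rfl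
    -- The cross terms B¹, B², B³, C¹, C², C³ and γ³ are the words xxγ, xγx, γxx, xγγ, γxγ, γγx and
    -- γγγ. Together with xxx they are the eight words in the third iterated integral of x + g. B³
    -- and C¹, written with a second-level integrator, need the integration by parts.
    have eB1 : B1 (smoothLift x) γ s t = _ := left (L := smoothLift x 2) dx dx dg
      fun u _ => smoothLift_two hx s u
    have eB2 : B2 (smoothLift x) γ s t = _ := left (L := A1 (smoothLift x) γ) dx dg dX1
      fun u hu => hA1 s u hu
    have eC2 : C2 (smoothLift x) γ s t = _ := left (L := lev2 γ (smoothLift x 1 0)) dg dx dg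
      fun u hu => A2 s u hu
    have eC3 : C3 (smoothLift x) γ s t = _ := left (L := lev2 γ γ) dg dg dX1
      fun u hu => G2 s u hu
    have eg3 : g3 γ s t = _ := left (L := lev2 γ γ) dg dg dg fun u hu => G2 s u hu
    have eB3 : B3 (smoothLift x) γ s t = _ :=
      (congrArg Neg.neg (youngIntegral_congr (i := 1) (j := 2) hst (fun _ _ => rfl)
        fun u _ => smoothLift_two hx u t)).trans (youngIntegral_right_eq dg dx dx hst)
    have eC1 : C1 (smoothLift x) γ s t = _ :=
      (congrArg Neg.neg (youngIntegral_congr (i := 1) (j := 2) hst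
        (fun u _ => smoothLift_one hx s u) fun u hu => G2 u t hu.2)).trans
        (youngIntegral_right_eq dx dg dg hst)
    rw [cross3, eB1, eB2, eB3, eC1, eC2, eC3, eg3, smoothLift_succ hx 2, smoothLift_succ hy 2]
    simp only [smoothLift_two hx, two]
    rw [← intervalIntegral.integral_add (c3 dx dx dg) (c3 dx dg dx),
      ← intervalIntegral.integral_add ((c3 dx dx dg).add (c3 dx dg dx)) (c3 dg dx dx),
      ← intervalIntegral.integral_add (((c3 dx dx dg).add (c3 dx dg dx)).add (c3 dg dx dx))
        (c3 dx dg dg),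
      ← intervalIntegral.integral_add ((((c3 dx dx dg).add (c3 dx dg dx)).add (c3 dg dx dx)).add
        (c3 dx dg dg)) (c3 dg dx dg),
      ← intervalIntegral.integral_add (((((c3 dx dx dg).add (c3 dx dg dx)).add (c3 dg dx dx)).add
        (c3 dx dg dg)).add (c3 dg dx dg)) (c3 dg dg dx),
      ← intervalIntegral.integral_add ((((((c3 dx dx dg).add (c3 dx dg dx)).add (c3 dg dx dx)).add
        (c3 dx dg dg)).add (c3 dg dx dg)).add (c3 dg dg dx)) (c3 dg dg dg),
      ← intervalIntegral.integral_add (c3 dx dx dx) (((((((c3 dx dx dg).add (c3 dx dg dx)).add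
        (c3 dg dx dx)).add (c3 dx dg dg)).add (c3 dg dx dg)).add (c3 dg dg dx)).add
        (c3 dg dg dg))]
    refine intervalIntegral.integral_congr fun u _ => ?_
    beta_reduce
    rw [dy, tmul_add, add_tmul, add_tmul, add_tmul, add_tmul, add_tmul, add_tmul]
    abel

end SmoothLift

/-! ### Besov norms -/

/-- The open simplex over which Besov norms are computed. -/
def besovSet : Set (ℝ × ℝ) := {p | 0 ≤ p.1 ∧ p.1 < p.2 ∧ p.2 ≤ 1}

/-- The closed simplex. -/
def closedSimplex : Set (ℝ × ℝ) := {p | 0 ≤ p.1 ∧ p.1 ≤ p.2 ∧ p.2 ≤ 1}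

lemma besovSet_subset : besovSet ⊆ closedSimplex := fun _ h => ⟨h.1, h.2.1.le, h.2.2⟩

lemma measurableSet_besovSet : MeasurableSet besovSet := by
  have h1 : MeasurableSet {p : ℝ × ℝ | 0 ≤ p.1} := measurableSet_le measurable_const measurable_fst
  have h2 : MeasurableSet {p : ℝ × ℝ | p.1 < p.2} := measurableSet_lt measurable_fst measurable_snd
  have h3 : MeasurableSet {p : ℝ × ℝ | p.2 ≤ 1} := measurableSet_le measurable_snd measurable_const
  exact h1.inter (h2.inter h3)

lemma volume_besovSet_le : volume besovSet ≤ 1 := by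
  have h : besovSet ⊆ Icc (0 : ℝ) 1 ×ˢ Icc (0 : ℝ) 1 := fun p hp =>
    ⟨⟨hp.1, hp.2.1.le.trans hp.2.2⟩, ⟨hp.1.trans hp.2.1.le, hp.2.2⟩⟩
  refine (measure_mono h).trans ?_
  rw [Measure.volume_eq_prod, Measure.prod_prod]
  simp

/-- Every point is moved a little along the segment towards the interior point (1/3, 2/3). -/
lemma closedSimplex_subset_closure :
    closedSimplex ⊆ closure {p : ℝ × ℝ | 0 < p.1 ∧ p.1 < p.2 ∧ p.2 < 1} := by
  intro p hp
  have ht : Tendsto (fun ε : ℝ => ((1 - ε) * p.1 + ε * (1 / 3), (1 - ε) * p.2 + ε * (2 / 3)))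
      (𝓝[>] 0) (𝓝 p) := by
    have : Continuous fun ε : ℝ => ((1 - ε) * p.1 + ε * (1 / 3), (1 - ε) * p.2 + ε * (2 / 3)) := by
      fun_prop
    have h := (this.tendsto 0).mono_left (nhdsWithin_le_nhds (s := Ioi 0))
    simpa using h
  refine mem_closure_of_tendsto ht ?_
  filter_upwards [Ioo_mem_nhdsGT (zero_lt_one (α := ℝ))] with ε hε
  obtain ⟨h1, h2, h3⟩ := hp
  obtain ⟨e1, e2⟩ := hε
  have e3 : 0 < 1 - ε := by linarith
  refine ⟨?_, ?_, ?_⟩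
  · have := mul_nonneg e3.le h1; linarith
  · have := mul_le_mul_of_nonneg_left h2 e3.le; linarith
  · have := mul_le_mul_of_nonneg_left h3 e3.le; linarith

section BesovNorm

variable {E E₁ E₂ : Type*} [NormedAddCommGroup E] [NormedAddCommGroup E₁] [NormedAddCommGroup E₂]
  {β r : ℝ}

/-- The integrand of the Besov norm. -/
noncomputable def besovFun (β r : ℝ) (z : ℝ → ℝ → E) (p : ℝ × ℝ) : ℝ≥0∞ :=
  ENNReal.ofReal (‖z p.1 p.2‖ ^ r / |p.2 - p.1| ^ (1 + β * r))

lemma besovNorm_eq (z : ℝ → ℝ → E) :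
    besovNorm β r z = (∫⁻ p in besovSet, besovFun β r z p) ^ (1 / r) := rfl

/-- Absorbing the weight into the function exhibits the Besov norm as an L^r norm, so that
Minkowski's inequality applies. -/
lemma besovFun_eq_rpow (hr : 0 < r) (z : ℝ → ℝ → E) (p : ℝ × ℝ) : besovFun β r z p =
    (ENNReal.ofReal (‖z p.1 p.2‖ * |p.2 - p.1| ^ (-(1 + β * r) / r))) ^ r := by
  rw [besovFun, ENNReal.ofReal_rpow_of_nonneg (by positivity) hr.le,
    Real.mul_rpow (norm_nonneg _) (by positivity), ← Real.rpow_mul (abs_nonneg _),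
    div_mul_cancel₀ _ hr.ne', Real.rpow_neg (abs_nonneg _), div_eq_mul_inv]

lemma aemeasurable_besov_aux {z : ℝ → ℝ → E}
    (hz : ContinuousOn (fun p : ℝ × ℝ => z p.1 p.2) closedSimplex) (q : ℝ) :
    AEMeasurable (fun p : ℝ × ℝ => ENNReal.ofReal (‖z p.1 p.2‖ * |p.2 - p.1| ^ q))
      (volume.restrict besovSet) := by
  have h1 : AEMeasurable (fun p : ℝ × ℝ => ‖z p.1 p.2‖) (volume.restrict besovSet) :=
    ((hz.mono besovSet_subset).norm).aemeasurable measurableSet_besovSet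
  have h2 : Measurable fun p : ℝ × ℝ => |p.2 - p.1| ^ q := by fun_prop
  exact (h1.mul h2.aemeasurable).ennreal_ofReal

lemma aemeasurable_besovFun {z : ℝ → ℝ → E} (hr : 0 < r)
    (hz : ContinuousOn (fun p : ℝ × ℝ => z p.1 p.2) closedSimplex) :
    AEMeasurable (besovFun β r z) (volume.restrict besovSet) := by
  rw [show besovFun β r z = fun p => _ from funext fun p => besovFun_eq_rpow hr z p]
  exact (aemeasurable_besov_aux hz _).pow_const _

/-- Minkowski's inequality for Besov norms. -/
lemma besovNorm_le_add (hr : 1 ≤ r) {z : ℝ → ℝ → E} {z₁ : ℝ → ℝ → E₁} {z₂ : ℝ → ℝ → E₂}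
    (h₁ : ContinuousOn (fun p : ℝ × ℝ => z₁ p.1 p.2) closedSimplex)
    (h₂ : ContinuousOn (fun p : ℝ × ℝ => z₂ p.1 p.2) closedSimplex)
    (h : ∀ s t, 0 ≤ s → s < t → t ≤ 1 → ‖z s t‖ ≤ ‖z₁ s t‖ + ‖z₂ s t‖) :
    besovNorm β r z ≤ besovNorm β r z₁ + besovNorm β r z₂ := by
  have hr0 : 0 < r := by linarith
  simp only [besovNorm_eq, besovFun_eq_rpow hr0]
  refine le_trans ?_ (ENNReal.lintegral_Lp_add_le (aemeasurable_besov_aux h₁ _)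
    (aemeasurable_besov_aux h₂ _) hr)
  refine ENNReal.rpow_le_rpow (setLIntegral_mono' measurableSet_besovSet fun p hp => ?_)
    (by positivity)
  refine ENNReal.rpow_le_rpow ?_ hr0.le
  rw [Pi.add_apply, ← ENNReal.ofReal_add (by positivity) (by positivity), ← add_mul]
  exact ENNReal.ofReal_le_ofReal
    (mul_le_mul_of_nonneg_right (h p.1 p.2 hp.1 hp.2.1 hp.2.2) (by positivity))

/-- The condition (q - β) r ≥ 1 makes the exponent of t - s in the integrand nonnegative. The
integrand is then at most D^r, on a set of measure at most one. -/
lemma besovNorm_le_of_le (hr : 0 < r) {z : ℝ → ℝ → E} {D q : ℝ} (hD : 0 ≤ D)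
    (hq : 1 ≤ (q - β) * r)
    (h : ∀ s t, 0 ≤ s → s < t → t ≤ 1 → ‖z s t‖ ≤ D * (t - s) ^ q) :
    besovNorm β r z ≤ ENNReal.ofReal D := by
  have key : ∫⁻ p in besovSet, besovFun β r z p ≤ ENNReal.ofReal (D ^ r) := by
    calc _ ≤ ∫⁻ _ in besovSet, ENNReal.ofReal (D ^ r) := by
          refine setLIntegral_mono' measurableSet_besovSet fun p hp => ?_
          refine ENNReal.ofReal_le_ofReal ?_
          have hpos : 0 < p.2 - p.1 := sub_pos.2 hp.2.1
          have h1 : p.2 - p.1 ≤ 1 := by linarith [hp.1, hp.2.2]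
          rw [abs_of_pos hpos, div_le_iff₀ (Real.rpow_pos_of_pos hpos _)]
          calc _ ≤ (D * (p.2 - p.1) ^ q) ^ r :=
                Real.rpow_le_rpow (norm_nonneg _) (h p.1 p.2 hp.1 hp.2.1 hp.2.2) hr.le
            _ = D ^ r * (p.2 - p.1) ^ (q * r) := by
                rw [Real.mul_rpow hD (Real.rpow_nonneg hpos.le _), ← Real.rpow_mul hpos.le]
            _ ≤ _ := mul_le_mul_of_nonneg_left
                (Real.rpow_le_rpow_of_exponent_ge hpos h1 (by linarith)) (Real.rpow_nonneg hD _)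
      _ ≤ _ := by
          rw [setLIntegral_const]
          exact mul_le_of_le_one_right' volume_besovSet_le
  rw [besovNorm_eq]
  calc _ ≤ (ENNReal.ofReal (D ^ r)) ^ (1 / r) := ENNReal.rpow_le_rpow key (by positivity)
    _ = _ := by
        rw [← ENNReal.ofReal_rpow_of_nonneg hD hr.le, ← ENNReal.rpow_mul, mul_one_div_cancel hr.ne',
          ENNReal.rpow_one]

lemma besovNorm_congr {z z' : ℝ → ℝ → E}
    (h : ∀ s t, 0 ≤ s → s < t → t ≤ 1 → ‖z s t‖ = ‖z' s t‖) :
    besovNorm β r z = besovNorm β r z' := by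
  rw [besovNorm_eq, besovNorm_eq]
  congr 1
  refine setLIntegral_congr_fun measurableSet_besovSet fun p hp => ?_
  rw [besovFun, besovFun, h p.1 p.2 hp.1 hp.2.1 hp.2.2]

/-- There is a point in `[s, s + κ(t-s)] × [t - κ(t-s), t]` where a function with small Besov norm
is small. -/
lemma exists_small_of_besovNorm_le (hr : 0 < r) (hβ : 0 ≤ β) {z : ℝ → ℝ → E}
    (hz : ContinuousOn (fun p : ℝ × ℝ => z p.1 p.2) closedSimplex) {M κ : ℝ} (hM : 0 ≤ M)
    (hκ : 0 < κ) (hκ' : κ ≤ 1 / 3) (h : besovNorm β r z ≤ ENNReal.ofReal M) {s t : ℝ}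
    (hs : 0 ≤ s) (hst : s < t) (ht : t ≤ 1) :
    ∃ u v, s ≤ u ∧ u ≤ s + κ * (t - s) ∧ t - κ * (t - s) ≤ v ∧ v ≤ t ∧ u ≤ v ∧
      ‖z u v‖ ≤ κ ^ (-(2 / r)) * M * (t - s) ^ (β - 1 / r) := by
  set l := t - s with hl
  have hl0 : 0 < l := sub_pos.2 hst
  have hκl : 0 < κ * l := mul_pos hκ hl0
  have hκl3 : κ * l ≤ l / 3 := by nlinarith
  set Q : Set (ℝ × ℝ) := Icc s (s + κ * l) ×ˢ Icc (t - κ * l) t with hQ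
  have hQs : Q ⊆ besovSet := fun p hp => ⟨hs.trans hp.1.1, by
    have h1 := hp.1.2
    have h2 := hp.2.1
    linarith, hp.2.2.trans ht⟩
  have hvol : volume Q = ENNReal.ofReal ((κ * l) ^ 2) := by
    rw [hQ, Measure.volume_eq_prod, Measure.prod_prod, Real.volume_Icc, Real.volume_Icc,
      add_sub_cancel_left, sub_sub_cancel, ← ENNReal.ofReal_mul hκl.le, sq]
  have hsq : (0 : ℝ) < (κ * l) ^ 2 := by positivity
  -- Somewhere in the square Q of side κ(t - s) the integrand is at most its average, hence at most
  -- M^r / (κ(t - s))². The condition κ ≤ 1/3 keeps Q inside the simplex.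
  obtain ⟨p, hp, hle⟩ := exists_le_setLAverage (μ := volume) (s := Q) (f := besovFun β r z)
    (by rw [hvol]; exact (ENNReal.ofReal_pos.2 hsq).ne') (by rw [hvol]; exact ENNReal.ofReal_ne_top)
    ((aemeasurable_besovFun hr hz).mono_measure (Measure.restrict_mono hQs le_rfl))
  have hint : ∫⁻ p in Q, besovFun β r z p ≤ ENNReal.ofReal (M ^ r) := by
    refine (lintegral_mono_set hQs).trans ?_
    rw [besovNorm_eq] at h
    have h' := ENNReal.rpow_le_rpow h hr.le
    rwa [← ENNReal.rpow_mul, one_div_mul_cancel hr.ne', ENNReal.rpow_one,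
      ENNReal.ofReal_rpow_of_nonneg hM hr.le] at h'
  rw [setLAverage_eq, hvol] at hle
  have h1 : besovFun β r z p ≤ ENNReal.ofReal (M ^ r / (κ * l) ^ 2) := by
    rw [ENNReal.ofReal_div_of_pos hsq]
    exact hle.trans (ENNReal.div_le_div_right hint _)
  have hMr : 0 ≤ M ^ r / (κ * l) ^ 2 := div_nonneg (Real.rpow_nonneg hM _) hsq.le
  rw [besovFun, ENNReal.ofReal_le_ofReal_iff hMr] at h1
  have hp0 := hQs hp
  have hd : 0 < p.2 - p.1 := sub_pos.2 hp0.2.1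
  refine ⟨p.1, p.2, hp.1.1, hp.1.2, hp.2.1, hp.2.2, hp0.2.1.le, ?_⟩
  rw [abs_of_pos hd, div_le_iff₀ (Real.rpow_pos_of_pos hd _)] at h1
  have hd1 : p.2 - p.1 ≤ l := by linarith [hp.1.1, hp.2.2]
  rw [← Real.rpow_le_rpow_iff (norm_nonneg _) (by positivity) hr]
  refine h1.trans ?_
  calc _ ≤ M ^ r / (κ * l) ^ 2 * l ^ (1 + β * r) :=
        mul_le_mul_of_nonneg_left (Real.rpow_le_rpow hd.le hd1 (by positivity)) hMr
    _ = _ := by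
        rw [Real.mul_rpow (by positivity) (by positivity), Real.mul_rpow (by positivity) hM,
          ← Real.rpow_mul hκ.le, ← Real.rpow_mul hl0.le, neg_mul, div_mul_cancel₀ _ hr.ne',
          sub_mul, one_div_mul_cancel hr.ne', mul_pow, Real.rpow_neg hκ.le, Real.rpow_two,
          show 1 + β * r = (β * r - 1) + 2 by ring, Real.rpow_add hl0, Real.rpow_two]
        field_simp

/-- A Garsia-Rodemich-Rumsey inequality: a function with finite Besov norm whose defect of
additivity is Hölder is Hölder. -/
theorem exists_holder_of_besovNorm_le {b : ℝ} (hr : 0 < r) (hb : 0 < b) (hβ : β = b + 1 / r) :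
    ∃ C, 0 ≤ C ∧ ∀ (E : Type) [NormedAddCommGroup E] (z : ℝ → ℝ → E) (M Λ : ℝ), 0 ≤ M → 0 ≤ Λ →
      ContinuousOn (fun p : ℝ × ℝ => z p.1 p.2) closedSimplex →
      besovNorm β r z ≤ ENNReal.ofReal M →
      (∀ s u t, 0 ≤ s → s ≤ u → u ≤ t → t ≤ 1 →
        ‖z s t - z s u - z u t‖ ≤ M * (t - s) ^ b) →
      (∀ s t, 0 ≤ s → s ≤ t → t ≤ 1 → ‖z s t‖ ≤ Λ * (t - s) ^ b) →
      ∀ s t, 0 ≤ s → s ≤ t → t ≤ 1 → ‖z s t‖ ≤ C * M * (t - s) ^ b := by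
  -- With κ^b ≤ 1/4 the two end pieces, of length at most κ(t - s), cost at most half of the current
  -- Hölder constant together.
  set κ : ℝ := min (1 / 3) ((1 / 4) ^ (1 / b)) with hκ
  have hκ0 : 0 < κ := lt_min (by norm_num) (Real.rpow_pos_of_pos (by norm_num) _)
  have hκ3 : κ ≤ 1 / 3 := min_le_left _ _
  have hκb : κ ^ b ≤ 1 / 4 := by
    refine (Real.rpow_le_rpow hκ0.le (min_le_right _ _) hb.le).trans ?_
    rw [← Real.rpow_mul (by norm_num), one_div_mul_cancel hb.ne', Real.rpow_one]
  set C₀ : ℝ := κ ^ (-(2 / r)) + 2 with hC₀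
  have hC₀0 : 0 ≤ C₀ := by positivity
  have hβ0 : 0 ≤ β := by rw [hβ]; positivity
  refine ⟨2 * C₀, by positivity, fun E _ z M Λ hM hΛ hz hn hdef hΛz => ?_⟩
  -- Self-improvement: a Hölder constant Λ can be replaced by Λ/2 + C₀ M. The middle piece is
  -- bounded by averaging, and the two additivity defects account for the summand 2 in C₀. Iteration
  -- converges to 2 C₀ M, so the a priori Λ, only required to be finite, disappears.
  have step : ∀ Λ : ℝ, 0 ≤ Λ →
      (∀ s t, 0 ≤ s → s ≤ t → t ≤ 1 → ‖z s t‖ ≤ Λ * (t - s) ^ b) →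
      ∀ s t, 0 ≤ s → s ≤ t → t ≤ 1 → ‖z s t‖ ≤ (Λ / 2 + C₀ * M) * (t - s) ^ b := by
    intro Λ hΛ h s t hs hst ht
    rcases hst.eq_or_lt with rfl | hst'
    · have := h s s hs le_rfl ht
      rw [sub_self, Real.zero_rpow hb.ne', mul_zero] at this ⊢
      exact this
    obtain ⟨u, v, hu1, hu2, hv1, hv2, huv, hsm⟩ :=
      exists_small_of_besovNorm_le hr hβ0 hz hM hκ0 hκ3 hn hs hst' ht
    have hl : 0 < t - s := sub_pos.2 hst'
    rw [show β - 1 / r = b by rw [hβ]; ring] at hsm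
    have d1 := hdef s u t hs hu1 (huv.trans hv2) ht
    have d2 := hdef u v t (hs.trans hu1) huv hv2 ht
    have hmono : ∀ x, 0 ≤ x → x ≤ κ * (t - s) → x ^ b ≤ 1 / 4 * (t - s) ^ b := fun x h0 h1 => by
      refine (Real.rpow_le_rpow h0 h1 hb.le).trans ?_
      rw [Real.mul_rpow hκ0.le hl.le]
      exact mul_le_mul_of_nonneg_right hκb (by positivity)
    have h1 := (h s u hs hu1 (huv.trans (hv2.trans ht))).trans
      (mul_le_mul_of_nonneg_left (hmono (u - s) (by linarith) (by linarith)) hΛ)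
    have h2 := (h v t (hs.trans (hu1.trans huv)) hv2 ht).trans
      (mul_le_mul_of_nonneg_left (hmono (t - v) (by linarith) (by linarith)) hΛ)
    have d2' : ‖z u t - z u v - z v t‖ ≤ M * (t - s) ^ b :=
      d2.trans (mul_le_mul_of_nonneg_left
        (Real.rpow_le_rpow (by linarith) (by linarith) hb.le) hM)
    have e : z s t = z s u + z u v + z v t + (z s t - z s u - z u t) +
      (z u t - z u v - z v t) := by abel
    rw [e]
    calc _ ≤ ‖z s u‖ + ‖z u v‖ + ‖z v t‖ + ‖z s t - z s u - z u t‖ + ‖z u t - z u v - z v t‖ :=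
          (norm_add_le _ _).trans (add_le_add_left ((norm_add_le _ _).trans
            (add_le_add_left norm_add₃_le _)) _)
      _ ≤ Λ * (1 / 4 * (t - s) ^ b) + κ ^ (-(2 / r)) * M * (t - s) ^ b +
          Λ * (1 / 4 * (t - s) ^ b) + M * (t - s) ^ b + M * (t - s) ^ b := by gcongr
      _ = _ := by rw [hC₀]; ring
  have iter : ∀ n : ℕ, ∀ s t, 0 ≤ s → s ≤ t → t ≤ 1 →
      ‖z s t‖ ≤ (Λ * (1 / 2) ^ n + 2 * C₀ * M) * (t - s) ^ b := by
    intro n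
    induction n with
    | zero =>
      intro s t hs hst ht
      refine (hΛz s t hs hst ht).trans (mul_le_mul_of_nonneg_right ?_
        (Real.rpow_nonneg (sub_nonneg.2 hst) _))
      rw [pow_zero, mul_one]
      have : 0 ≤ 2 * C₀ * M := by positivity
      linarith
    | succ n ih =>
      intro s t hs hst ht
      have h0 : 0 ≤ Λ * (1 / 2) ^ n + 2 * C₀ * M := by positivity
      exact (step _ h0 ih s t hs hst ht).trans_eq (by rw [pow_succ]; ring)
  intro s t hs hst ht
  have hlim : Tendsto (fun n : ℕ => (Λ * (1 / 2) ^ n + 2 * C₀ * M) * (t - s) ^ b) atTop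
      (𝓝 ((Λ * 0 + 2 * C₀ * M) * (t - s) ^ b)) :=
    (((tendsto_pow_atTop_nhds_zero_of_lt_one (by norm_num) (by norm_num)).const_mul Λ).add_const
      _).mul_const _
  rw [mul_zero, zero_add] at hlim
  exact ge_of_tendsto hlim (Filter.Eventually.of_forall fun n => iter n s t hs hst ht)

/-- A uniformly Cauchy sequence which converges in Besov norm converges pointwise to its Besov
limit. -/
lemma tendsto_of_besovNorm_tendsto [CompleteSpace E] (hr : 0 < r) {z : ℕ → ℝ → ℝ → E}
    {x : ℝ → ℝ → E} (hz : ∀ n, ContinuousOn (fun p : ℝ × ℝ => z n p.1 p.2) closedSimplex)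
    (hx : ContinuousOn (fun p : ℝ × ℝ => x p.1 p.2) closedSimplex)
    (hlim : Tendsto (fun n => besovNorm β r fun s t => z n s t - x s t) atTop (𝓝 0))
    (hc : UniformCauchySeqOn (fun n (p : ℝ × ℝ) => z n p.1 p.2) atTop closedSimplex)
    {s t : ℝ} (hs : 0 ≤ s) (hst : s ≤ t) (ht : t ≤ 1) :
    Tendsto (fun n => z n s t) atTop (𝓝 (x s t)) := by
  have hex : ∀ p : ℝ × ℝ, ∃ L, p ∈ closedSimplex → Tendsto (fun n => z n p.1 p.2) atTop (𝓝 L) := by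
    intro p
    by_cases hp : p ∈ closedSimplex
    · obtain ⟨L, hL⟩ := cauchySeq_tendsto_of_complete (hc.cauchySeq hp)
      exact ⟨L, fun _ => hL⟩
    · exact ⟨0, fun h => absurd h hp⟩
  choose Z hZ using hex
  have hZc : ContinuousOn Z closedSimplex :=
    (hc.tendstoUniformlyOn_of_tendsto hZ).continuousOn (Filter.Frequently.of_forall hz)
  have hmeas : ∀ n, AEMeasurable (besovFun β r fun s t => z n s t - x s t)
      (volume.restrict besovSet) := fun n => aemeasurable_besovFun hr ((hz n).sub hx)
  have hint : Tendsto (fun n => ∫⁻ p in besovSet, besovFun β r (fun s t => z n s t - x s t) p)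
      atTop (𝓝 0) := by
    have := hlim.ennrpow_const r
    simp only [besovNorm_eq, ← ENNReal.rpow_mul, one_div_mul_cancel hr.ne', ENNReal.rpow_one,
      ENNReal.zero_rpow_of_pos hr] at this
    exact this
  -- Fatou's lemma shows that the pointwise limit Z is at Besov distance 0 from x, so the two agree
  -- almost everywhere.
  have hfatou := lintegral_liminf_le' (u := atTop) hmeas
  rw [hint.liminf_eq, nonpos_iff_eq_zero] at hfatou
  have hpt : ∀ p ∈ besovSet, liminf (fun n => besovFun β r (fun s t => z n s t - x s t) p) atTop =
      ENNReal.ofReal (‖Z p - x p.1 p.2‖ ^ r / |p.2 - p.1| ^ (1 + β * r)) := fun p hp => by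
    refine Tendsto.liminf_eq ?_
    refine ENNReal.tendsto_ofReal (Tendsto.div_const ?_ _)
    exact (((hZ p (besovSet_subset hp)).sub_const _).norm).rpow_const (Or.inr hr.le)
  rw [setLIntegral_congr_fun measurableSet_besovSet hpt] at hfatou
  have hmeas' : AEMeasurable (fun p : ℝ × ℝ =>
      ENNReal.ofReal (‖Z p - x p.1 p.2‖ ^ r / |p.2 - p.1| ^ (1 + β * r)))
      (volume.restrict besovSet) :=
    aemeasurable_besovFun hr (z := fun s t => Z (s, t) - x s t) (hZc.sub hx)
  rw [lintegral_eq_zero_iff' hmeas'] at hfatou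
  have hae : Z =ᵐ[volume.restrict besovSet] fun p => x p.1 p.2 := by
    filter_upwards [hfatou, ae_restrict_mem measurableSet_besovSet] with p hp hp'
    have hd : 0 < p.2 - p.1 := sub_pos.2 hp'.2.1
    simp only [Pi.zero_apply, ENNReal.ofReal_eq_zero] at hp
    rw [abs_of_pos hd] at hp
    have h0 : ‖Z p - x p.1 p.2‖ ^ r ≤ 0 := by
      have := (div_le_iff₀ (Real.rpow_pos_of_pos hd (1 + β * r))).1 hp
      rwa [zero_mul] at this
    have h1 := (Real.rpow_eq_zero (norm_nonneg _) hr.ne').1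
      (le_antisymm h0 (Real.rpow_nonneg (norm_nonneg _) _))
    exact sub_eq_zero.1 (norm_eq_zero.1 h1)
  -- Almost everywhere equality of continuous functions becomes equality on an open set, then on its
  -- closure, which contains the diagonal and the boundary of the simplex.
  set U : Set (ℝ × ℝ) := {p | 0 < p.1 ∧ p.1 < p.2 ∧ p.2 < 1} with hU
  have hUo : IsOpen U := by
    have h1 : IsOpen {p : ℝ × ℝ | 0 < p.1} := isOpen_lt continuous_const continuous_fst
    have h2 : IsOpen {p : ℝ × ℝ | p.1 < p.2} := isOpen_lt continuous_fst continuous_snd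
    have h3 : IsOpen {p : ℝ × ℝ | p.2 < 1} := isOpen_lt continuous_snd continuous_const
    exact h1.inter (h2.inter h3)
  have hUs : U ⊆ besovSet := fun p hp => ⟨hp.1.le, hp.2.1, hp.2.2.le⟩
  have hUT := hUs.trans besovSet_subset
  have heqU : EqOn Z (fun p => x p.1 p.2) U :=
    Measure.eqOn_open_of_ae_eq (ae_restrict_of_ae_restrict_of_subset hUs hae) hUo (hZc.mono hUT)
      (hx.mono hUT)
  have heq := heqU.of_subset_closure hZc hx hUT closedSimplex_subset_closure
  have hp : ((s, t) : ℝ × ℝ) ∈ closedSimplex := ⟨hs, hst, ht⟩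
  have := hZ (s, t) hp
  rwa [heq hp] at this

end BesovNorm

/-! ### Geometric rough paths -/

/-- The range of parameters in which we work: `a = α - 1/r` is the Hölder exponent of rough paths
with finite `(α, r)`-Besov norm. -/
structure BesovParams (α r a : ℝ) : Prop where
  r_ge : 12 ≤ r
  a_eq : a = α - 1 / r
  a_pos : 0 < a
  α_le : α ≤ 1 / 2
  two_le : 2 ≤ ⌊1 / α⌋₊
  le_three : ⌊1 / α⌋₊ ≤ 3

section

variable {d : ℕ} {α r a : ℝ}

/-- The levels up to `⌊1/α⌋` are continuous. -/
def LevelsCont (α : ℝ) (X : RoughFunctional d) : Prop :=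
  ∀ i ∈ Finset.Icc 1 ⌊1 / α⌋₊, ContinuousOn (fun p : ℝ × ℝ => X i p.1 p.2) closedSimplex

lemma besovNorm_le_besovDist {X Y : RoughFunctional d} {i : ℕ}
    (hi : i ∈ Finset.Icc 1 ⌊1 / α⌋₊) :
    besovNorm (i * α) (r / i) (fun s t => X i s t - Y i s t) ≤ besovDist α r X Y :=
  Finset.single_le_sum (f := fun i : ℕ => besovNorm (i * α) (r / i) fun s t => X i s t - Y i s t)
    (fun _ _ => zero_le) hi

lemma besovDist_comm (X Y : RoughFunctional d) : besovDist α r X Y = besovDist α r Y X :=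
  Finset.sum_congr rfl fun _ _ => besovNorm_congr fun _ _ _ _ _ => norm_sub_rev _ _

namespace BesovParams

lemma r_pos (h : BesovParams α r a) : 0 < r := by linarith [h.r_ge]

lemma a_lt (h : BesovParams α r a) : a < α := by
  have := h.r_pos
  have : 0 < 1 / r := by positivity
  linarith [h.a_eq]

lemma one_le_div (h : BesovParams α r a) {i : ℕ} (hi : i ∈ Finset.Icc 1 ⌊1 / α⌋₊) :
    1 ≤ (i : ℝ) ∧ (i : ℝ) ≤ 3 ∧ 4 ≤ r / i := by
  have h1 := Finset.mem_Icc.1 hi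
  have h3 := h1.2.trans h.le_three
  have h1' : (1 : ℝ) ≤ i := by exact_mod_cast h1.1
  have h3' : (i : ℝ) ≤ 3 := by exact_mod_cast h3
  refine ⟨h1', h3', ?_⟩
  rw [le_div_iff₀ (by linarith)]
  linarith [h.r_ge]

lemma one_mem (h : BesovParams α r a) : 1 ∈ Finset.Icc 1 ⌊1 / α⌋₊ :=
  Finset.mem_Icc.2 ⟨le_rfl, by linarith [h.two_le]⟩

lemma two_mem (h : BesovParams α r a) : 2 ∈ Finset.Icc 1 ⌊1 / α⌋₊ :=
  Finset.mem_Icc.2 ⟨by norm_num, h.two_le⟩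

lemma besovDist_triangle (h : BesovParams α r a) {X Y Z : RoughFunctional d}
    (hX : LevelsCont α X) (hY : LevelsCont α Y) (hZ : LevelsCont α Z) :
    besovDist α r X Z ≤ besovDist α r X Y + besovDist α r Y Z := by
  unfold besovDist
  rw [← Finset.sum_add_distrib]
  refine Finset.sum_le_sum fun i hi => ?_
  refine besovNorm_le_add (by linarith [h.one_le_div hi]) ((hX i hi).sub (hY i hi))
    ((hY i hi).sub (hZ i hi)) fun s t _ _ _ => ?_
  rw [← sub_add_sub_cancel (X i s t) (Y i s t)]
  exact norm_add_le _ _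

lemma levelsCont_zero : LevelsCont α (0 : RoughFunctional d) := fun _ _ => continuousOn_const

lemma levelsCont_smoothLift {x : ℝ → EuclideanSpace ℝ (Fin d)} (hx : ContDiff ℝ ∞ x) :
    LevelsCont α (smoothLift x) := fun i _ => (continuous_smoothLift hx i).continuousOn

lemma besovDist_smoothLift_zero_lt_top (h : BesovParams α r a)
    {x : ℝ → EuclideanSpace ℝ (Fin d)} (hx : ContDiff ℝ ∞ x) :
    besovDist α r (smoothLift x) 0 < ⊤ := by
  refine ENNReal.sum_lt_top.2 fun i hi => ?_
  obtain ⟨C, hC, hb⟩ := exists_norm_smoothLift_le hx i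
  obtain ⟨h1, h3, h4⟩ := h.one_le_div hi
  have hq : 1 ≤ ((i : ℝ) - i * α) * (r / i) := by
    have : ((i : ℝ) - i * α) * (r / i) = (1 - α) * r := by field_simp
    rw [this]
    nlinarith [h.α_le, h.r_ge]
  refine (besovNorm_le_of_le (by linarith) hC hq fun s t hs hst ht => ?_).trans_lt
    ENNReal.ofReal_lt_top
  rw [Real.rpow_natCast]
  change ‖smoothLift x i s t - 0‖ ≤ _
  rw [sub_zero]
  exact hb s t hs hst.le ht

end BesovParams

lemma smoothLift_isChen {x : ℝ → EuclideanSpace ℝ (Fin d)} (hx : ContDiff ℝ ∞ x) :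
    IsChen (i := 1) (j := 1) (smoothLift x 2) (smoothLift x 1 0) (smoothLift x 1 0) := by
  intro s u t h1 h2 h3 h4
  have := smooth2_isChen (toTens_isC1 hx) (toTens_isC1 hx) s u t h1 h2 h3 h4
  simp only [smoothLift_two hx, smoothLift_one hx, sub_sub_sub_cancel_right]
  exact this

lemma smoothLift_chen1 {x : ℝ → EuclideanSpace ℝ (Fin d)} (hx : ContDiff ℝ ∞ x) (s t : ℝ) :
    smoothLift x 1 s t = smoothLift x 1 0 t - smoothLift x 1 0 s := by
  simp only [smoothLift_one hx, sub_sub_sub_cancel_right]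

lemma smoothLift_const_zero (i : ℕ) (s t : ℝ) :
    smoothLift (fun _ => (0 : EuclideanSpace ℝ (Fin d))) (i + 1) s t = 0 := by
  ext w
  simp [smoothLift]

/-- The lift of the zero path has level zero equal to 1, but the distance starts at level one.
Bounds on one lift thus become special cases of bounds on differences of lifts. -/
lemma besovDist_smoothLift_const_zero (X : RoughFunctional d) :
    besovDist α r X (smoothLift fun _ => 0) = besovDist α r X 0 := by
  refine Finset.sum_congr rfl fun i hi => ?_
  obtain ⟨j, rfl⟩ : ∃ j, i = j + 1 := ⟨i - 1, by have := (Finset.mem_Icc.1 hi).1; omega⟩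
  refine besovNorm_congr fun s t _ _ _ => ?_
  rw [smoothLift_const_zero]
  rfl

lemma exists_norm_smoothLift_le_rpow {x : ℝ → EuclideanSpace ℝ (Fin d)} (hx : ContDiff ℝ ∞ x)
    (i : ℕ) {b : ℝ} (hb : 0 < b) (hbi : b ≤ i) :
    ∃ C, 0 ≤ C ∧ ∀ s t, 0 ≤ s → s ≤ t → t ≤ 1 → ‖smoothLift x i s t‖ ≤ C * (t - s) ^ b := by
  obtain ⟨C, hC, h⟩ := exists_norm_smoothLift_le hx i
  refine ⟨C, hC, fun s t hs hst ht => (h s t hs hst ht).trans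
    (mul_le_mul_of_nonneg_left ?_ hC)⟩
  rw [← Real.rpow_natCast]
  exact powGauge_le_of_le hb hbi hst (by linarith)

/-! ### Hölder regularity of the first two levels -/

/-- The first two levels of lifts of smooth paths are Hölder, and depend on the Besov distance in a
Lipschitz way. -/
lemma BesovParams.exists_smooth_close (h : BesovParams α r a) (R : ℝ) (hR : 0 ≤ R) :
    ∃ K, 0 ≤ K ∧ ∀ x y : ℝ → EuclideanSpace ℝ (Fin d), ContDiff ℝ ∞ x → ContDiff ℝ ∞ y →
      ∀ D : ℝ, 0 ≤ D → besovDist α r (smoothLift x) 0 ≤ ENNReal.ofReal R →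
      besovDist α r (smoothLift y) 0 ≤ ENNReal.ofReal R →
      besovDist α r (smoothLift x) (smoothLift y) ≤ ENNReal.ofReal D →
      CloseOn (powGauge a) K D (smoothLift x 1) (smoothLift y 1) 0 1 ∧
      CloseOn (powGauge (2 * a)) K D (smoothLift x 2) (smoothLift y 2) 0 1 := by
  have hr := h.r_pos
  have ha := h.a_pos
  have ha1 : a ≤ 1 := by linarith [h.a_lt, h.α_le]
  -- At level i the Besov parameters (iα, r/i) yield the Hölder exponent iα - i/r = i a.
  obtain ⟨C₁, hC₁, H₁⟩ := exists_holder_of_besovNorm_le (r := r) (β := α) (b := a) hr ha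
    (by rw [h.a_eq]; ring)
  obtain ⟨C₂, hC₂, H₂⟩ := exists_holder_of_besovNorm_le (r := r / 2) (β := 2 * α) (b := 2 * a)
    (by positivity) (by positivity) (by rw [h.a_eq]; field_simp; ring)
  have lev1 : ∀ x y : ℝ → EuclideanSpace ℝ (Fin d), ContDiff ℝ ∞ x → ContDiff ℝ ∞ y →
      ∀ D : ℝ, 0 ≤ D → besovDist α r (smoothLift x) (smoothLift y) ≤ ENNReal.ofReal D →
      ∀ s t, 0 ≤ s → s ≤ t → t ≤ 1 →
        ‖smoothLift x 1 s t - smoothLift y 1 s t‖ ≤ C₁ * D * (t - s) ^ a := by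
    intro x y hx hy D hD hdist
    obtain ⟨A, hA, hA'⟩ := exists_norm_smoothLift_le_rpow hx 1 ha (by simpa using ha1)
    obtain ⟨B, hB, hB'⟩ := exists_norm_smoothLift_le_rpow hy 1 ha (by simpa using ha1)
    refine H₁ (Tens d 1) (fun s t => smoothLift x 1 s t - smoothLift y 1 s t) D (A + B) hD
      (add_nonneg hA hB)
      ((continuous_smoothLift hx 1).sub (continuous_smoothLift hy 1)).continuousOn ?_ ?_ ?_
    · have := (besovNorm_le_besovDist h.one_mem).trans hdist
      simpa using this
    · intro s u t hs hsu hut ht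
      have : smoothLift x 1 s t - smoothLift y 1 s t - (smoothLift x 1 s u - smoothLift y 1 s u) -
          (smoothLift x 1 u t - smoothLift y 1 u t) = 0 := by
        simp only [smoothLift_one hx, smoothLift_one hy]; abel
      rw [this, norm_zero]
      exact mul_nonneg hD (Real.rpow_nonneg (by linarith) _)
    · intro s t hs hst ht
      refine (norm_sub_le _ _).trans ?_
      rw [add_mul]
      exact add_le_add (hA' s t hs hst ht) (hB' s t hs hst ht)
  have lev2 : ∀ x y : ℝ → EuclideanSpace ℝ (Fin d), ContDiff ℝ ∞ x → ContDiff ℝ ∞ y →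
      ∀ A : ℝ, 0 ≤ A →
      (∀ s t, 0 ≤ s → s ≤ t → t ≤ 1 → ‖smoothLift x 1 s t‖ ≤ A * (t - s) ^ a) →
      (∀ s t, 0 ≤ s → s ≤ t → t ≤ 1 → ‖smoothLift y 1 s t‖ ≤ A * (t - s) ^ a) →
      ∀ D : ℝ, 0 ≤ D → besovDist α r (smoothLift x) (smoothLift y) ≤ ENNReal.ofReal D →
      ∀ s t, 0 ≤ s → s ≤ t → t ≤ 1 →
        ‖smoothLift x 2 s t - smoothLift y 2 s t‖ ≤
          C₂ * (D + 2 * A * C₁ * D) * (t - s) ^ (2 * a) := by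
    intro x y hx hy A hA hxA hyA D hD hdist
    have h2a : 0 < 2 * a := by positivity
    obtain ⟨A', hA', hxA'⟩ := exists_norm_smoothLift_le_rpow hx 2 h2a (by push_cast; linarith)
    obtain ⟨B', hB', hyB'⟩ := exists_norm_smoothLift_le_rpow hy 2 h2a (by push_cast; linarith)
    have hM : 0 ≤ D + 2 * A * C₁ * D := by positivity
    refine H₂ (Tens d 2) (fun s t => smoothLift x 2 s t - smoothLift y 2 s t) _ (A' + B') hM
      (add_nonneg hA' hB')
      ((continuous_smoothLift hx 2).sub (continuous_smoothLift hy 2)).continuousOn ?_ ?_ ?_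
    · have := (besovNorm_le_besovDist h.two_mem).trans hdist
      push_cast at this
      exact this.trans (ENNReal.ofReal_le_ofReal (by
        have : 0 ≤ 2 * A * C₁ * D := by positivity
        linarith))
    · intro s u t hs hsu hut ht
      have ex := smoothLift_isChen hx s u t hs hsu hut ht
      have ey := smoothLift_isChen hy s u t hs hsu hut ht
      rw [← smoothLift_chen1 hx, ← smoothLift_chen1 hx] at ex
      rw [← smoothLift_chen1 hy, ← smoothLift_chen1 hy] at ey
      -- At level one the difference is additive and has no defect. Here the defect is a difference
      -- of two tensor products; the product rule puts the already established level-one difference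
      -- in each term.
      have e : smoothLift x 2 s t - smoothLift y 2 s t - (smoothLift x 2 s u - smoothLift y 2 s u) -
          (smoothLift x 2 u t - smoothLift y 2 u t) =
          tmul (i := 1) (j := 1) (smoothLift x 1 s u - smoothLift y 1 s u) (smoothLift x 1 u t) +
          tmul (i := 1) (j := 1) (smoothLift y 1 s u)
            (smoothLift x 1 u t - smoothLift y 1 u t) := by
        rw [sub_tmul, tmul_sub, ex, ey]; abel
      rw [e]
      have hp : ∀ v w, s ≤ v → v ≤ w → w ≤ t → (w - v) ^ a ≤ (t - s) ^ a := fun v w e1 e2 e3 =>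
        Real.rpow_le_rpow (by linarith) (by linarith) ha.le
      have hsu' := hp s u le_rfl hsu hut
      have hut' := hp u t hsu hut le_rfl
      have hP : 0 ≤ (t - s) ^ a := Real.rpow_nonneg (by linarith) _
      have hsq : (t - s) ^ (2 * a) = (t - s) ^ a * (t - s) ^ a := by
        rw [two_mul, Real.rpow_add_of_nonneg (by linarith) ha.le ha.le]
      have d1 := (lev1 x y hx hy D hD hdist s u hs hsu (hut.trans ht)).trans
        (mul_le_mul_of_nonneg_left hsu' (mul_nonneg hC₁ hD))
      have d2 := (lev1 x y hx hy D hD hdist u t (hs.trans hsu) hut ht).trans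
        (mul_le_mul_of_nonneg_left hut' (mul_nonneg hC₁ hD))
      have b1 := (hxA u t (hs.trans hsu) hut ht).trans (mul_le_mul_of_nonneg_left hut' hA)
      have b2 := (hyA s u hs hsu (hut.trans ht)).trans (mul_le_mul_of_nonneg_left hsu' hA)
      refine (norm_add_le _ _).trans ?_
      rw [norm_tmul, norm_tmul, hsq]
      have m1 := mul_le_mul d1 b1 (norm_nonneg _) (by positivity)
      have m2 := mul_le_mul b2 d2 (norm_nonneg _) (by positivity)
      have : 0 ≤ D * ((t - s) ^ a * (t - s) ^ a) := by positivity
      linarith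
    · intro s t hs hst ht
      refine (norm_sub_le _ _).trans ?_
      rw [add_mul]
      exact add_le_add (hxA' s t hs hst ht) (hyB' s t hs hst ht)
  have h0 : ContDiff ℝ ∞ fun _ : ℝ => (0 : EuclideanSpace ℝ (Fin d)) := contDiff_const
  have one : ∀ x : ℝ → EuclideanSpace ℝ (Fin d), ContDiff ℝ ∞ x →
      besovDist α r (smoothLift x) 0 ≤ ENNReal.ofReal R →
      ∀ s t, 0 ≤ s → s ≤ t → t ≤ 1 → ‖smoothLift x 1 s t‖ ≤ C₁ * R * (t - s) ^ a := by
    intro x hx hd s t hs hst ht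
    have := lev1 x _ hx h0 R hR (by rwa [besovDist_smoothLift_const_zero]) s t hs hst ht
    rwa [smoothLift_const_zero, sub_zero] at this
  have two : ∀ x : ℝ → EuclideanSpace ℝ (Fin d), ContDiff ℝ ∞ x →
      besovDist α r (smoothLift x) 0 ≤ ENNReal.ofReal R →
      ∀ s t, 0 ≤ s → s ≤ t → t ≤ 1 → ‖smoothLift x 2 s t‖ ≤
        C₂ * (R + 2 * (C₁ * R) * C₁ * R) * (t - s) ^ (2 * a) := by
    intro x hx hd s t hs hst ht
    have := lev2 x _ hx h0 (C₁ * R) (by positivity) (one x hx hd) (fun s t h1 h2 h3 => by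
      rw [smoothLift_const_zero, norm_zero]
      have := sub_nonneg.2 h2
      positivity) R hR (by rwa [besovDist_smoothLift_const_zero]) s t hs hst ht
    rwa [smoothLift_const_zero, sub_zero] at this
  set K₁ := C₁ * R + C₁ with hK₁
  set K₂ := C₂ * (R + 2 * (C₁ * R) * C₁ * R) + C₂ * (1 + 2 * (C₁ * R) * C₁) with hK₂
  have hK₁0 : 0 ≤ K₁ := by positivity
  have hK₂0 : 0 ≤ K₂ := by positivity
  refine ⟨K₁ + K₂, by positivity, fun x y hx hy D hD hxR hyR hdist => ⟨⟨fun s t hs hst ht => ?_,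
    fun s t hs hst ht => ?_, fun s t hs hst ht => ?_⟩, ⟨fun s t hs hst ht => ?_,
    fun s t hs hst ht => ?_, fun s t hs hst ht => ?_⟩⟩⟩
  · exact (one x hx hxR s t hs hst ht).trans (mul_le_mul_of_nonneg_right (by linarith)
      (powGauge_nonneg hst))
  · exact (one y hy hyR s t hs hst ht).trans (mul_le_mul_of_nonneg_right (by linarith)
      (powGauge_nonneg hst))
  · refine (lev1 x y hx hy D hD hdist s t hs hst ht).trans (mul_le_mul_of_nonneg_right ?_
      (powGauge_nonneg hst))
    have : 0 ≤ (C₁ * R + K₂) * D := by positivity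
    linarith
  · have : 0 ≤ C₂ * (1 + 2 * (C₁ * R) * C₁) := by positivity
    exact (two x hx hxR s t hs hst ht).trans (mul_le_mul_of_nonneg_right (by linarith)
      (powGauge_nonneg hst))
  · have : 0 ≤ C₂ * (1 + 2 * (C₁ * R) * C₁) := by positivity
    exact (two y hy hyR s t hs hst ht).trans (mul_le_mul_of_nonneg_right (by linarith)
      (powGauge_nonneg hst))
  · refine (lev2 x y hx hy (C₁ * R) (by positivity) (one x hx hxR) (one y hy hyR) D hD hdist s t hs
      hst ht).trans (mul_le_mul_of_nonneg_right ?_ (powGauge_nonneg hst))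
    have : 0 ≤ (K₁ + C₂ * (R + 2 * (C₁ * R) * C₁ * R)) * D := by positivity
    linarith

lemma besovDist_self (h : BesovParams α r a) (X : RoughFunctional d) : besovDist α r X X = 0 := by
  refine Finset.sum_eq_zero fun i hi => ?_
  have h4 := (h.one_le_div hi).2.2
  have := besovNorm_le_of_le (β := i * α) (r := r / i) (z := fun s t => X i s t - X i s t)
    (D := 0) (q := i * α + 1) (by linarith) le_rfl (by rw [add_sub_cancel_left]; linarith)
    (fun s t _ _ _ => by simp)
  simpa using this

lemma isBesovGeoRP_smoothLift (h : BesovParams α r a) {x : ℝ → EuclideanSpace ℝ (Fin d)}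
    (hx : ContDiff ℝ ∞ x) : IsBesovGeoRP α r (smoothLift x) :=
  ⟨BesovParams.levelsCont_smoothLift hx, fun _ => x, fun _ => hx, by
    simp only [besovDist_self h]; exact tendsto_const_nhds⟩

namespace IsBesovGeoRP

lemma besovDist_zero_lt_top (h : BesovParams α r a) {X : RoughFunctional d}
    (hX : IsBesovGeoRP α r X) : besovDist α r X 0 < ⊤ := by
  obtain ⟨hc, x, hx, hlim⟩ := hX
  obtain ⟨n, hn⟩ := (hlim.eventually_lt_const (u := 1) one_pos).exists
  refine (h.besovDist_triangle (Y := smoothLift (x n)) hc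
    (BesovParams.levelsCont_smoothLift (hx n)) BesovParams.levelsCont_zero).trans_lt ?_
  rw [besovDist_comm X]
  exact ENNReal.add_lt_top.2 ⟨hn.trans ENNReal.one_lt_top,
    h.besovDist_smoothLift_zero_lt_top (hx n)⟩

/-- Besov limits of smooth lifts are pointwise limits at the first two levels. -/
lemma tendsto_levels (h : BesovParams α r a) {X : RoughFunctional d} (hc : LevelsCont α X)
    {x : ℕ → ℝ → EuclideanSpace ℝ (Fin d)} (hx : ∀ n, ContDiff ℝ ∞ (x n))
    (hlim : Tendsto (fun n => besovDist α r (smoothLift (x n)) X) atTop (𝓝 0)) {s t : ℝ}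
    (hs : 0 ≤ s) (hst : s ≤ t) (ht : t ≤ 1) :
    Tendsto (fun n => smoothLift (x n) 1 s t) atTop (𝓝 (X 1 s t)) ∧
    Tendsto (fun n => smoothLift (x n) 2 s t) atTop (𝓝 (X 2 s t)) := by
  have hX0 : besovDist α r X 0 < ⊤ := besovDist_zero_lt_top h ⟨hc, x, hx, hlim⟩
  set R := (besovDist α r X 0).toReal + 1 with hR
  have hR0 : 0 ≤ R := by positivity
  have hRe : ENNReal.ofReal R = besovDist α r X 0 + 1 := by
    rw [hR, ENNReal.ofReal_add (by positivity) zero_le_one, ENNReal.ofReal_toReal hX0.ne,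
      ENNReal.ofReal_one]
  obtain ⟨K, hK, H⟩ := h.exists_smooth_close (d := d) R hR0
  have hsm := fun n => BesovParams.levelsCont_smoothLift (α := α) (hx n)
  -- A Besov-convergent sequence of lifts is Besov-Cauchy and eventually lies in the ball of radius
  -- R, so the Hölder estimate on differences makes it uniformly Cauchy.
  have hcau : ∀ ε > 0, ∃ N, ∀ m ≥ N, ∀ n ≥ N, ∀ p ∈ closedSimplex,
      dist (smoothLift (x m) 1 p.1 p.2) (smoothLift (x n) 1 p.1 p.2) < ε ∧
      dist (smoothLift (x m) 2 p.1 p.2) (smoothLift (x n) 2 p.1 p.2) < ε := by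
    intro ε hε
    set η := min 1 (ε / (4 * (K + 1))) with hη
    have hη0 : 0 < η := lt_min one_pos (by positivity)
    have hηK : K * (2 * η) < ε := by
      have : η * (4 * (K + 1)) ≤ ε := by
        rw [← le_div_iff₀ (by positivity)]; exact min_le_right _ _
      nlinarith
    obtain ⟨N, hN⟩ := eventually_atTop.1
      (hlim.eventually_le_const (u := ENNReal.ofReal η) (ENNReal.ofReal_pos.2 hη0))
    have hbd : ∀ n ≥ N, besovDist α r (smoothLift (x n)) 0 ≤ ENNReal.ofReal R := fun n hn => by
      refine (h.besovDist_triangle (hsm n) hc BesovParams.levelsCont_zero).trans ?_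
      rw [hRe, add_comm]
      gcongr
      refine (hN n hn).trans ?_
      rw [← ENNReal.ofReal_one]
      exact ENNReal.ofReal_le_ofReal (min_le_left _ _)
    refine ⟨N, fun m hm n hn p hp => ?_⟩
    have hmn : besovDist α r (smoothLift (x m)) (smoothLift (x n)) ≤ ENNReal.ofReal (2 * η) := by
      refine (h.besovDist_triangle (hsm m) hc (hsm n)).trans ?_
      rw [two_mul, ENNReal.ofReal_add hη0.le hη0.le, besovDist_comm X]
      exact add_le_add (hN m hm) (hN n hn)
    obtain ⟨c1, c2⟩ := H (x m) (x n) (hx m) (hx n) (2 * η) (by positivity) (hbd m hm) (hbd n hn) hmn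
    have g1 : ∀ b, 0 ≤ b → K * (2 * η) * powGauge b p.1 p.2 ≤ K * (2 * η) := fun b hb =>
      mul_le_of_le_one_right (by positivity)
        (Real.rpow_le_one (sub_nonneg.2 hp.2.1) (by linarith [hp.1, hp.2.2]) hb)
    rw [dist_eq_norm, dist_eq_norm]
    exact ⟨((c1.diff _ _ hp.1 hp.2.1 hp.2.2).trans (g1 a h.a_pos.le)).trans_lt hηK,
      ((c2.diff _ _ hp.1 hp.2.1 hp.2.2).trans (g1 (2 * a) (by linarith [h.a_pos]))).trans_lt hηK⟩
  have lvl : ∀ i ∈ Finset.Icc 1 ⌊1 / α⌋₊,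
      Tendsto (fun n => besovNorm (i * α) (r / i) fun s t => smoothLift (x n) i s t - X i s t)
      atTop (𝓝 0) := fun i hi =>
    tendsto_of_tendsto_of_tendsto_of_le_of_le tendsto_const_nhds hlim (fun _ => zero_le)
      fun n => besovNorm_le_besovDist hi
  constructor
  · refine tendsto_of_besovNorm_tendsto (by linarith [(h.one_le_div h.one_mem).2.2])
      (fun n => hsm n 1 h.one_mem) (hc 1 h.one_mem) (lvl 1 h.one_mem)
      (Metric.uniformCauchySeqOn_iff.2 fun ε hε => ?_) hs hst ht
    obtain ⟨N, hN⟩ := hcau ε hε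
    exact ⟨N, fun m hm n hn p hp => (hN m hm n hn p hp).1⟩
  · refine tendsto_of_besovNorm_tendsto (by linarith [(h.one_le_div h.two_mem).2.2])
      (fun n => hsm n 2 h.two_mem) (hc 2 h.two_mem) (lvl 2 h.two_mem)
      (Metric.uniformCauchySeqOn_iff.2 fun ε hε => ?_) hs hst ht
    obtain ⟨N, hN⟩ := hcau ε hε
    exact ⟨N, fun m hm n hn p hp => (hN m hm n hn p hp).2⟩

lemma chen1 (h : BesovParams α r a) {X : RoughFunctional d} (hX : IsBesovGeoRP α r X) (s t : ℝ)
    (hs : 0 ≤ s) (hst : s ≤ t) (ht : t ≤ 1) : X 1 s t = X 1 0 t - X 1 0 s := by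
  obtain ⟨hc, x, hx, hlim⟩ := hX
  have l1 := (tendsto_levels h hc hx hlim hs hst ht).1
  have l2 := (tendsto_levels h hc hx hlim le_rfl (hs.trans hst) ht).1
  have l3 := (tendsto_levels h hc hx hlim le_rfl hs (hst.trans ht)).1
  refine tendsto_nhds_unique l1 ((l2.sub l3).congr fun n => ?_)
  rw [← smoothLift_chen1 (hx n)]

lemma chen2 (h : BesovParams α r a) {X : RoughFunctional d} (hX : IsBesovGeoRP α r X) :
    IsChen (i := 1) (j := 1) (X 2) (X 1 0) (X 1 0) := by
  intro s u t hs hsu hut ht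
  obtain ⟨hc, x, hx, hlim⟩ := hX
  have hu := hs.trans hsu
  have l : ∀ {v w : ℝ}, 0 ≤ v → v ≤ w → w ≤ 1 → _ := fun {v w} h1 h2 h3 =>
    tendsto_levels h hc hx hlim (s := v) (t := w) h1 h2 h3
  have e1 := (l le_rfl hu (hut.trans ht)).1.sub (l le_rfl hs (hsu.trans (hut.trans ht))).1
  have e2 := (l le_rfl (hu.trans hut) ht).1.sub (l le_rfl hu (hut.trans ht)).1
  have e3 := ((tmulL d 1 1).continuous₂.tendsto (X 1 0 u - X 1 0 s, X 1 0 t - X 1 0 u)).comp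
    (e1.prodMk_nhds e2)
  refine tendsto_nhds_unique (l hs (hsu.trans hut) ht).2
    ((((l hs hsu (hut.trans ht)).2.add (l hu hut ht).2).add e3).congr fun n => ?_)
  exact (smoothLift_isChen (hx n) s u t hs hsu hut ht).symm

/-- The first two levels of geometric rough paths are Hölder, and depend on the Besov distance in a
Lipschitz way. -/
lemma exists_close (h : BesovParams α r a) (d : ℕ) (R : ℝ) (hR : 0 ≤ R) :
    ∃ K, 0 ≤ K ∧ ∀ X Y : RoughFunctional d, IsBesovGeoRP α r X → IsBesovGeoRP α r Y →
      ∀ D : ℝ, 0 ≤ D → besovDist α r X 0 ≤ ENNReal.ofReal R →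
      besovDist α r Y 0 ≤ ENNReal.ofReal R → besovDist α r X Y ≤ ENNReal.ofReal D →
      CloseOn (powGauge a) K D (X 1) (Y 1) 0 1 ∧
      CloseOn (powGauge (2 * a)) K D (X 2) (Y 2) 0 1 := by
  obtain ⟨K, hK, H⟩ := h.exists_smooth_close (d := d) (R + 1) (by linarith)
  refine ⟨K, hK, fun X Y hX hY D hD hXR hYR hXY => ?_⟩
  obtain ⟨hcX, x, hx, hxlim⟩ := hX
  obtain ⟨hcY, y, hy, hylim⟩ := hY
  have hsx := fun n => BesovParams.levelsCont_smoothLift (α := α) (hx n)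
  have hsy := fun n => BesovParams.levelsCont_smoothLift (α := α) (hy n)
  have key : ∀ η, 0 < η → η ≤ 1 → ∀ᶠ n in atTop,
      CloseOn (powGauge a) K (D + 2 * η) (smoothLift (x n) 1) (smoothLift (y n) 1) 0 1 ∧
      CloseOn (powGauge (2 * a)) K (D + 2 * η) (smoothLift (x n) 2) (smoothLift (y n) 2) 0 1 := by
    intro η hη hη1
    have hpos : 0 < ENNReal.ofReal η := ENNReal.ofReal_pos.2 hη
    filter_upwards [hxlim.eventually_le_const hpos, hylim.eventually_le_const hpos] with n h1 h2
    have hR1 : ∀ {Z W : RoughFunctional d}, LevelsCont α Z → LevelsCont α W →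
        besovDist α r Z W ≤ ENNReal.ofReal η → besovDist α r W 0 ≤ ENNReal.ofReal R →
        besovDist α r Z 0 ≤ ENNReal.ofReal (R + 1) := fun hZ hW hZW hW0 => by
      refine (h.besovDist_triangle hZ hW BesovParams.levelsCont_zero).trans ?_
      rw [add_comm R, ENNReal.ofReal_add zero_le_one hR]
      exact add_le_add (hZW.trans (ENNReal.ofReal_le_ofReal hη1)) hW0
    refine H (x n) (y n) (hx n) (hy n) (D + 2 * η) (by positivity)
      (hR1 (hsx n) hcX h1 hXR) (hR1 (hsy n) hcY h2 hYR) ?_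
    refine (h.besovDist_triangle (hsx n) hcX (hsy n)).trans ((add_le_add h1
      ((h.besovDist_triangle hcX hcY (hsy n)).trans (add_le_add hXY
        ((besovDist_comm _ _).trans_le h2)))).trans_eq ?_)
    rw [← ENNReal.ofReal_add hD hη.le, ← ENNReal.ofReal_add hη.le (by positivity)]
    congr 1
    ring
  have lx : ∀ {v w : ℝ}, 0 ≤ v → v ≤ w → w ≤ 1 → _ := fun {v w} h1 h2 h3 =>
    tendsto_levels h hcX hx hxlim (s := v) (t := w) h1 h2 h3
  have ly : ∀ {v w : ℝ}, 0 ≤ v → v ≤ w → w ≤ 1 → _ := fun {v w} h1 h2 h3 =>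
    tendsto_levels h hcY hy hylim (s := v) (t := w) h1 h2 h3
  have k1 := key 1 one_pos le_rfl
  -- Approximating X and Y within η enlarges their distance by at most 2η; letting η tend to 0
  -- recovers the constant D, including D = 0.
  have small : ∀ A G : ℝ, (∀ η, 0 < η → η ≤ 1 → A ≤ K * (D + 2 * η) * G) → A ≤ K * D * G := by
    intro A G hA
    have ht : Tendsto (fun η : ℝ => K * (D + 2 * η) * G) (𝓝[>] 0) (𝓝 (K * (D + 2 * 0) * G)) :=
      Tendsto.mono_left (Continuous.tendsto (by fun_prop) 0) nhdsWithin_le_nhds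
    rw [mul_zero, add_zero] at ht
    refine ge_of_tendsto ht ?_
    filter_upwards [Ioo_mem_nhdsGT (zero_lt_one (α := ℝ))] with η hη using hA η hη.1 hη.2.le
  refine ⟨⟨fun s t hs hst ht => ?_, fun s t hs hst ht => ?_, fun s t hs hst ht => ?_⟩,
    ⟨fun s t hs hst ht => ?_, fun s t hs hst ht => ?_, fun s t hs hst ht => ?_⟩⟩
  · exact le_of_tendsto (lx hs hst ht).1.norm (k1.mono fun n hn => hn.1.left s t hs hst ht)
  · exact le_of_tendsto (ly hs hst ht).1.norm (k1.mono fun n hn => hn.1.right s t hs hst ht)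
  · exact small _ _ fun η h0 h1 => le_of_tendsto ((lx hs hst ht).1.sub (ly hs hst ht).1).norm
      ((key η h0 h1).mono fun n hn => hn.1.diff s t hs hst ht)
  · exact le_of_tendsto (lx hs hst ht).2.norm (k1.mono fun n hn => hn.2.left s t hs hst ht)
  · exact le_of_tendsto (ly hs hst ht).2.norm (k1.mono fun n hn => hn.2.right s t hs hst ht)
  · exact small _ _ fun η h0 h1 => le_of_tendsto ((lx hs hst ht).2.sub (ly hs hst ht).2).norm
      ((key η h0 h1).mono fun n hn => hn.2.diff s t hs hst ht)

end IsBesovGeoRP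

end

/-! ### Paths of finite energy and controls -/

section

variable {E : Type*} [NormedAddCommGroup E]

/-- The sums `∑ ‖f (u (k+1)) - f (u k)‖² / (u (k+1) - u k)^{2p}` along partitions `u` of
subintervals with nodes in `S` are bounded by `M²`. -/
def EnergyOn (S : Set ℝ) (p M : ℝ) (f : ℝ → E) : Prop :=
  ∀ (n : ℕ) (u : ℕ → ℝ), Monotone u → (∀ k, u k ∈ S) →
    ∑ k ∈ Finset.range n, ‖f (u (k + 1)) - f (u k)‖ ^ 2 / (u (k + 1) - u k) ^ (2 * p) ≤ M ^ 2

namespace EnergyOn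

variable {S T : Set ℝ} {p M M' : ℝ} {f g : ℝ → E}

lemma mono_set (h : EnergyOn T p M f) (hST : S ⊆ T) : EnergyOn S p M f :=
  fun n u hu hS => h n u hu fun k => hST (hS k)

lemma mono (h : EnergyOn S p M f) (hM : 0 ≤ M) (hMM' : M ≤ M') : EnergyOn S p M' f :=
  fun n u hu hS => (h n u hu hS).trans (pow_le_pow_left₀ hM hMM' 2)

lemma comp_norm {F : Type*} [NormedAddCommGroup F] {f' : ℝ → F} (h : EnergyOn S p M f)
    (hf : ∀ s t, ‖f' t - f' s‖ = ‖f t - f s‖) : EnergyOn S p M f' := fun n u hu hS => by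
  simpa only [hf] using h n u hu hS

lemma sub_two (hf : EnergyOn S p M f) (hg : EnergyOn S p M g) :
    EnergyOn S p (2 * M) fun t => f t - g t := by
  intro n u hu hS
  have h1 := hf n u hu hS
  have h2 := hg n u hu hS
  have h3 : ∑ k ∈ Finset.range n,
      ‖f (u (k + 1)) - g (u (k + 1)) - (f (u k) - g (u k))‖ ^ 2 / (u (k + 1) - u k) ^ (2 * p) ≤
      ∑ k ∈ Finset.range n, (2 * (‖f (u (k + 1)) - f (u k)‖ ^ 2 / (u (k + 1) - u k) ^ (2 * p)) +
        2 * (‖g (u (k + 1)) - g (u k)‖ ^ 2 / (u (k + 1) - u k) ^ (2 * p))) := by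
    refine Finset.sum_le_sum fun k _ => ?_
    have hΔ : 0 ≤ (u (k + 1) - u k) ^ (2 * p) :=
      Real.rpow_nonneg (sub_nonneg.2 (hu k.le_succ)) _
    rw [← mul_div_assoc, ← mul_div_assoc, ← add_div]
    refine div_le_div_of_nonneg_right ?_ hΔ
    have : ‖f (u (k + 1)) - g (u (k + 1)) - (f (u k) - g (u k))‖ ≤
        ‖f (u (k + 1)) - f (u k)‖ + ‖g (u (k + 1)) - g (u k)‖ := by
      rw [sub_sub_sub_comm]; exact norm_sub_le _ _
    nlinarith [norm_nonneg (f (u (k + 1)) - g (u (k + 1)) - (f (u k) - g (u k))),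
      sq_nonneg (‖f (u (k + 1)) - f (u k)‖ - ‖g (u (k + 1)) - g (u k)‖)]
  rw [Finset.sum_add_distrib, ← Finset.mul_sum, ← Finset.mul_sum] at h3
  linarith

lemma norm_sq_div_le (h : EnergyOn S p M f) {s t : ℝ} (hst : s ≤ t) (hs : s ∈ S) (ht : t ∈ S) :
    ‖f t - f s‖ ^ 2 / (t - s) ^ (2 * p) ≤ M ^ 2 := by
  have := h 1 (fun k => if k = 0 then s else t) (monotone_nat_of_le_succ fun k => by
    by_cases hk : k = 0 <;> simp [hk, hst]) fun k => by by_cases hk : k = 0 <;> simp [hk, hs, ht]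
  simpa using this

lemma norm_le (h : EnergyOn S p M f) (hM : 0 ≤ M) {s t : ℝ} (hst : s ≤ t)
    (hs : s ∈ S) (ht : t ∈ S) : ‖f t - f s‖ ≤ M * (t - s) ^ p := by
  rcases hst.eq_or_lt with rfl | hlt
  · simpa using mul_nonneg hM (Real.rpow_nonneg le_rfl p)
  have h1 := h.norm_sq_div_le hst hs ht
  have hpos := Real.rpow_pos_of_pos (sub_pos.2 hlt) p
  rw [mul_comm 2 p, Real.rpow_mul (sub_nonneg.2 hst), Real.rpow_two, ← div_pow] at h1
  rw [← div_le_iff₀ hpos]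
  exact (sq_le_sq₀ (by positivity) hM).1 h1

/-- Interpolation between an energy bound of higher order and a uniform bound. -/
lemma interpolate {q δ η : ℝ} (h : EnergyOn (Icc 0 1) q M f) (hp : 0 ≤ p) (hpq : p ≤ q)
    (hη : 0 < η) (hδ : ∀ t, ‖f t‖ ≤ δ)
    (hle : η ^ (2 * (q - p)) * M ^ 2 + 4 * δ ^ 2 / η ^ (2 * p + 1) ≤ M' ^ 2) :
    EnergyOn (Icc 0 1) p M' f := by
  intro n u hu hS
  have hδ0 : 0 ≤ δ := (norm_nonneg _).trans (hδ 0)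
  refine le_trans ?_ hle
  have h1 := h n u hu hS
  have h2 : ∑ k ∈ Finset.range n, (u (k + 1) - u k) ≤ 1 := by
    rw [Finset.sum_range_sub]; linarith [(hS n).2, (hS 0).1]
  -- Each interval of length Δ > 0 is estimated by one of the two summands. If Δ ≤ η, lowering the
  -- order gains Δ^(2(q - p)). If Δ > η, the increment is at most 2δ and Δ^(-2p) ≤ Δ / η^(2p + 1);
  -- these lengths add up to at most 1.
  calc _ ≤ ∑ k ∈ Finset.range n, (η ^ (2 * (q - p)) *
        (‖f (u (k + 1)) - f (u k)‖ ^ 2 / (u (k + 1) - u k) ^ (2 * q)) +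
        4 * δ ^ 2 / η ^ (2 * p + 1) * (u (k + 1) - u k)) := by
        refine Finset.sum_le_sum fun k _ => ?_
        have hΔ : 0 ≤ u (k + 1) - u k := sub_nonneg.2 (hu k.le_succ)
        set Δ := u (k + 1) - u k with hΔd
        rcases hΔ.eq_or_lt with h0 | h0
        · have : f (u (k + 1)) - f (u k) = 0 := by
            rw [sub_eq_zero.1 (hΔd.symm.trans h0.symm), sub_self]
          rw [this, ← h0]; simp
        rcases le_or_gt Δ η with hle | hgt
        · have e : Δ ^ (2 * q) = Δ ^ (2 * p) * Δ ^ (2 * (q - p)) := by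
            rw [← Real.rpow_add h0]; congr 1; ring
          have hx : ‖f (u (k + 1)) - f (u k)‖ ^ 2 / Δ ^ (2 * p) =
              Δ ^ (2 * (q - p)) * (‖f (u (k + 1)) - f (u k)‖ ^ 2 / Δ ^ (2 * q)) := by
            rw [e]
            have := (Real.rpow_pos_of_pos h0 (2 * (q - p))).ne'
            have := (Real.rpow_pos_of_pos h0 (2 * p)).ne'
            field_simp
          rw [hx]
          refine le_add_of_le_of_nonneg (mul_le_mul_of_nonneg_right
            (Real.rpow_le_rpow hΔ hle (by linarith)) (by positivity)) (by positivity)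
        · refine le_add_of_nonneg_of_le (by positivity) ?_
          have hn : ‖f (u (k + 1)) - f (u k)‖ ≤ 2 * δ :=
            (norm_sub_le _ _).trans (by linarith [hδ (u (k + 1)), hδ (u k)])
          have hn2 : ‖f (u (k + 1)) - f (u k)‖ ^ 2 ≤ 4 * δ ^ 2 := by
            nlinarith [norm_nonneg (f (u (k + 1)) - f (u k))]
          have hηp := Real.rpow_pos_of_pos hη (2 * p)
          calc _ ≤ 4 * δ ^ 2 / η ^ (2 * p) :=
                div_le_div₀ (by positivity) hn2 hηp
                  (Real.rpow_le_rpow hη.le hgt.le (by linarith))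
            _ = 4 * δ ^ 2 / η ^ (2 * p + 1) * η := by
                rw [Real.rpow_add hη, Real.rpow_one]; field_simp
            _ ≤ _ := mul_le_mul_of_nonneg_left hgt.le (by positivity)
    _ ≤ _ := by
        rw [Finset.sum_add_distrib, ← Finset.mul_sum, ← Finset.mul_sum]
        exact add_le_add (mul_le_mul_of_nonneg_left h1 (by positivity))
          (mul_le_of_le_one_right (by positivity) h2)

/-- A path of finite energy is dominated by a mixed gauge. -/
lemma exists_control (h : EnergyOn (Icc 0 1) p M f) (hM : 0 ≤ M) :
    ∃ F : ℝ → ℝ, Monotone F ∧ (∀ t, F t ∈ Icc (0 : ℝ) 1) ∧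
      ∀ s t, 0 ≤ s → s ≤ t → t ≤ 1 → ‖f t - f s‖ ≤ M * mixGauge F p s t := by
  -- V t, the supremum of energy sums over [0,t], grows by at least the term of [s,t] when passing
  -- from s to t (`hstep`). Normalised by M² it is the required increasing function.
  set sums : ℝ → Set ℝ := fun t => {x | ∃ (n : ℕ) (u : ℕ → ℝ), Monotone u ∧
    (∀ k, u k ∈ Icc (0 : ℝ) t) ∧ x = ∑ k ∈ Finset.range n,
      ‖f (u (k + 1)) - f (u k)‖ ^ 2 / (u (k + 1) - u k) ^ (2 * p)} with hsums
  set V : ℝ → ℝ := fun t => sSup (sums t) with hV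
  have hzero : ∀ t, 0 ≤ t → (0 : ℝ) ∈ sums t := fun t ht =>
    ⟨0, fun _ => 0, monotone_const, fun _ => ⟨le_rfl, ht⟩, by simp⟩
  have hup : ∀ t, t ≤ 1 → M ^ 2 ∈ upperBounds (sums t) := by
    rintro t ht _ ⟨n, u, hu, hS, rfl⟩
    exact h n u hu fun k => ⟨(hS k).1, (hS k).2.trans ht⟩
  have hstep : ∀ s t, 0 ≤ s → s ≤ t → t ≤ 1 →
      V s + ‖f t - f s‖ ^ 2 / (t - s) ^ (2 * p) ≤ V t := by
    intro s t hs hst ht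
    rw [← le_sub_iff_add_le]
    refine csSup_le ⟨0, hzero s hs⟩ ?_
    rintro _ ⟨n, u, hu, hS, rfl⟩
    rw [le_sub_iff_add_le]
    -- The nodes s and t are appended to a partition of [0,s]; the connecting interval [u n, s] only
    -- adds a nonnegative term.
    set w : ℕ → ℝ := fun k => if k ≤ n then u k else if k = n + 1 then s else t with hw
    have hw1 : ∀ k ≤ n, w k = u k := fun k hk => by simp [hw, hk]
    have hw2 : w (n + 1) = s := by simp [hw]
    have hw3 : ∀ k, n + 2 ≤ k → w k = t := fun k hk => by
      simp [hw, show ¬ k ≤ n by omega, show k ≠ n + 1 by omega]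
    have hwm : Monotone w := by
      refine monotone_nat_of_le_succ fun k => ?_
      rcases lt_trichotomy k n with hk | rfl | hk
      · rw [hw1 k hk.le, hw1 _ hk]; exact hu k.le_succ
      · rw [hw1 k le_rfl, hw2]; exact (hS k).2
      · rcases (Nat.succ_le_of_lt hk).eq_or_lt with rfl | hk'
        · rw [hw2, hw3 _ le_rfl]; exact hst
        · rw [hw3 k hk', hw3 _ (by omega)]
    have hwS : ∀ k, w k ∈ Icc (0 : ℝ) t := by
      intro k
      rcases le_or_gt k n with hk | hk
      · rw [hw1 k hk]; exact ⟨(hS k).1, (hS k).2.trans hst⟩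
      · rcases (Nat.succ_le_of_lt hk).eq_or_lt with rfl | hk'
        · rw [hw2]; exact ⟨hs, hst⟩
        · rw [hw3 k hk']; exact ⟨hs.trans hst, le_rfl⟩
    refine le_trans ?_ (le_csSup ⟨_, hup t ht⟩ ⟨n + 2, w, hwm, hwS, rfl⟩)
    rw [Finset.sum_range_succ, Finset.sum_range_succ, hw3 _ le_rfl, hw2]
    refine add_le_add (le_add_of_le_of_nonneg (Finset.sum_le_sum fun k hk => ?_) ?_) le_rfl
    · have hk := Finset.mem_range.1 hk
      rw [hw1 k hk.le, hw1 _ hk]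
    · exact div_nonneg (by positivity) (Real.rpow_nonneg (sub_nonneg.2 (by
        rw [← hw2]; exact hwm n.le_succ)) _)
  have hmono : ∀ s t, 0 ≤ s → s ≤ t → t ≤ 1 → V s ≤ V t := fun s t hs hst ht =>
    (le_add_of_nonneg_right (div_nonneg (by positivity)
      (Real.rpow_nonneg (sub_nonneg.2 hst) _))).trans (hstep s t hs hst ht)
  have hV0 : ∀ t, 0 ≤ t → t ≤ 1 → 0 ≤ V t := fun t h0 h1 => le_csSup ⟨_, hup t h1⟩ (hzero t h0)
  have hV1 : ∀ t, 0 ≤ t → t ≤ 1 → V t ≤ M ^ 2 := fun t h0 h1 => csSup_le ⟨0, hzero t h0⟩ (hup t h1)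
  refine ⟨fun t => V (projIcc 0 1 zero_le_one t) / M ^ 2, fun s t hst => ?_, fun t => ?_,
    fun s t hs hst ht => ?_⟩
  · exact div_le_div_of_nonneg_right (hmono _ _ (projIcc 0 1 zero_le_one s).2.1
      (monotone_projIcc zero_le_one hst) (projIcc 0 1 zero_le_one t).2.2) (by positivity)
  · have h2 := (projIcc (0 : ℝ) 1 zero_le_one t).2
    exact ⟨div_nonneg (hV0 _ h2.1 h2.2) (by positivity),
      div_le_one_of_le₀ (hV1 _ h2.1 h2.2) (by positivity)⟩
  · have hss : s ∈ Icc (0 : ℝ) 1 := ⟨hs, hst.trans ht⟩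
    have htt : t ∈ Icc (0 : ℝ) 1 := ⟨hs.trans hst, ht⟩
    rcases hst.eq_or_lt with rfl | hlt
    · simp only [sub_self, norm_zero, mixGauge]
      have := Real.rpow_nonneg (le_refl (0 : ℝ)) p
      positivity
    have h1 := hstep s t hs hst ht
    have h2 := hmono s t hs hst ht
    have hpos := Real.rpow_pos_of_pos (sub_pos.2 hlt) p
    simp only [mixGauge, projIcc_of_mem zero_le_one hss, projIcc_of_mem zero_le_one htt]
    rw [mul_comm 2 p, Real.rpow_mul (sub_nonneg.2 hst), Real.rpow_two, ← div_pow] at h1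
    rcases hM.eq_or_lt with rfl | hM
    · have := hV1 t htt.1 htt.2
      have := hV0 s hss.1 hss.2
      have h3 : (‖f t - f s‖ / (t - s) ^ p) ^ 2 ≤ 0 := by linarith
      have h4 : ‖f t - f s‖ / (t - s) ^ p = 0 := by nlinarith
      rcases div_eq_zero_iff.1 h4 with h5 | h5
      · rw [h5]; simp
      · exact absurd h5 hpos.ne'
    · have h3 : ‖f t - f s‖ / (t - s) ^ p ≤ √(V t - V s) := Real.le_sqrt_of_sq_le (by linarith)
      rw [div_le_iff₀ hpos] at h3
      rw [← sub_div, Real.sqrt_div (by linarith), Real.sqrt_sq hM.le]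
      refine h3.trans (le_of_eq ?_)
      field_simp

end EnergyOn

end

/-! ### Mollification of paths of finite energy -/

section

variable {E : Type*} [NormedAddCommGroup E]

lemma EnergyOn.mono_exponent {p q M : ℝ} {f : ℝ → E} (h : EnergyOn (Icc 0 1) q M f)
    (hpq : p ≤ q) : EnergyOn (Icc 0 1) p M f := by
  intro n u hu hS
  refine le_trans (Finset.sum_le_sum fun k _ => ?_) (h n u hu hS)
  have hΔ : 0 ≤ u (k + 1) - u k := sub_nonneg.2 (hu k.le_succ)
  rcases hΔ.eq_or_lt with h0 | h0
  · have : f (u (k + 1)) - f (u k) = 0 := by rw [sub_eq_zero.1 h0.symm, sub_self]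
    rw [this]; simp
  · exact div_le_div_of_nonneg_left (by positivity) (Real.rpow_pos_of_pos h0 _)
      (Real.rpow_le_rpow_of_exponent_ge h0 (by linarith [(hS (k + 1)).2, (hS k).1])
        (by linarith))

lemma EnergyOn.norm_le_abs {p M : ℝ} {f : ℝ → E} (h : EnergyOn univ p M f) (hM : 0 ≤ M)
    (s t : ℝ) : ‖f t - f s‖ ≤ M * |t - s| ^ p := by
  rcases le_total s t with hst | hst
  · rw [abs_of_nonneg (sub_nonneg.2 hst)]
    exact h.norm_le hM hst (mem_univ _) (mem_univ _)
  · rw [norm_sub_rev, abs_sub_comm, abs_of_nonneg (sub_nonneg.2 hst)]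
    exact h.norm_le hM hst (mem_univ _) (mem_univ _)

lemma exists_pos_mul_rpow_le {q C ε : ℝ} (hq : 0 < q) (hε : 0 < ε) :
    ∃ η > 0, C * η ^ q ≤ ε := by
  have h1 : Tendsto (fun η : ℝ => C * η ^ q) (𝓝[>] 0) (𝓝 0) := by
    have := ((Real.continuousAt_rpow_const 0 q (Or.inr hq.le)).tendsto.const_mul C).mono_left
      (nhdsWithin_le_nhds (s := Ioi 0))
    simpa [Real.zero_rpow hq.ne'] using this
  obtain ⟨η, h2, h3⟩ := ((h1.eventually_le_const hε).and self_mem_nhdsWithin).exists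
  exact ⟨η, h3, h2⟩

lemma EnergyOn.continuous {p M : ℝ} {f : ℝ → E} (h : EnergyOn univ p M f) (hp : 0 < p)
    (hM : 0 ≤ M) : Continuous f := by
  refine Metric.continuous_iff.2 fun s ε hε => ?_
  obtain ⟨η, hη, hη'⟩ := exists_pos_mul_rpow_le (C := M) hp (half_pos hε)
  refine ⟨η, hη, fun t ht => ?_⟩
  rw [dist_eq_norm]
  have h1 : |t - s| ^ p ≤ η ^ p :=
    Real.rpow_le_rpow (abs_nonneg _) (by rw [← Real.dist_eq]; exact ht.le) hp.le
  linarith [h.norm_le_abs hM s t, mul_le_mul_of_nonneg_left h1 hM]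

variable [NormedSpace ℝ E] [CompleteSpace E]

open ContinuousLinearMap in
/-- Averaging the translates of a path does not increase its energy. -/
lemma EnergyOn.convolution {p M : ℝ} {f : ℝ → E} (h : EnergyOn univ p M f) (hf : Continuous f)
    (hM : 0 ≤ M) (φ : ContDiffBump (0 : ℝ)) :
    EnergyOn univ p M (MeasureTheory.convolution (φ.normed volume) f (lsmul ℝ ℝ) volume) := by
  intro n u hu _
  set ρ := φ.normed volume
  have hρc : Continuous ρ := φ.continuous_normed
  have hρs : HasCompactSupport ρ := φ.hasCompactSupport_normed
  have hint : ∀ z : ℝ → E, Continuous z → Integrable fun y => ρ y • z y := fun z hz =>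
    (hρc.smul hz).integrable_of_hasCompactSupport hρs.smul_right
  -- The weighted increments of the translate by y form an ℓ² vector of norm at most M, because
  -- translating the partition does not change the energy bound. The convolution averages these
  -- vectors, and the norm of an average is at most M.
  set Φ : ℝ → PiLp 2 (fun _ : Fin n => E) := fun y => WithLp.toLp 2 fun k =>
    ((u (k + 1) - u k) ^ p)⁻¹ • (f (u (k + 1) - y) - f (u k - y)) with hΦ
  have hΔ : ∀ k, 0 ≤ (u (k + 1) - u k) ^ p := fun k =>
    Real.rpow_nonneg (sub_nonneg.2 (hu k.le_succ)) _
  have hsq : ∀ (k : ℕ) (x : E), ‖((u (k + 1) - u k) ^ p)⁻¹ • x‖ ^ 2 =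
      ‖x‖ ^ 2 / (u (k + 1) - u k) ^ (2 * p) := fun k x => by
    rw [norm_smul, norm_inv, Real.norm_of_nonneg (hΔ k), mul_comm 2 p,
      Real.rpow_mul (sub_nonneg.2 (hu k.le_succ)), Real.rpow_two, mul_pow, inv_pow, div_eq_inv_mul]
  have hΦc : Continuous Φ := by
    refine (PiLp.continuous_toLp 2 _).comp (continuous_pi fun k => ?_)
    fun_prop
  have hΦn : ∀ y, ‖Φ y‖ ≤ M := fun y => by
    refine (sq_le_sq₀ (norm_nonneg _) hM).1 ?_
    rw [PiLp.norm_sq_eq_of_L2]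
    simp only [hΦ, hsq]
    rw [Fin.sum_univ_eq_sum_range fun k =>
      ‖f (u (k + 1) - y) - f (u k - y)‖ ^ 2 / (u (k + 1) - u k) ^ (2 * p)]
    have := h n (fun k => u k - y) (fun i j hij => sub_le_sub_right (hu hij) y) fun _ => mem_univ _
    simpa only [sub_sub_sub_cancel_right] using this
  have hΦi : Integrable fun y => ρ y • Φ y :=
    (hρc.smul hΦc).integrable_of_hasCompactSupport hρs.smul_right
  have h1 : ‖∫ y, ρ y • Φ y‖ ≤ M := by
    have h2 : ‖∫ y, ρ y • Φ y‖ ≤ ∫ y, ρ y * M := by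
      refine norm_integral_le_of_norm_le (φ.integrable_normed.mul_const M) (ae_of_all _ fun y => ?_)
      rw [norm_smul, Real.norm_of_nonneg (φ.nonneg_normed y)]
      exact mul_le_mul_of_nonneg_left (hΦn y) (φ.nonneg_normed y)
    rwa [integral_mul_const, φ.integral_normed, one_mul] at h2
  have h3 : ∀ k : Fin n, (∫ y, ρ y • Φ y) k = ((u (k + 1) - u k) ^ p)⁻¹ •
      (MeasureTheory.convolution ρ f (lsmul ℝ ℝ) volume (u (k + 1)) -
        MeasureTheory.convolution ρ f (lsmul ℝ ℝ) volume (u k)) := fun k => by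
    have e := (PiLp.proj 2 (𝕜 := ℝ) (fun _ : Fin n => E) k).integral_comp_comm hΦi
    simp only [PiLp.proj_apply] at e
    rw [← e, convolution_lsmul, convolution_lsmul, ← integral_sub (hint _ (by fun_prop))
      (hint _ (by fun_prop)), ← integral_smul]
    refine integral_congr_ae (ae_of_all _ fun y => ?_)
    simp only [hΦ, PiLp.smul_apply]
    rw [← smul_sub, smul_comm]
  calc _ = ‖∫ y, ρ y • Φ y‖ ^ 2 := by
        rw [PiLp.norm_sq_eq_of_L2]
        simp only [h3, hsq]
        rw [Fin.sum_univ_eq_sum_range fun k =>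
          ‖MeasureTheory.convolution ρ f (lsmul ℝ ℝ) volume (u (k + 1)) -
            MeasureTheory.convolution ρ f (lsmul ℝ ℝ) volume (u k)‖ ^ 2 /
            (u (k + 1) - u k) ^ (2 * p)]
    _ ≤ _ := pow_le_pow_left₀ (norm_nonneg _) h1 2

/-- Paths of finite energy are approximated by smooth paths in the energy of lower order. -/
lemma EnergyOn.exists_contDiff {p q M M' : ℝ} {f : ℝ → E} (h : EnergyOn univ q M f) (hp : 0 ≤ p)
    (hpq : p < q) (hM : 0 ≤ M) (hM' : 0 < M') :
    ∃ g : ℝ → E, ContDiff ℝ ∞ g ∧ EnergyOn (Icc 0 1) p M g ∧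
      EnergyOn (Icc 0 1) p M' fun t => g t - f t := by
  have hf := h.continuous (hp.trans_lt hpq) hM
  -- The difference of the mollified and the original path has energy at most 2M at order q. First η
  -- makes the short-interval term of `EnergyOn.interpolate` at most M'²/2; then the mollification
  -- radius makes the uniform distance so small that the long-interval term is M'²/2 as well.
  obtain ⟨η, hη, hη'⟩ := exists_pos_mul_rpow_le (C := (2 * M) ^ 2) (q := 2 * (q - p))
    (by linarith) (ε := M' ^ 2 / 2) (by positivity)
  have hηp := Real.rpow_pos_of_pos hη (2 * p + 1)
  obtain ⟨r, hr, hr'⟩ := exists_pos_mul_rpow_le (C := M) (hp.trans_lt hpq)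
    (ε := M' * √(η ^ (2 * p + 1) / 8)) (by positivity)
  let φ : ContDiffBump (0 : ℝ) := ⟨r / 2, r, by positivity, by linarith⟩
  have hg := (h.convolution hf hM φ).mono_set (subset_univ (Icc 0 1))
  refine ⟨_, φ.hasCompactSupport_normed.contDiff_convolution_left _ φ.contDiff_normed
    hf.locallyIntegrable, hg.mono_exponent hpq.le,
    (hg.sub_two (h.mono_set (subset_univ _))).interpolate hp hpq.le hη
      (δ := M' * √(η ^ (2 * p + 1) / 8)) (fun t => ?_) ?_⟩
  · rw [← dist_eq_norm]
    refine φ.dist_normed_convolution_le hf.aestronglyMeasurable fun s hs => ?_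
    rw [dist_eq_norm]
    refine (h.norm_le_abs hM t s).trans (le_trans (mul_le_mul_of_nonneg_left
      (Real.rpow_le_rpow (abs_nonneg _) ?_ (by linarith)) hM) hr')
    rw [← Real.dist_eq]
    exact (Metric.mem_ball.1 hs).le
  · rw [mul_pow M', Real.sq_sqrt (by positivity)]
    have : 4 * (M' ^ 2 * (η ^ (2 * p + 1) / 8)) / η ^ (2 * p + 1) = M' ^ 2 / 2 := by
      field_simp; norm_num
    linarith

end

/-! ### The energy of Cameron-Martin paths -/

/-- Concavity of x ↦ x^p: the points a + c and b are convex combinations of a and b + c with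
complementary weights. -/
lemma rpow_add_sub_rpow_le {p a b c : ℝ} (hp : 0 ≤ p) (hp1 : p ≤ 1) (ha : 0 ≤ a) (hab : a ≤ b)
    (hc : 0 ≤ c) : (b + c) ^ p - b ^ p ≤ (a + c) ^ p - a ^ p := by
  have hL : 0 ≤ b + c - a := by linarith
  rcases hL.eq_or_lt with h0 | h0
  · have h1 : a = b := by linarith
    rw [h1]
  have hcon := Real.concaveOn_rpow hp hp1
  have hw : c / (b + c - a) + (b - a) / (b + c - a) = 1 := by
    rw [← add_div, div_eq_one_iff_eq h0.ne']; ring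
  have h1 := hcon.2 (x := b + c) (y := a) (by simp; linarith) (by simpa using ha)
    (div_nonneg hc h0.le) (div_nonneg (sub_nonneg.2 hab) h0.le) hw
  have h2 := hcon.2 (x := a) (y := b + c) (by simpa using ha) (by simp; linarith)
    (div_nonneg hc h0.le) (div_nonneg (sub_nonneg.2 hab) h0.le) hw
  have e1 : c / (b + c - a) * (b + c) + (b - a) / (b + c - a) * a = a + c := by
    field_simp; ring
  have e2 : c / (b + c - a) * a + (b - a) / (b + c - a) * (b + c) = b := by
    field_simp; ring
  simp only [smul_eq_mul, e1, e2] at h1 h2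
  have h3 : (c / (b + c - a) + (b - a) / (b + c - a)) * (a ^ p + (b + c) ^ p) ≤
    (a + c) ^ p + b ^ p := by linarith
  rw [hw] at h3
  linarith

/-- The covariance of two increments of fractional Brownian motion. -/
noncomputable def fbmIncrCov (H s t s' t' : ℝ) : ℝ :=
  fbmCov H t t' - fbmCov H t s' - fbmCov H s t' + fbmCov H s s'

lemma fbmIncrCov_comm (H s t s' t' : ℝ) : fbmIncrCov H s t s' t' = fbmIncrCov H s' t' s t := by
  simp only [fbmIncrCov, fbmCov, abs_sub_comm t', abs_sub_comm s']
  ring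

/-- The increments of fractional Brownian motion with Hurst parameter `H ≤ 1/2` are negatively
correlated, so that the rows of their covariance matrix are summable. -/
lemma sum_abs_fbmIncrCov_le {H : ℝ} (h0 : 0 < H) (h1 : H ≤ 1 / 2) {u : ℕ → ℝ} (hu : Monotone u)
    {n j : ℕ} (hj : j < n) :
    ∑ k ∈ Finset.range n, |fbmIncrCov H (u j) (u (j + 1)) (u k) (u (k + 1))| ≤
      2 * (u (j + 1) - u j) ^ (2 * H) := by
  set D := (u (j + 1) - u j) ^ (2 * H) with hD
  -- Row j of the covariance matrix consists of the differences T (k + 1) - T k. By concavity T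
  -- decreases everywhere except across k = j, where it jumps from -D/2 to D/2.
  set T : ℕ → ℝ := fun k => (|u k - u j| ^ (2 * H) - |u k - u (j + 1)| ^ (2 * H)) / 2 with hT
  have hG : ∀ k, fbmIncrCov H (u j) (u (j + 1)) (u k) (u (k + 1)) = T (k + 1) - T k := fun k => by
    simp only [fbmIncrCov, fbmCov, hT]; ring
  have hz : |(0 : ℝ)| ^ (2 * H) = 0 := by rw [abs_zero, Real.zero_rpow (by linarith)]
  have hjj : 0 ≤ u (j + 1) - u j := sub_nonneg.2 (hu j.le_succ)
  have hTj : T j = -(D / 2) := by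
    simp only [hT, sub_self, hz, abs_sub_comm (u j), abs_of_nonneg hjj]; ring
  have hTj' : T (j + 1) = D / 2 := by
    simp only [hT, sub_self, hz, abs_of_nonneg hjj]; ring
  have hneg : ∀ k, k ≠ j → T (k + 1) ≤ T k := by
    intro k hk
    have hkk : 0 ≤ u (k + 1) - u k := sub_nonneg.2 (hu k.le_succ)
    rcases lt_or_gt_of_ne hk with hk | hk
    · have a0 : 0 ≤ u j - u (k + 1) := sub_nonneg.2 (hu hk)
      have := rpow_add_sub_rpow_le (p := 2 * H) (by linarith) (by linarith) a0
        (b := u (j + 1) - u (k + 1)) (by linarith) hkk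
      simp only [sub_add_sub_cancel] at this
      simp only [hT, abs_sub_comm (u k), abs_sub_comm (u (k + 1)), abs_of_nonneg a0]
      rw [abs_of_nonneg (a := u j - u k) (by linarith),
        abs_of_nonneg (a := u (j + 1) - u k) (by linarith),
        abs_of_nonneg (a := u (j + 1) - u (k + 1)) (by linarith)]
      linarith
    · have a0 : 0 ≤ u k - u (j + 1) := sub_nonneg.2 (hu hk)
      have := rpow_add_sub_rpow_le (p := 2 * H) (by linarith) (by linarith) a0
        (b := u k - u j) (by linarith) hkk
      rw [show u k - u j + (u (k + 1) - u k) = u (k + 1) - u j by ring,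
        show u k - u (j + 1) + (u (k + 1) - u k) = u (k + 1) - u (j + 1) by ring] at this
      simp only [hT, abs_of_nonneg a0]
      rw [abs_of_nonneg (a := u k - u j) (by linarith),
        abs_of_nonneg (a := u (k + 1) - u j) (by linarith),
        abs_of_nonneg (a := u (k + 1) - u (j + 1)) (by linarith)]
      linarith
  have hT0 : T 0 ≤ 0 := by
    have a0 : 0 ≤ u j - u 0 := sub_nonneg.2 (hu j.zero_le)
    have := Real.rpow_le_rpow a0 (show u j - u 0 ≤ u (j + 1) - u 0 by linarith)
      (by linarith : 0 ≤ 2 * H)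
    simp only [hT, abs_sub_comm (u 0), abs_of_nonneg a0]
    rw [abs_of_nonneg (a := u (j + 1) - u 0) (by linarith)]
    linarith
  have hTn : 0 ≤ T n := by
    have a0 : 0 ≤ u n - u (j + 1) := sub_nonneg.2 (hu hj)
    have := Real.rpow_le_rpow a0 (show u n - u (j + 1) ≤ u n - u j by linarith)
      (by linarith : 0 ≤ 2 * H)
    simp only [hT, abs_of_nonneg a0]
    rw [abs_of_nonneg (a := u n - u j) (by linarith)]
    linarith
  have hD0 : 0 ≤ D := Real.rpow_nonneg hjj _
  -- The absolute values telescope to T 0 - T n ≤ 0, apart from the single rise at k = j, whose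
  -- correction is 2D.
  have habs : ∀ k, |T (k + 1) - T k| ≤ (T k - T (k + 1)) + if k = j then 2 * D else 0 := by
    intro k
    by_cases hk : k = j
    · subst hk
      rw [if_pos rfl, hTj, hTj', abs_of_nonneg (by linarith)]; linarith
    · rw [if_neg hk, abs_of_nonpos (by linarith [hneg k hk])]; linarith
  calc _ ≤ ∑ k ∈ Finset.range n, ((T k - T (k + 1)) + if k = j then 2 * D else 0) :=
        Finset.sum_le_sum fun k _ => by rw [hG]; exact habs k
    _ = T 0 - T n + 2 * D := by
        rw [Finset.sum_add_distrib, Finset.sum_range_sub', Finset.sum_ite_eq',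
          if_pos (Finset.mem_range.2 hj)]
    _ ≤ _ := by linarith

section

variable {d : ℕ} {H : Ioo (0 : ℝ) 1}

lemma inner_kerFun_kerFun (s t : unitInterval) (v w : EuclideanSpace ℝ (Fin d)) :
    inner ℝ (RKHS.kerFun (CameronMartin d H) s v) (RKHS.kerFun (CameronMartin d H) t w) =
      fbmCov H s t * inner ℝ v w := by
  rw [← RKHS.kernel_inner, RKHS.OfKernel.kernel_ofKernel, fbmKernel, Matrix.of_apply,
    smul_apply, real_inner_smul_left]
  simp only [fbmCov, abs_sub_comm, add_comm]
  rfl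

/-- The energy of a Cameron-Martin path along a partition of `[0,1]`. -/
lemma CameronMartin.sum_sq_div_le (hH : (H : ℝ) ≤ 1 / 2) (γ : CameronMartin d H) (n : ℕ)
    (u : ℕ → unitInterval) (hu : Monotone u) :
    ∑ k ∈ Finset.range n, ‖γ (u (k + 1)) - γ (u k)‖ ^ 2 /
      ((u (k + 1) : ℝ) - u k) ^ (2 * (H : ℝ)) ≤ 2 * ‖γ‖ ^ 2 := by
  have hum : Monotone fun k => (u k : ℝ) := fun i j hij => hu hij
  set D : ℕ → ℝ := fun k => ((u (k + 1) : ℝ) - u k) ^ (2 * (H : ℝ)) with hD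
  have hD0 : ∀ k, 0 ≤ D k := fun k => Real.rpow_nonneg (sub_nonneg.2 (hum k.le_succ)) _
  set z : ℕ → EuclideanSpace ℝ (Fin d) := fun k => γ (u (k + 1)) - γ (u k) with hz
  set x : ℕ → EuclideanSpace ℝ (Fin d) := fun k => (D k)⁻¹ • z k with hx
  set S := ∑ k ∈ Finset.range n, ‖z k‖ ^ 2 / D k with hS
  -- Duality: `g` is chosen so that its inner product with γ is, by the reproducing property, the
  -- energy sum S. Repeated nodes have D k = 0 and drop out thanks to the convention 0⁻¹ = 0.
  set g : CameronMartin d H := ∑ k ∈ Finset.range n,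
    (RKHS.kerFun (CameronMartin d H) (u (k + 1)) (x k) -
      RKHS.kerFun (CameronMartin d H) (u k) (x k)) with hg
  have hS1 : inner ℝ g γ = S := by
    rw [hg, sum_inner]
    refine Finset.sum_congr rfl fun k _ => ?_
    rw [inner_sub_left, RKHS.kerFun_inner, RKHS.kerFun_inner, ← inner_sub_right]
    change inner ℝ ((D k)⁻¹ • z k) (z k) = _
    rw [real_inner_smul_left, real_inner_self_eq_norm_sq]; ring
  have hgg : inner ℝ g g = ∑ j ∈ Finset.range n, ∑ k ∈ Finset.range n,
      fbmIncrCov H (u j) (u (j + 1)) (u k) (u (k + 1)) * inner ℝ (x j) (x k) := by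
    rw [hg, sum_inner]
    refine Finset.sum_congr rfl fun j _ => ?_
    rw [inner_sum]
    refine Finset.sum_congr rfl fun k _ => ?_
    simp only [inner_sub_left, inner_sub_right, inner_kerFun_kerFun, fbmIncrCov]
    ring
  have hDx : ∀ k, D k * ‖x k‖ ^ 2 ≤ ‖z k‖ ^ 2 / D k := fun k => by
    rw [hx]
    simp only [norm_smul, norm_inv, Real.norm_of_nonneg (hD0 k), mul_pow]
    rcases (hD0 k).eq_or_lt with h | h
    · rw [← h]; simp
    · refine le_of_eq ?_; field_simp
  -- Schur's test: the elementary bound 2‖x j‖‖x k‖ ≤ ‖x j‖² + ‖x k‖² and symmetry reduce the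
  -- quadratic form to its row sums, each at most 2 D j. With S ≤ ‖g‖ ‖γ‖ this gives S ≤ 2‖γ‖².
  have hg2 : ‖g‖ ^ 2 ≤ 2 * S := by
    rw [← real_inner_self_eq_norm_sq, hgg]
    set G : ℕ → ℕ → ℝ := fun j k => |fbmIncrCov H (u j) (u (j + 1)) (u k) (u (k + 1))| with hG
    have hGs : ∀ j k, G j k = G k j := fun j k => by simp only [hG]; rw [fbmIncrCov_comm]
    calc _ ≤ ∑ j ∈ Finset.range n, ∑ k ∈ Finset.range n,
          (G j k * ‖x j‖ ^ 2 / 2 + G k j * ‖x k‖ ^ 2 / 2) := by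
          refine Finset.sum_le_sum fun j _ => Finset.sum_le_sum fun k _ => ?_
          rw [hGs k j]
          have h1 := abs_real_inner_le_norm (x j) (x k)
          have h2 : fbmIncrCov H (u j) (u (j + 1)) (u k) (u (k + 1)) * inner ℝ (x j) (x k) ≤
              G j k * (‖x j‖ * ‖x k‖) := by
            refine (le_abs_self _).trans ?_
            rw [abs_mul]
            exact mul_le_mul_of_nonneg_left h1 (abs_nonneg _)
          have h3 : 0 ≤ G j k := abs_nonneg _
          nlinarith [mul_nonneg h3 (sq_nonneg (‖x j‖ - ‖x k‖))]
      _ = ∑ j ∈ Finset.range n, (∑ k ∈ Finset.range n, G j k) * ‖x j‖ ^ 2 := by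
          simp only [Finset.sum_add_distrib]
          rw [Finset.sum_comm (f := fun j k => G k j * ‖x k‖ ^ 2 / 2), ← Finset.sum_add_distrib]
          refine Finset.sum_congr rfl fun j _ => ?_
          rw [← Finset.sum_add_distrib, Finset.sum_mul]
          exact Finset.sum_congr rfl fun k _ => by ring
      _ ≤ ∑ j ∈ Finset.range n, 2 * (‖z j‖ ^ 2 / D j) := by
          refine Finset.sum_le_sum fun j hj => ?_
          have h1 := sum_abs_fbmIncrCov_le H.2.1 hH hum (Finset.mem_range.1 hj)
          have h2 := mul_le_mul_of_nonneg_right h1 (sq_nonneg ‖x j‖)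
          have h3 := hDx j
          simp only [hG, hD] at h2 h3 ⊢
          linarith
      _ = _ := by rw [← Finset.mul_sum]
  have hS0 : 0 ≤ S := Finset.sum_nonneg fun k _ => div_nonneg (sq_nonneg _) (hD0 k)
  have hcs : S ≤ ‖g‖ * ‖γ‖ := hS1 ▸ real_inner_le_norm g γ
  rcases hS0.eq_or_lt with h | h
  · rw [← h]; positivity
  · have h1 : S ^ 2 ≤ ‖g‖ ^ 2 * ‖γ‖ ^ 2 := by
      rw [← mul_pow]; exact pow_le_pow_left₀ hS0 hcs 2
    have h2 : S * S ≤ S * (2 * ‖γ‖ ^ 2) := by nlinarith [sq_nonneg ‖γ‖]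
    exact le_of_mul_le_mul_left h2 h

/-- Clamping the nodes to [0,1] shortens the intervals without changing the increments, and lengths
at most 1 allow the order to drop from H to p. Having the bound on the whole line makes
mollification harmless near the endpoints. -/
lemma CameronMartin.energyOn (hH : (H : ℝ) ≤ 1 / 2) {p : ℝ} (hp : 0 ≤ p) (hpH : p ≤ H)
    (γ : CameronMartin d H) :
    EnergyOn univ p (2 * ‖γ‖) fun t => γ (projIcc 0 1 zero_le_one t) := by
  intro n u hu _
  have h := γ.sum_sq_div_le hH n (fun k => projIcc 0 1 zero_le_one (u k))
    fun i j hij => monotone_projIcc zero_le_one (hu hij)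
  refine le_trans (Finset.sum_le_sum fun k _ => ?_) (h.trans ?_)
  · have hle : projIcc (0 : ℝ) 1 zero_le_one (u k) ≤ projIcc 0 1 zero_le_one (u (k + 1)) :=
      monotone_projIcc zero_le_one (hu k.le_succ)
    set a := projIcc (0 : ℝ) 1 zero_le_one (u k) with ha
    set b := projIcc (0 : ℝ) 1 zero_le_one (u (k + 1)) with hb
    have hab : (a : ℝ) ≤ b := hle
    rcases hab.eq_or_lt with h0 | h0
    · have e : γ (projIcc 0 1 zero_le_one (u (k + 1))) - γ (projIcc 0 1 zero_le_one (u k)) = 0 :=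
        sub_eq_zero.2 (congrArg γ (Subtype.ext h0.symm))
      simp only [e, norm_zero, ne_eq, OfNat.ofNat_ne_zero, not_false_eq_true, zero_pow, zero_div]
      exact div_nonneg (sq_nonneg _) (Real.rpow_nonneg (sub_nonneg.2 hab) _)
    have hle1 : (b : ℝ) - a ≤ u (k + 1) - u k := by
      have h1 := hu k.le_succ
      have ea : (a : ℝ) = max 0 (min 1 (u k)) := coe_projIcc 0 1 zero_le_one _
      have eb : (b : ℝ) = max 0 (min 1 (u (k + 1))) := coe_projIcc 0 1 zero_le_one _
      rw [ea, eb]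
      rcases max_cases 0 (min 1 (u (k + 1))) with h2 | h2 <;>
      rcases max_cases 0 (min 1 (u k)) with h3 | h3 <;>
      rcases min_cases 1 (u (k + 1)) with h4 | h4 <;>
      rcases min_cases 1 (u k) with h5 | h5 <;> linarith
    have hpos : 0 < (b : ℝ) - a := by linarith
    refine div_le_div_of_nonneg_left (by positivity) (Real.rpow_pos_of_pos hpos _) ?_
    exact (Real.rpow_le_rpow_of_exponent_ge hpos (by linarith [a.2.1, b.2.2]) (by linarith)).trans
      (Real.rpow_le_rpow hpos.le hle1 (by linarith))
  · nlinarith [sq_nonneg ‖γ‖]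

end

/-! ### Continuity of the translation -/

open PathTranslation

section

variable {d : ℕ}

/-- The difference of the translation of `X` by `g` and of `X`. -/
noncomputable def cross (X : RoughFunctional d) (g : ℝ → Tens d 1) : RoughFunctional d
  | 1 => incr g
  | 2 => cross2 X g
  | 3 => cross3 X g
  | _ => fun _ _ => 0

lemma translation_eq_add_cross (X : RoughFunctional d) (g : ℝ → Tens d 1) {i : ℕ}
    (hi : i ∈ Finset.Icc 1 3) (s t : ℝ) : translation X g i s t = X i s t + cross X g i s t := by
  match i, Finset.mem_Icc.1 hi with
  | 1, _ => rfl
  | 2, _ => rfl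
  | 3, _ => rfl

/-- The average of the three controls serves all paths at once: each increment is at most three
times that of the average, and rounding 3 up to 4 gives the clean factor 2 under the root. It is
used for g, k and g - k, so that closeness is measured in one gauge. -/
lemma exists_common_control {p M₁ M₂ M₃ : ℝ} {f₁ f₂ f₃ : ℝ → Tens d 1}
    (h₁ : EnergyOn (Icc 0 1) p M₁ f₁) (h₂ : EnergyOn (Icc 0 1) p M₂ f₂)
    (h₃ : EnergyOn (Icc 0 1) p M₃ f₃) (hM₁ : 0 ≤ M₁) (hM₂ : 0 ≤ M₂) (hM₃ : 0 ≤ M₃) :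
    ∃ F : ℝ → ℝ, Monotone F ∧ (∀ t, F t ∈ Icc (0 : ℝ) 1) ∧ ∀ s t, 0 ≤ s → s ≤ t → t ≤ 1 →
      ‖f₁ t - f₁ s‖ ≤ 2 * M₁ * mixGauge F p s t ∧ ‖f₂ t - f₂ s‖ ≤ 2 * M₂ * mixGauge F p s t ∧
      ‖f₃ t - f₃ s‖ ≤ 2 * M₃ * mixGauge F p s t := by
  obtain ⟨F₁, m₁, b₁, e₁⟩ := h₁.exists_control hM₁
  obtain ⟨F₂, m₂, b₂, e₂⟩ := h₂.exists_control hM₂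
  obtain ⟨F₃, m₃, b₃, e₃⟩ := h₃.exists_control hM₃
  have key : ∀ {F G : ℝ → ℝ} {M s t : ℝ}, 0 ≤ M → s ≤ t → F t - F s ≤ 4 * (G t - G s) →
      M * mixGauge F p s t ≤ 2 * M * mixGauge G p s t := by
    intro F G M s t hM hst hFG
    have h1 : √(F t - F s) ≤ 2 * √(G t - G s) := by
      refine (Real.sqrt_le_sqrt hFG).trans_eq ?_
      rw [Real.sqrt_mul (by norm_num), show (4 : ℝ) = 2 ^ 2 by norm_num, Real.sqrt_sq (by norm_num)]
    have h2 := mul_le_mul_of_nonneg_left h1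
      (mul_nonneg hM (Real.rpow_nonneg (sub_nonneg.2 hst) p))
    simp only [mixGauge]
    linarith
  refine ⟨fun t => (F₁ t + F₂ t + F₃ t) / 3, fun s t hst => ?_, fun t => ?_,
    fun s t hs hst ht => ?_⟩
  · have := m₁ hst; have := m₂ hst; have := m₃ hst
    simp only
    linarith
  · obtain ⟨⟨_, _⟩, ⟨_, _⟩, ⟨_, _⟩⟩ := And.intro (b₁ t) (And.intro (b₂ t) (b₃ t))
    constructor <;> linarith
  · have := m₁ hst; have := m₂ hst; have := m₃ hst
    exact ⟨(e₁ s t hs hst ht).trans (key hM₁ hst (by linarith)),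
      (e₂ s t hs hst ht).trans (key hM₂ hst (by linarith)),
      (e₃ s t hs hst ht).trans (key hM₃ hst (by linarith))⟩

variable {α r a h : ℝ}

/-- The Young integrals in the translation of a rough path by a path of finite energy exist, and
the cross terms are Lipschitz continuous on bounded sets. -/
lemma BesovParams.exists_cross_close (hP : BesovParams α r a) (hah : a ≤ h) (hp : 1 / 2 < a + h)
    (d : ℕ) (R : ℝ) (hR : 0 ≤ R) :
    ∃ C, 0 ≤ C ∧ ∀ (X Y : RoughFunctional d) (g k : ℝ → Tens d 1) (D : ℝ), IsBesovGeoRP α r X →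
      IsBesovGeoRP α r Y → 0 ≤ D → besovDist α r X 0 ≤ ENNReal.ofReal R →
      besovDist α r Y 0 ≤ ENNReal.ofReal R → besovDist α r X Y ≤ ENNReal.ofReal D →
      EnergyOn (Icc 0 1) h R g → EnergyOn (Icc 0 1) h R k →
      (EnergyOn (Icc 0 1) h D fun t => g t - k t) →
      (∀ s t, 0 ≤ s → s ≤ t → t ≤ 1 →
        (YoungIntegrable (fun u => g u - g s) g s t ∧
          YoungIntegrable (fun u => X 1 s u) g s t ∧
          YoungIntegrable (fun u => g u - g s) (X 1 0) s t) ∧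
        YoungIntegrable (fun u => lev2 g g s u) g s t ∧
        YoungIntegrable (fun u => X 2 s u) g s t ∧
        YoungIntegrable (fun v => A1 X g s v) (X 1 0) s t ∧
        YoungIntegrable (fun u => g u - g s) (fun u => X 2 u t) s t ∧
        YoungIntegrable (fun u => X 1 s u) (fun u => lev2 g g u t) s t ∧
        YoungIntegrable (fun v => lev2 g (X 1 0) s v) g s t ∧
        YoungIntegrable (fun u => lev2 g g s u) (X 1 0) s t) ∧
      ∀ i ∈ Finset.Icc 1 3, ∀ s t, 0 ≤ s → s ≤ t → t ≤ 1 →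
        ‖cross X g i s t - cross Y k i s t‖ ≤ C * D * (t - s) ^ ((i - 1) * a + h) := by
  obtain ⟨K₀, hK₀, close⟩ := IsBesovGeoRP.exists_close hP d R hR
  -- The terms 2R and 2 absorb the factor 2 of `exists_common_control`, for the two paths and for
  -- their difference respectively.
  set K := K₀ + 2 * R + 2 with hKd
  have hK : 0 ≤ K := by positivity
  have hS0 : 0 ≤ sewConst (a + h) := sewConst_nonneg _
  set S := sewConst (a + h) with hS
  set c := 2 * K * K * S with hc
  set D₁ := 2 * (K + 2 * K * K) * K * S with hD₁
  set D₂ := 2 * (c + 2 * K * K) * K * S with hD₂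
  have hc0 : 0 ≤ c := by positivity
  have hD₁0 : 0 ≤ D₁ := by positivity
  have hD₂0 : 0 ≤ D₂ := by positivity
  refine ⟨K + (c + c + c) + (D₁ + D₂ + D₁ + D₂ + D₂ + D₂ + D₂), by positivity,
    fun X Y g k D hX hY hD hXR hYR hXY hg hk hgk => ?_⟩
  obtain ⟨F, hF, hF1, hFb⟩ := exists_common_control hg hk hgk hR hR hD
  obtain ⟨c1, c2⟩ := close X Y hX hY D hD hXR hYR hXY
  have enlarge : ∀ {E : Type} [NormedAddCommGroup E] {q : ℝ} {L L' : ℝ → ℝ → E},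
      CloseOn (powGauge q) K₀ D L L' 0 1 → CloseOn (powGauge q) K D L L' 0 1 := by
    intro E _ q L L' hL
    refine ⟨fun s t hs hst ht => (hL.left s t hs hst ht).trans ?_,
      fun s t hs hst ht => (hL.right s t hs hst ht).trans ?_,
      fun s t hs hst ht => (hL.diff s t hs hst ht).trans ?_⟩
    · exact mul_le_mul_of_nonneg_right (by linarith) (powGauge_nonneg hst)
    · exact mul_le_mul_of_nonneg_right (by linarith) (powGauge_nonneg hst)
    · exact mul_le_mul_of_nonneg_right (mul_le_mul_of_nonneg_right (by linarith) hD)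
        (powGauge_nonneg hst)
  have hclose : RoughClose F a h K D X Y g k :=
    { chen1 := hX.chen1 hP
      chen1' := hY.chen1 hP
      chen2 := hX.chen2 hP
      chen2' := hY.chen2 hP
      close1 := enlarge c1
      close2 := enlarge c2
      closeg := by
        refine ⟨fun s t hs hst ht => (hFb s t hs hst ht).1.trans ?_,
          fun s t hs hst ht => (hFb s t hs hst ht).2.1.trans ?_, fun s t hs hst ht => ?_⟩
        · exact mul_le_mul_of_nonneg_right (by linarith) (mixGauge_nonneg hst)
        · exact mul_le_mul_of_nonneg_right (by linarith) (mixGauge_nonneg hst)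
        · have := (hFb s t hs hst ht).2.2
          rw [sub_sub_sub_comm] at this
          exact this.trans (mul_le_mul_of_nonneg_right
            (mul_le_mul_of_nonneg_right (by linarith) hD) (mixGauge_nonneg hst)) }
  obtain ⟨e0, e1, e2, e3⟩ := hclose.estimates hF hF1 hP.a_pos hah hp hK hD hS hc hD₁ hD₂
  refine ⟨e0, fun i hi s t hs hst ht => ?_⟩
  match i, Finset.mem_Icc.1 hi with
  | 1, _ =>
    rw [Nat.cast_one, sub_self, zero_mul, zero_add]
    exact (e1.diff s t hs hst ht).trans (mul_le_mul_of_nonneg_right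
      (mul_le_mul_of_nonneg_right (by linarith) hD) (powGauge_nonneg hst))
  | 2, _ =>
    rw [show ((2 : ℕ) - 1 : ℝ) * a + h = a + h by push_cast; ring]
    exact (e2.diff s t hs hst ht).trans (mul_le_mul_of_nonneg_right
      (mul_le_mul_of_nonneg_right (by linarith) hD) (powGauge_nonneg hst))
  | 3, _ =>
    rw [show ((3 : ℕ) - 1 : ℝ) * a + h = a + (a + h) by push_cast; ring]
    exact (e3.diff s t hs hst ht).trans (mul_le_mul_of_nonneg_right
      (mul_le_mul_of_nonneg_right (by linarith) hD) (powGauge_nonneg hst))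

lemma BesovParams.Icc_subset (hP : BesovParams α r a) {i : ℕ} (hi : i ∈ Finset.Icc 1 ⌊1 / α⌋₊) :
    i ∈ Finset.Icc 1 3 :=
  Finset.mem_Icc.2 ⟨(Finset.mem_Icc.1 hi).1, (Finset.mem_Icc.1 hi).2.trans hP.le_three⟩

/-- A bound on the cross terms yields a bound on the distance of translations. -/
lemma BesovParams.besovDist_translation_le (hP : BesovParams α r a) (hh : h = α + 12 / r)
    {X Y : RoughFunctional d} {g k : ℝ → Tens d 1} {D : ℝ} (hD : 0 ≤ D) (hX : LevelsCont α X)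
    (hY : LevelsCont α Y) (hXg : LevelsCont α (cross X g)) (hYk : LevelsCont α (cross Y k))
    (hc : ∀ i ∈ Finset.Icc 1 3, ∀ s t, 0 ≤ s → s ≤ t → t ≤ 1 →
      ‖cross X g i s t - cross Y k i s t‖ ≤ D * (t - s) ^ ((i - 1) * a + h)) :
    besovDist α r (translation X g) (translation Y k) ≤
      besovDist α r X Y + 3 * ENNReal.ofReal D := by
  have hr := hP.r_pos
  have hlev : ∀ i ∈ Finset.Icc 1 ⌊1 / α⌋₊,
      besovNorm (i * α) (r / i) (fun s t => translation X g i s t - translation Y k i s t) ≤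
      besovNorm (i * α) (r / i) (fun s t => X i s t - Y i s t) + ENNReal.ofReal D := by
    intro i hi
    obtain ⟨i1, i3, i4⟩ := hP.one_le_div hi
    have hi' := hP.Icc_subset hi
    refine (besovNorm_le_add (by linarith) ((hX i hi).sub (hY i hi))
      ((hXg i hi).sub (hYk i hi)) fun s t hs hst ht => ?_).trans (add_le_add le_rfl
      (besovNorm_le_of_le (q := (i - 1) * a + h) (by linarith) hD ?_
        fun s t hs hst ht => hc i hi' s t hs hst.le ht))
    · rw [translation_eq_add_cross _ _ hi', translation_eq_add_cross _ _ hi', add_sub_add_comm]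
      exact norm_add_le _ _
    -- Here the choice h = α + 12/r enters: replacing α by a costs (i - 1)/r, leaving the surplus
    -- (13 - i)/r over iα. The ratio (13 - i)/i is at least 1 for i ≤ 3.
    · have e : ((i - 1) * a + h - i * α) * (r / i) = (13 - i) / i := by
        rw [hh, hP.a_eq]
        have : (i : ℝ) ≠ 0 := by linarith
        field_simp
        ring
      rw [e, le_div_iff₀ (by linarith)]
      linarith
  refine (Finset.sum_le_sum hlev).trans ?_
  rw [Finset.sum_add_distrib, Finset.sum_const, nsmul_eq_mul]
  refine add_le_add le_rfl (mul_le_mul_left ?_ _)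
  rw [Nat.card_Icc]
  exact_mod_cast hP.le_three

lemma levelsCont_translation (hP : BesovParams α r a) {X : RoughFunctional d} {g : ℝ → Tens d 1}
    (hX : LevelsCont α X) (hXg : LevelsCont α (cross X g)) : LevelsCont α (translation X g) :=
  fun i hi => ((hX i hi).add (hXg i hi)).congr fun _ _ =>
    translation_eq_add_cross _ _ (hP.Icc_subset hi) _ _

/-- For smooth data the cross terms are the difference of the lifts of x + g and of x, both
continuous. -/
lemma levelsCont_cross_smoothLift (hP : BesovParams α r a) {x g : ℝ → EuclideanSpace ℝ (Fin d)}
    (hx : ContDiff ℝ ∞ x) (hg : ContDiff ℝ ∞ g) :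
    LevelsCont α (cross (smoothLift x) fun u => toTens (g u)) := fun i hi => by
  refine ((BesovParams.levelsCont_smoothLift (hx.add hg) i hi).sub
    (BesovParams.levelsCont_smoothLift hx i hi)).congr fun p hp => ?_
  have := translation_smoothLift hx hg (hP.Icc_subset hi) hp.2.1
  rw [translation_eq_add_cross _ _ (hP.Icc_subset hi)] at this
  exact eq_sub_of_add_eq' this

/-- Smooth approximation of the cross terms. -/
lemma BesovParams.exists_smooth_cross_close (hP : BesovParams α r a) (hah : a ≤ h)
    (hp : 1 / 2 < a + h) {q M : ℝ} (hq : h < q) (hM : 0 ≤ M) {X : RoughFunctional d}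
    (hX : IsBesovGeoRP α r X) {f : ℝ → EuclideanSpace ℝ (Fin d)} (hf : EnergyOn univ q M f) :
    ∃ C, 0 ≤ C ∧ ∀ D, 0 < D → D ≤ 1 → ∃ x g : ℝ → EuclideanSpace ℝ (Fin d),
      ContDiff ℝ ∞ x ∧ ContDiff ℝ ∞ g ∧ besovDist α r (smoothLift x) X ≤ ENNReal.ofReal D ∧
      ∀ i ∈ Finset.Icc 1 3, ∀ s t, 0 ≤ s → s ≤ t → t ≤ 1 →
        ‖cross (smoothLift x) (fun u => toTens (g u)) i s t -
          cross X (fun u => toTens (f u)) i s t‖ ≤ C * D * (t - s) ^ ((i - 1) * a + h) := by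
  have hX0 := hX.besovDist_zero_lt_top hP
  -- The radius covers the unit Besov ball around X, where the approximating lifts lie since D ≤ 1,
  -- and the energy M, which mollification preserves.
  set R := (besovDist α r X 0).toReal + 1 + M with hR
  have hR0 : 0 ≤ R := by positivity
  have hRe : besovDist α r X 0 + 1 ≤ ENNReal.ofReal R := by
    rw [hR, ENNReal.ofReal_add (by positivity) hM, ENNReal.ofReal_add (by positivity) zero_le_one,
      ENNReal.ofReal_toReal hX0.ne, ENNReal.ofReal_one]
    exact le_self_add
  obtain ⟨C, hC, H⟩ := hP.exists_cross_close hah hp d R hR0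
  refine ⟨C, hC, fun D hD hD1 => ?_⟩
  obtain ⟨hc, x, hx, hlim⟩ := hX
  obtain ⟨n, hn⟩ := (hlim.eventually_le_const (u := ENNReal.ofReal D)
    (ENNReal.ofReal_pos.2 hD)).exists
  obtain ⟨g, hg, hgM, hgD⟩ := hf.exists_contDiff (hP.a_pos.le.trans hah) hq hM hD
  have hsm := BesovParams.levelsCont_smoothLift (α := α) (hx n)
  refine ⟨x n, g, hx n, hg, hn, (H (smoothLift (x n)) X (fun u => toTens (g u))
    (fun u => toTens (f u)) D (isBesovGeoRP_smoothLift hP (hx n)) ⟨hc, x, hx, hlim⟩ hD.le ?_ ?_ hn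
    ?_ ?_ ?_).2⟩
  · refine (hP.besovDist_triangle hsm hc BesovParams.levelsCont_zero).trans (le_trans ?_ hRe)
    rw [add_comm]
    refine add_le_add le_rfl (hn.trans ?_)
    rw [← ENNReal.ofReal_one]
    exact ENNReal.ofReal_le_ofReal hD1
  · exact le_self_add.trans hRe
  · exact (hgM.mono hM (by rw [hR]; linarith [ENNReal.toReal_nonneg (a := besovDist α r X 0)])
      ).comp_norm fun s t => by rw [← map_sub, toTens.norm_map]
  · exact (((hf.mono_set (subset_univ _)).mono_exponent hq.le).mono hM
      (by rw [hR]; linarith [ENNReal.toReal_nonneg (a := besovDist α r X 0)])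
      ).comp_norm fun s t => by rw [← map_sub, toTens.norm_map]
  · exact hgD.comp_norm fun s t => by
      rw [← map_sub, ← map_sub, ← map_sub, toTens.norm_map]

/-- Cross terms are uniform limits of those of smooth data. Continuity is part of belonging to the
rough path space and also provides the measurability behind Minkowski's inequality. -/
lemma levelsCont_cross (hP : BesovParams α r a) (hah : a ≤ h)
    (hp : 1 / 2 < a + h) {q M : ℝ} (hq : h < q) (hM : 0 ≤ M) {X : RoughFunctional d}
    (hX : IsBesovGeoRP α r X) {f : ℝ → EuclideanSpace ℝ (Fin d)} (hf : EnergyOn univ q M f) :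
    LevelsCont α (cross X fun u => toTens (f u)) := by
  obtain ⟨C, hC, H⟩ := hP.exists_smooth_cross_close hah hp hq hM hX hf
  intro i hi
  refine continuousOn_of_uniform_approx_of_continuousOn fun U hU => ?_
  obtain ⟨ε, hε, hεU⟩ := Metric.mem_uniformity_dist.1 hU
  obtain ⟨x, g, hx, hg, -, hc⟩ := H (min 1 (ε / (2 * (C + 1)))) (lt_min one_pos (by positivity))
    (min_le_left _ _)
  refine ⟨_, levelsCont_cross_smoothLift hP hx hg i hi, fun p hp' => hεU ?_⟩
  rw [dist_comm, dist_eq_norm]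
  obtain ⟨i1, -, -⟩ := hP.one_le_div hi
  have h1 : (p.2 - p.1) ^ (((i : ℝ) - 1) * a + h) ≤ 1 :=
    Real.rpow_le_one (sub_nonneg.2 hp'.2.1) (by linarith [hp'.1, hp'.2.2])
      (add_nonneg (mul_nonneg (by linarith) hP.a_pos.le) (hP.a_pos.le.trans hah))
  have h2 : C * min 1 (ε / (2 * (C + 1))) ≤ ε / 2 := by
    refine (mul_le_mul_of_nonneg_left (min_le_right _ _) hC).trans ?_
    rw [← mul_div_assoc, div_le_div_iff₀ (by positivity) two_pos]
    nlinarith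
  have h3 := (hc i (hP.Icc_subset hi) p.1 p.2 hp'.1 hp'.2.1 hp'.2.2).trans
    (mul_le_of_le_one_right (by positivity) h1)
  linarith

/-- Translations by paths of finite energy preserve geometric rough paths. -/
theorem IsBesovGeoRP.translation (hP : BesovParams α r a) (hah : a ≤ h)
    (hp : 1 / 2 < a + h) (hh : h = α + 12 / r) {q M : ℝ} (hq : h < q) (hM : 0 ≤ M)
    {X : RoughFunctional d} (hX : IsBesovGeoRP α r X) {f : ℝ → EuclideanSpace ℝ (Fin d)}
    (hf : EnergyOn univ q M f) : IsBesovGeoRP α r (translation X fun u => toTens (f u)) := by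
  have hcc := levelsCont_cross hP hah hp hq hM hX hf
  refine ⟨levelsCont_translation hP hX.1 hcc, ?_⟩
  obtain ⟨C, hC, H⟩ := hP.exists_smooth_cross_close hah hp hq hM hX hf
  choose x g hx hg hd hc using fun n : ℕ => H (1 / ((n : ℝ) + 1)) (by positivity)
    (by rw [div_le_one (by positivity)]; linarith [n.cast_nonneg (α := ℝ)])
  refine ⟨fun n u => x n u + g n u, fun n => (hx n).add (hg n), ?_⟩
  have hlim : Tendsto (fun n : ℕ => ENNReal.ofReal (1 / ((n : ℝ) + 1)) +
      3 * ENNReal.ofReal (C * (1 / ((n : ℝ) + 1)))) atTop (𝓝 0) := by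
    have h1 := tendsto_one_div_add_atTop_nhds_zero_nat (𝕜 := ℝ)
    have h2 := ENNReal.tendsto_ofReal h1
    have h3 := ENNReal.tendsto_ofReal (h1.const_mul C)
    have h4 := h2.add (ENNReal.Tendsto.const_mul h3 (Or.inr (ENNReal.ofNat_ne_top (n := 3))))
    simpa using h4
  refine tendsto_of_tendsto_of_tendsto_of_le_of_le tendsto_const_nhds hlim (fun _ => zero_le)
    fun n => ?_
  -- The lift of the smooth sum is the translated lift, so the estimate for two translations
  -- applies.
  have e : besovDist α r (smoothLift fun u => x n u + g n u)
      (_root_.translation X fun u => toTens (f u)) =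
      besovDist α r (_root_.translation (smoothLift (x n)) fun u => toTens (g n u))
        (_root_.translation X fun u => toTens (f u)) :=
    Finset.sum_congr rfl fun i hi => besovNorm_congr fun s t _ hst _ => by
      rw [translation_smoothLift (hx n) (hg n) (hP.Icc_subset hi) hst.le]
  rw [e]
  exact (hP.besovDist_translation_le hh (by positivity) (BesovParams.levelsCont_smoothLift (hx n))
    hX.1 (levelsCont_cross_smoothLift hP (hx n) (hg n)) hcc (hc n)).trans
    (add_le_add (hd n) le_rfl)

end

/-! ### The main theorem -/

section

variable {d : ℕ} {H : Ioo (0 : ℝ) 1} {α r a h : ℝ}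

lemma youngTranslation_eq_toTens (X : RoughFunctional d) (γ : CameronMartin d H) :
    youngTranslation X γ = translation X fun t => toTens (γ (projIcc 0 1 zero_le_one t)) :=
  youngTranslation_eq X γ

lemma CameronMartin.energyOn_path (hH : (H : ℝ) ≤ 1 / 2) (hh : 0 ≤ h) (hhH : h ≤ H)
    (γ : CameronMartin d H) {M : ℝ} (hM : 2 * ‖γ‖ ≤ M) :
    EnergyOn (Icc 0 1) h M fun t => toTens (γ (projIcc 0 1 zero_le_one t)) :=
  (((γ.energyOn hH hh hhH).mono_set (subset_univ _)).mono (by positivity) hM).comp_norm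
    fun s t => by rw [← map_sub, toTens.norm_map]

lemma CameronMartin.energyOn_sub (hH : (H : ℝ) ≤ 1 / 2) (hh : 0 ≤ h) (hhH : h ≤ H)
    (γ κ : CameronMartin d H) {M : ℝ} (hM : 2 * ‖γ - κ‖ ≤ M) :
    EnergyOn (Icc 0 1) h M fun t => toTens (γ (projIcc 0 1 zero_le_one t)) -
      toTens (κ (projIcc 0 1 zero_le_one t)) := by
  have := (γ - κ).energyOn_path hH hh hhH hM
  simpa only [RKHS.coe_sub, Pi.sub_apply, map_sub] using this

/-- The translation is Lipschitz continuous on bounded sets. -/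
theorem exists_lipschitz_youngTranslation (hP : BesovParams α r a) (hah : a ≤ h)
    (hp : 1 / 2 < a + h) (hh : h = α + 12 / r) (hH : (H : ℝ) ≤ 1 / 2) (hhH : h < H) (d : ℕ)
    (R : ℝ≥0) :
    ∃ L : ℝ≥0, ∀ (X Y : RoughFunctional d) (γ κ : CameronMartin d H),
      IsBesovGeoRP α r X → IsBesovGeoRP α r Y →
      besovDist α r X 0 ≤ R → besovDist α r Y 0 ≤ R → ‖γ‖ ≤ R → ‖κ‖ ≤ R →
      besovDist α r (youngTranslation X γ) (youngTranslation Y κ) ≤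
        L * (besovDist α r X Y + edist γ κ) := by
  have hh0 : 0 ≤ h := hP.a_pos.le.trans hah
  -- The radius is doubled because the energy of γ is bounded by 2‖γ‖; for the same reason D
  -- contains 2‖γ - κ‖, whence the factor 2 in the Lipschitz constant.
  obtain ⟨C, hC, hclose⟩ := hP.exists_cross_close hah hp d (2 * R) (by positivity)
  refine ⟨1 + 3 * (C.toNNReal * 2), fun X Y γ κ hX hY hXR hYR hγ hκ => ?_⟩
  have hR2 : (R : ℝ≥0∞) ≤ ENNReal.ofReal (2 * R) := by
    rw [← ENNReal.ofReal_coe_nnreal]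
    exact ENNReal.ofReal_le_ofReal (by linarith [R.2])
  have hXY : besovDist α r X Y < ⊤ := by
    refine (hP.besovDist_triangle hX.1 BesovParams.levelsCont_zero hY.1).trans_lt ?_
    rw [besovDist_comm 0]
    exact ENNReal.add_lt_top.2 ⟨hX.besovDist_zero_lt_top hP, hY.besovDist_zero_lt_top hP⟩
  set D := (besovDist α r X Y).toReal + 2 * ‖γ - κ‖ with hDd
  have hD : 0 ≤ D := by positivity
  have hDe : ENNReal.ofReal D = besovDist α r X Y + 2 * edist γ κ := by
    rw [hDd, ENNReal.ofReal_add ENNReal.toReal_nonneg (by positivity),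
      ENNReal.ofReal_toReal hXY.ne, ENNReal.ofReal_mul two_pos.le, edist_dist, dist_eq_norm,
      ENNReal.ofReal_ofNat]
  have hle : besovDist α r X Y ≤ ENNReal.ofReal D := hDe ▸ le_self_add
  obtain ⟨-, hcr⟩ := hclose X Y _ _ D hX hY hD (hXR.trans hR2) (hYR.trans hR2) hle
    (γ.energyOn_path hH hh0 hhH.le (by linarith)) (κ.energyOn_path hH hh0 hhH.le (by linarith))
    (γ.energyOn_sub hH hh0 hhH.le κ
      (by rw [hDd]; linarith [ENNReal.toReal_nonneg (a := besovDist α r X Y)]))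
  have hcont : ∀ {Z : RoughFunctional d} (η : CameronMartin d H), IsBesovGeoRP α r Z →
      LevelsCont α (cross Z fun t => toTens (η (projIcc 0 1 zero_le_one t))) := fun η hZ =>
    levelsCont_cross hP hah hp hhH (by positivity) hZ (η.energyOn hH H.2.1.le le_rfl)
  rw [youngTranslation_eq_toTens, youngTranslation_eq_toTens]
  refine (hP.besovDist_translation_le hh (mul_nonneg hC hD) hX.1 hY.1 (hcont γ hX) (hcont κ hY)
    hcr).trans ?_
  rw [ENNReal.ofReal_mul hC, hDe]
  push_cast
  rw [show ENNReal.ofReal C = (C.toNNReal : ℝ≥0∞) from rfl]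
  set c : ℝ≥0∞ := (C.toNNReal : ℝ≥0∞)
  set x := besovDist α r X Y
  set y := edist γ κ
  calc x + 3 * (c * (x + 2 * y)) ≤ (x + y) + 3 * (c * (2 * (x + y))) := by
        gcongr
        · exact le_self_add
        · rw [mul_add]
          gcongr
          rw [two_mul]; exact le_self_add
    _ = (1 + 3 * (c * 2)) * (x + y) := by ring

/-- The translation is continuous. -/
theorem continuous_youngTranslation (hP : BesovParams α r a) (hah : a ≤ h)
    (hp : 1 / 2 < a + h) (hh : h = α + 12 / r) (hH : (H : ℝ) ≤ 1 / 2) (hhH : h < H)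
    {X : RoughFunctional d} (γ : CameronMartin d H) (hX : IsBesovGeoRP α r X) {ε : ℝ≥0∞}
    (hε : 0 < ε) :
    ∃ δ : ℝ≥0∞, 0 < δ ∧ ∀ (Y : RoughFunctional d) (κ : CameronMartin d H), IsBesovGeoRP α r Y →
      besovDist α r X Y < δ → edist γ κ < δ →
      besovDist α r (youngTranslation X γ) (youngTranslation Y κ) < ε := by
  have hX0 := hX.besovDist_zero_lt_top hP
  -- Large enough for the ball of radius R to contain the unit neighbourhoods of X and of γ, on
  -- which the Lipschitz estimate is used.
  set R : ℝ≥0 := (besovDist α r X 0).toNNReal + 1 + ‖γ‖₊ with hR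
  have hRe : besovDist α r X 0 + 1 ≤ R := by
    rw [hR]
    push_cast
    rw [ENNReal.coe_toNNReal hX0.ne]
    exact le_self_add
  have hRγ : ‖γ‖ + 1 ≤ R := by
    rw [hR]
    push_cast
    linarith [ENNReal.toReal_nonneg (a := besovDist α r X 0)]
  obtain ⟨L, hL⟩ := exists_lipschitz_youngTranslation hP hah hp hh hH hhH d R
  have hlim : Tendsto (fun δ : ℝ≥0∞ => L * (δ + δ)) (𝓝[>] 0) (𝓝 0) := by
    have h1 : Tendsto (fun δ : ℝ≥0∞ => δ + δ) (𝓝 0) (𝓝 0) := by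
      simpa using (tendsto_id (α := ℝ≥0∞) (x := 𝓝 0)).add tendsto_id
    have h2 := ENNReal.Tendsto.const_mul h1 (Or.inr (ENNReal.coe_ne_top (r := L)))
    rw [mul_zero] at h2
    exact h2.mono_left nhdsWithin_le_nhds
  obtain ⟨δ, hδ, hδ0⟩ := ((hlim.eventually_lt_const hε).and self_mem_nhdsWithin).exists
  refine ⟨min 1 δ, lt_min one_pos hδ0, fun Y κ hY hXY hγκ => ?_⟩
  refine (hL X Y γ κ hX hY (le_self_add.trans hRe) ?_ (by linarith) ?_).trans_lt
    (lt_of_le_of_lt ?_ hδ)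
  · refine (hP.besovDist_triangle hY.1 hX.1 BesovParams.levelsCont_zero).trans (le_trans ?_ hRe)
    rw [besovDist_comm Y, add_comm]
    exact add_le_add le_rfl (hXY.le.trans (min_le_left _ _))
  · have h1 : edist γ κ < 1 := hγκ.trans_le (min_le_left _ _)
    rw [edist_dist, ENNReal.ofReal_lt_one, dist_comm, dist_eq_norm] at h1
    have := norm_le_norm_add_norm_sub' κ γ
    linarith
  · gcongr
    · exact hXY.le.trans (min_le_right _ _)
    · exact hγκ.le.trans (min_le_right _ _)

end

theorem mainTheorem6 (d : ℕ) (H : Ioo (0 : ℝ) 1) (hH : 1 / 4 < (H : ℝ)) (hH' : (H : ℝ) ≤ 1 / 2)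
    (α : ℝ) (hα : 1 / (1 + (⌊1 / (H : ℝ)⌋₊ : ℝ)) < α) (hα' : α < H)
    (m : ℕ) (hm : 0 < m) (hm' : 2 / (m : ℝ) < H - α) :
    -- all the Young integrals in the definition of `τ` exist
    (∀ (X : RoughFunctional d) (γ : CameronMartin d H), IsBesovGeoRP α (12 * m) X →
      ∀ s t : ℝ, 0 ≤ s → s ≤ t → t ≤ 1 →
        YoungTranslation.Level2Exists X γ s t ∧
        (3 ≤ ⌊1 / α⌋₊ → YoungTranslation.Level3Exists X γ s t)) ∧
    -- `τ` maps into the geometric rough path space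
    (∀ (X : RoughFunctional d) (γ : CameronMartin d H), IsBesovGeoRP α (12 * m) X →
      IsBesovGeoRP α (12 * m) (youngTranslation X γ)) ∧
    -- `τ` is continuous
    (∀ (X : RoughFunctional d) (γ : CameronMartin d H), IsBesovGeoRP α (12 * m) X →
      ∀ ε : ℝ≥0∞, 0 < ε → ∃ δ : ℝ≥0∞, 0 < δ ∧
        ∀ (Y : RoughFunctional d) (κ : CameronMartin d H), IsBesovGeoRP α (12 * m) Y →
          besovDist α (12 * m) X Y < δ → edist γ κ < δ →
          besovDist α (12 * m) (youngTranslation X γ) (youngTranslation Y κ) < ε) ∧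
    -- `τ` is Lipschitz continuous on bounded sets
    (∀ R : ℝ≥0, ∃ L : ℝ≥0, ∀ (X Y : RoughFunctional d) (γ κ : CameronMartin d H),
      IsBesovGeoRP α (12 * m) X → IsBesovGeoRP α (12 * m) Y →
      besovDist α (12 * m) X 0 ≤ R → besovDist α (12 * m) Y 0 ≤ R → ‖γ‖ ≤ R → ‖κ‖ ≤ R →
      besovDist α (12 * m) (youngTranslation X γ) (youngTranslation Y κ) ≤
        L * (besovDist α (12 * m) X Y + edist γ κ)) := by
  have hm0 : (0 : ℝ) < m := by exact_mod_cast hm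
  have hm1 : (1 : ℝ) ≤ m := by exact_mod_cast hm
  have hH0 : (0 : ℝ) < H := H.2.1
  -- H > 1/4 forces ⌊1/H⌋ ≤ 3, so the lower bound on α is at least 1/4. This yields ⌊1/α⌋ ≤ 3 as
  -- well as Young's condition.
  have hα4 : 1 / 4 < α := by
    refine lt_of_le_of_lt ?_ hα
    have h1 : ⌊1 / (H : ℝ)⌋₊ < 4 := by
      rw [Nat.floor_lt (by positivity), div_lt_iff₀ hH0]
      push_cast; linarith
    have h2 : (⌊1 / (H : ℝ)⌋₊ : ℝ) ≤ 3 := by exact_mod_cast Nat.lt_succ_iff.1 h1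
    exact one_div_le_one_div_of_le (by positivity) (by linarith)
  have hα0 : 0 < α := by linarith
  have h1m : 1 / (m : ℝ) < 1 / 8 := by
    have e : 2 / (m : ℝ) = 2 * (1 / m) := by ring
    linarith
  have hr1 : 1 / (12 * (m : ℝ)) = 1 / m / 12 := by field_simp
  have hr12 : 12 / (12 * (m : ℝ)) = 1 / m := by field_simp
  have hr0 : 0 < 1 / (m : ℝ) := by positivity
  have hm2 : 2 * (1 / (m : ℝ)) < H - α := by rwa [← mul_div_assoc, mul_one]
  have hP : BesovParams α (12 * m) (α - 1 / (12 * m)) :=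
    { r_ge := by linarith
      a_eq := rfl
      a_pos := by rw [hr1]; linarith
      α_le := by linarith
      two_le := by
        rw [Nat.le_floor_iff (by positivity), le_div_iff₀ hα0]
        push_cast; linarith
      le_three := by
        refine Nat.lt_succ_iff.1 ((Nat.floor_lt (by positivity)).2 ?_)
        rw [div_lt_iff₀ hα0]
        push_cast; linarith }
  have hah : α - 1 / (12 * (m : ℝ)) ≤ α + 12 / (12 * m) := by rw [hr1, hr12]; linarith
  -- The sum is 2α + 11/(12m), and 2α alone exceeds 1/2.
  have hp : 1 / 2 < α - 1 / (12 * (m : ℝ)) + (α + 12 / (12 * m)) := by rw [hr1, hr12]; linarith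
  have hhH : α + 12 / (12 * (m : ℝ)) < H := by rw [hr12]; linarith
  refine ⟨fun X γ hX s t hs hst ht => ?_, fun X γ hX => ?_, fun X γ hX ε hε =>
    continuous_youngTranslation hP hah hp rfl hH' hhH γ hX hε,
    exists_lipschitz_youngTranslation hP hah hp rfl hH' hhH d⟩
  · have hX0 := hX.besovDist_zero_lt_top hP
    set R := (besovDist α (12 * m) X 0).toReal + 2 * ‖γ‖ with hR
    have hXR : besovDist α (12 * m) X 0 ≤ ENNReal.ofReal R := by
      rw [hR, ENNReal.ofReal_add ENNReal.toReal_nonneg (by positivity),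
        ENNReal.ofReal_toReal hX0.ne]
      exact le_self_add
    have hγ := γ.energyOn_path hH' (hP.a_pos.le.trans hah) hhH.le (M := R)
      (by rw [hR]; linarith [ENNReal.toReal_nonneg (a := besovDist α (12 * m) X 0)])
    obtain ⟨C, -, hclose⟩ := hP.exists_cross_close hah hp d R (by positivity)
    -- Existence of the integrals is the first half of the comparison statement, applied to (X, γ)
    -- and itself at distance 0.
    have hex := (hclose X X _ _ 0 hX hX le_rfl hXR hXR (by simp [besovDist_self hP]) hγ hγ
      (γ.energyOn_sub hH' (hP.a_pos.le.trans hah) hhH.le γ (by simp))).1 s t hs hst ht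
    exact ⟨hex.1, fun _ => hex.2⟩
  · rw [youngTranslation_eq_toTens]
    exact hX.translation hP hah hp rfl hhH (by positivity) (γ.energyOn hH' H.2.1.le le_rfl)
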